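/- **Setting.** $\log$ is the logarithm to base $2$, $\mathbb N=\{1,2,\dots\}$, and $\rho(x)=\max(x,0)$ acts componentwise. All functions are real-valued. *Networks.* $\mathcal N_{1,1}$ is the set of ReLU networks $\Phi=W_L\circ\rho\circ W_{L-1}\circ\dots\circ\rho\circ W_1:\mathbb R\to\mathbb R$ with $L\ge 1$ and $W_\ell(x)=A_\ell x+b_\ell$, in which every input and hidden node has an outgoing edge and the output node has an incoming edge (an edge is a non-zero entry of some $A_\ell$). The connectivity $\mathcal M(\Phi)$ is the number of non-zero entries of all $A_\ell,b_\ell$, the depth is $\mathcal L(\Phi)=L$, and the weight magnitude $\mathcal B(\Phi)$ is the largest absolute value of these entries. *Rates.* Let $\Omega\subset\mathbb R$ be a measurable set. A function class is a compact set $\mathcal C\subset L^2(\Omega)$, and a dictionary is a sequence $\mathcal D=(\varphi_i)_{i\in\mathbb N}\subset L^2(\Omega)$. Suprema of exponents are taken in $[0,\infty]$, and infima of errors over the empty set are $\infty$. - $L(\varepsilon,\mathcal C)$ is the least $\ell\in\mathbb N$ for which there are maps $E:\mathcal C\to\{0,1\}^\ell$ and $D:\{0,1\}^\ell\to L^2(\Omega)$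 with $\sup_{f\in\mathcal C}\|D(E(f))-f\|_{L^2(\Omega)}\le\varepsilon$, and $\gamma^*(\mathcal C)=\sup\{\gamma>0: L(\varepsilon,\mathcal C)\in\mathcal O(\varepsilon^{-1/\gamma}),\ \varepsilon\to0\}$. - $\gamma^{*,\mathrm{eff}}(\mathcal C,\mathcal D)$ is the supremum of all $\gamma\ge0$ for which there is a polynomial $\pi$ such that $$\sup_{f\in\mathcal C}\ \inf_{\substack{I\subset\{1,2,\dots,\pi(M)\},\ |I|=M,\\ |c_i|\le\pi(M)}}\Big\|f-\sum_{i\in I}c_i\varphi_i\Big\|_{L^2(\Omega)}\in\mathcal O(M^{-\gamma}),\quad M\to\infty.$$ $\mathcal C$ is *optimally representable by $\mathcal D$* if $\gamma^{*,\mathrm{eff}}(\mathcal C,\mathcal D)=\gamma^*(\mathcal C)$. - $\gamma_{\mathcal N}^{*,\mathrm{eff}}(\mathcal C)$ is the supremum of all $\gamma\ge0$ for which there is a polynomial $\pi$ such that $\sup_{f\in\mathcal C}\inf_\Phi\|f-\Phi\|_{L^2(\Omega)}\in\mathcal O(M^{-\gamma})$, $M\to\infty$, where $\Phi$ runs over all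 networks in $\mathcal N_{1,1}$ with $\mathcal M(\Phi)\le M$, $\mathcal L(\Phi)\le\pi(\log M)$ and $\mathcal B(\Phi)\le\pi(M)$. $\mathcal C$ is *optimally representable by neural networks* if $\gamma_{\mathcal N}^{*,\mathrm{eff}}(\mathcal C)=\gamma^*(\mathcal C)$. *Spline wavelets.* Let $N_1=\chi_{[0,1]}$ and $N_{m+1}=N_1*N_m$ be the cardinal B-splines, and let $$\psi_m(x)=\frac1{2^{m-1}}\sum_{j=0}^{2m-2}(-1)^jN_{2m}(j+1)\,N_{2m}^{(m)}(2x-j).$$ The spline wavelet system of order $m$ on $\Omega$ consists of those restrictions to $\Omega$ of $2^{n/2}\psi_m(2^n\cdot-k)$ ($n\in\mathbb N_0$, $k\in\mathbb Z$) and $N_m(\cdot-k)$ ($k\in\mathbb Z$) that are non-zero in $L^2(\Omega)$. It is canonically ordered if it is listed as $(\mathcal D_1,\mathcal D_2,\dots)$, each $\mathcal D_j$ in arbitrary order, where $\mathcal D_1$ contains the elements $\psi_m(\cdot-k)$ and $N_m(\cdot-k)$, and $\mathcal D_{n+1}$, $n\ge1$, contains the elements $2^{n/2}\psi_m(2^n\cdot-k)$.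 If differently labelled functions coincide on $\Omega$, the repetitions may be listed or omitted. **Theorem.** Let $m\in\mathbb N$. 1. Let $\Omega\subset\mathbb R$ be bounded, measurable and of non-empty interior, and let $\mathcal D=(\varphi_i)_{i\in\mathbb N}\subset L^2(\Omega)$ be the spline wavelet system of order $m$ on $\Omega$, canonically ordered. Then every function class $\mathcal C\subset L^2(\Omega)$ that is optimally representable by $\mathcal D$ is optimally representable by neural networks. 2. If $m\ge2$, there is a constant $K>0$ such that for every $\varepsilon\in(0,1/2)$ there is a network $\Phi_\varepsilon\in\mathcal N_{1,1}$ with $\sup_{x\in\mathbb R}|\Phi_\varepsilon(x)-N_m(x)|\le\varepsilon$, $\mathcal M(\Phi_\varepsilon)\le K\log(\varepsilon^{-1})$ and $\mathcal B(\Phi_\varepsilon)\le1$. 3. For almost every $x\in\mathbb R$, $$\psi_m(x)=\sum_{n=1}^{3m-1}q_n\,N_m(2x-n+1),\qquad q_n=\frac{(-1)^{n+1}}{2^{m-1}}\sum_{j=0}^m\binom mj N_{2m}(n-j).$$ -/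

import Mathlib

open MeasureTheory Filter Topology
open scoped NNReal ENNReal Polynomial

noncomputable section

/-! ### ReLU neural networks -/

/-- The affine map `x ↦ A x + b`. -/
def affineMap {d d' : ℕ} (A : Matrix (Fin d') (Fin d) ℝ) (b : Fin d' → ℝ)
    (x : Fin d → ℝ) : Fin d' → ℝ :=
  A.mulVec x + b

/-- The number of non-zero entries of `A` and of `b`. -/
def nonzeroWeights {d d' : ℕ} (A : Matrix (Fin d') (Fin d) ℝ) (b : Fin d' → ℝ) : ℕ :=
  (Finset.univ.filter fun p : Fin d' × Fin d => A p.1 p.2 ≠ 0).card +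
    (Finset.univ.filter fun i : Fin d' => b i ≠ 0).card

/-- The largest absolute value of an entry of `A` or of `b`. -/
def maxWeight {d d' : ℕ} (A : Matrix (Fin d') (Fin d) ℝ) (b : Fin d' → ℝ) : ℝ≥0 :=
  (Finset.univ.sup fun p : Fin d' × Fin d => ‖A p.1 p.2‖₊) ⊔
    (Finset.univ.sup fun i : Fin d' => ‖b i‖₊)

/-- A ReLU network, given by its weights, with input dimension `d` (first index) and output
dimension `d'` (second index): either a single affine map `W`, or `Ψ ∘ ρ ∘ W` with an affine
map `W` (the first layer) and a network `Ψ` (the remaining layers). -/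
inductive ReLUNetwork : ℕ → ℕ → Type where
  | affine {d d' : ℕ} (A : Matrix (Fin d') (Fin d) ℝ) (b : Fin d' → ℝ) : ReLUNetwork d d'
  | layer {d k d' : ℕ} (A : Matrix (Fin k) (Fin d) ℝ) (b : Fin k → ℝ)
      (Ψ : ReLUNetwork k d') : ReLUNetwork d d'

namespace ReLUNetwork

/-- The map `W_L ∘ ρ ∘ W_{L-1} ∘ ⋯ ∘ ρ ∘ W_1` realized by the network, `ρ(x) = max(x, 0)`
acting componentwise. -/
def realize : {d d' : ℕ} → ReLUNetwork d d' → (Fin d → ℝ) → (Fin d' → ℝ)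
  | _, _, affine A b, x => affineMap A b x
  | _, _, layer A b Ψ, x => Ψ.realize fun i => max (affineMap A b x i) 0

/-- The connectivity: the total number of non-zero weights. -/
def connectivity : {d d' : ℕ} → ReLUNetwork d d' → ℕ
  | _, _, affine A b => nonzeroWeights A b
  | _, _, layer A b Ψ => nonzeroWeights A b + Ψ.connectivity

/-- The depth: the number of affine maps. -/
def depth : {d d' : ℕ} → ReLUNetwork d d' → ℕ
  | _, _, affine _ _ => 1
  | _, _, layer _ _ Ψ => 1 + Ψ.depth

/-- The weight magnitude: the largest absolute value of a weight. -/
def weightMagnitude : {d d' : ℕ} → ReLUNetwork d d' → ℝ≥0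
  | _, _, affine A b => maxWeight A b
  | _, _, layer A b Ψ => maxWeight A b ⊔ Ψ.weightMagnitude

/-- Every node in the input layer and in the hidden layers has an outgoing edge, and every node
in the output layer has an incoming edge. -/
def Nondegenerate : {d d' : ℕ} → ReLUNetwork d d' → Prop
  | _, _, affine A _ => (∀ j, ∃ i, A i j ≠ 0) ∧ ∀ i, ∃ j, A i j ≠ 0
  | _, _, layer A _ Ψ => (∀ j, ∃ i, A i j ≠ 0) ∧ Ψ.Nondegenerate

/-- A network with one input and one output, as a function on the real line. -/
def toRealFun (Φ : ReLUNetwork 1 1) (x : ℝ) : ℝ :=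
  Φ.realize (fun _ => x) 0

end ReLUNetwork

/-! ### Optimal exponent and effective approximation rates -/

/-- Real-valued functions in `L²(Ω)`, for `Ω` a subset of the real line. -/
abbrev L2On (Ω : Set ℝ) := Lp ℝ 2 (volume.restrict Ω)

/-- There is an encoder-decoder pair of length `ℓ` with uniform error at most `ε` over `C`. -/
def HasCode {Ω : Set ℝ} (C : Set (L2On Ω)) (ε : ℝ) (ℓ : ℕ) : Prop :=
  ∃ (E : C → (Fin ℓ → Bool)) (D : (Fin ℓ → Bool) → L2On Ω),
    ∀ f : C, ‖D (E f) - (f : L2On Ω)‖ ≤ ε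

/-- The minimax code length `L(ε, C)` (infinite if there is no code at all). -/
def minimaxCodeLength {Ω : Set ℝ} (C : Set (L2On Ω)) (ε : ℝ) : ℕ∞ :=
  ⨅ (ℓ : ℕ) (_ : 1 ≤ ℓ ∧ HasCode C ε ℓ), (ℓ : ℕ∞)

/-- The optimal exponent `γ*(C)`: the supremum, in `[0, ∞]`, of all `γ > 0` such that
`L(ε, C) ∈ O(ε ^ (-1/γ))` as `ε → 0`. -/
def optimalExponent {Ω : Set ℝ} (C : Set (L2On Ω)) : ℝ≥0∞ :=
  ⨆ (γ : ℝ≥0) (_ : 0 < γ ∧ ∃ K : ℝ≥0, ∀ᶠ ε : ℝ in 𝓝[>] 0,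
      (minimaxCodeLength C ε : ℝ≥0∞) ≤ K * ENNReal.ofReal (ε ^ (-1 / (γ : ℝ)))), (γ : ℝ≥0∞)

/-- `e(M) ∈ O(M ^ (-γ))` as `M → ∞`, for `[0, ∞]`-valued `e`. -/
def DecaysWithRate (e : ℕ → ℝ≥0∞) (γ : ℝ≥0) : Prop :=
  ∃ K : ℝ≥0, ∀ᶠ M : ℕ in atTop, e M ≤ K * ENNReal.ofReal ((M : ℝ) ^ (-(γ : ℝ)))

/-- The worst-case error over `C` of `M`-term approximation by the dictionary `φ`, subject to
polynomial-depth search and polynomially bounded coefficients. The dictionary elements are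
numbered `1, 2, 3, …` in the mathematics; number `n` is `φ (n - 1)`. The infimum over the
empty set is `∞`. -/
def dictionaryError {Ω : Set ℝ} (C : Set (L2On Ω)) (φ : ℕ → L2On Ω) (p : ℝ[X])
    (M : ℕ) : ℝ≥0∞ :=
  ⨆ f ∈ C, ⨅ (I : Finset ℕ) (c : ℕ → ℝ)
    (_ : I.card = M ∧ (∀ i ∈ I, (i : ℝ) + 1 ≤ p.eval (M : ℝ)) ∧
      ∀ i ∈ I, |c i| ≤ p.eval (M : ℝ)),
    ‖f - ∑ i ∈ I, c i • φ i‖ₑ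

/-- The effective best `M`-term approximation rate of `C` in the dictionary `φ`. -/
def dictionaryRate {Ω : Set ℝ} (C : Set (L2On Ω)) (φ : ℕ → L2On Ω) : ℝ≥0∞ :=
  ⨆ (γ : ℝ≥0) (_ : ∃ p : ℝ[X], DecaysWithRate (dictionaryError C φ p) γ), (γ : ℝ≥0∞)

/-- The networks with one input and one output, connectivity at most `M`, depth at most
`p (log₂ M)` and weight magnitude at most `p M`. -/
def boundedNetworks (p : ℝ[X]) (M : ℕ) : Set (ReLUNetwork 1 1) :=
  {Φ | Φ.Nondegenerate ∧ Φ.connectivity ≤ M ∧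
    (Φ.depth : ℝ) ≤ p.eval (Real.logb 2 (M : ℝ)) ∧
    (Φ.weightMagnitude : ℝ) ≤ p.eval (M : ℝ)}

/-- The worst-case `L²(Ω)` error over `C` of approximation by networks in
`boundedNetworks p M`. -/
def networkError {Ω : Set ℝ} (C : Set (L2On Ω)) (p : ℝ[X]) (M : ℕ) : ℝ≥0∞ :=
  ⨆ f ∈ C, ⨅ Φ ∈ boundedNetworks p M,
    eLpNorm (fun x => f x - Φ.toRealFun x) 2 (volume.restrict Ω)

/-- The effective best `M`-weight approximation rate of `C` by neural networks. -/
def networkRate {Ω : Set ℝ} (C : Set (L2On Ω)) : ℝ≥0∞ :=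
  ⨆ (γ : ℝ≥0) (_ : ∃ p : ℝ[X], DecaysWithRate (networkError C p) γ), (γ : ℝ≥0∞)

/-- `C` is optimally representable by the dictionary `φ`. -/
def OptimallyRepresentableByDictionary {Ω : Set ℝ} (C : Set (L2On Ω)) (φ : ℕ → L2On Ω) : Prop :=
  dictionaryRate C φ = optimalExponent C

/-- `C` is optimally representable by neural networks. -/
def OptimallyRepresentableByNetworks {Ω : Set ℝ} (C : Set (L2On Ω)) : Prop :=
  networkRate C = optimalExponent C

/-! ### Spline wavelet systems -/

/-- The cardinal B-spline `N_m` of order `m`: `N_1` is the indicator function of `[0, 1]` and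
`N_{m+1} = N_1 * N_m`. The value at `m = 0` is not used. -/
def cardinalBSpline : ℕ → ℝ → ℝ
  | 0 => 0
  | 1 => Set.indicator (Set.Icc 0 1) 1
  | m + 2 => convolution (Set.indicator (Set.Icc 0 1) 1) (cardinalBSpline (m + 1))
      (ContinuousLinearMap.mul ℝ ℝ) volume

/-- The spline wavelet `ψ_m`. For `m = 1` the derivative of `N_2` fails to exist at the three
points `0, 1, 2`, which are irrelevant in `L²`. -/
def splineWavelet (m : ℕ) (x : ℝ) : ℝ :=
  1 / 2 ^ (m - 1) * ∑ j ∈ Finset.range (2 * m - 1),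
    (-1) ^ j * cardinalBSpline (2 * m) ((j : ℝ) + 1) *
      iteratedDeriv m (cardinalBSpline (2 * m)) (2 * x - j)

/-- The functions of the spline wavelet system on the real line: `inl (n, k)` stands for
`2^{n/2} ψ_m(2^n x - k)` and `inr k` for `N_m(x - k)`. -/
def splineFun (m : ℕ) : (ℕ × ℤ) ⊕ ℤ → ℝ → ℝ
  | Sum.inl (n, k) => fun x => (2 : ℝ) ^ ((n : ℝ) / 2) * splineWavelet m (2 ^ n * x - k)
  | Sum.inr k => fun x => cardinalBSpline m (x - k)

/-- The scale of a member of the system; the sub-dictionary `𝒟_{n+1}` consists of the members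
of scale `n`. -/
def splineScale : (ℕ × ℤ) ⊕ ℤ → ℕ
  | Sum.inl (n, _) => n
  | Sum.inr _ => 0

/-- `φ` lists the spline wavelet system of order `m` on `Ω`, that is the restrictions to `Ω` of
the functions `splineFun m ι`, as far as they are not zero in `L²(Ω)`, in canonical order: first
the sub-dictionary `𝒟_1`, then `𝒟_2`, and so on, each of them in arbitrary order. Here `σ i` is
the label of the `i`-th element. If functions with different labels have the same restriction to
`Ω`, then a repetition may be listed or omitted. -/
def IsCanonicalSplineDictionary (m : ℕ) (Ω : Set ℝ) (φ : ℕ → L2On Ω) : Prop :=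
  ∃ σ : ℕ → (ℕ × ℤ) ⊕ ℤ, Function.Injective σ ∧ Monotone (fun i => splineScale (σ i)) ∧
    (∀ i, φ i ≠ 0 ∧ φ i =ᵐ[volume.restrict Ω] splineFun m (σ i)) ∧
    ∀ ι, ¬ (splineFun m ι =ᵐ[volume.restrict Ω] 0) →
      ∃ i, splineScale (σ i) ≤ splineScale ι ∧ φ i =ᵐ[volume.restrict Ω] splineFun m ι

/-- The coefficients `q_n` of the two-scale relation that expresses `ψ_m` through `N_m`. -/
def twoScaleCoeff (m n : ℕ) : ℝ :=
  (-1) ^ (n + 1) / 2 ^ (m - 1) *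
    ∑ j ∈ Finset.range (m + 1), (m.choose j : ℝ) * cardinalBSpline (2 * m) ((n : ℝ) - j)

end

noncomputable section

/-! ### Calculus of networks -/

/-! Assertion 1 is the chain `dictionaryRate` ≤ `networkRate` ≤ `optimalExponent`: if the two ends
agree, so do the last two terms.

The right inequality (`networkRate_le_optimalExponent`) is a counting argument. Take a network with
M non-zero weights, depth T polylogarithmic in M, and weights at most M^k. Rounding the weights to a
grid of mesh δ changes the output on a bounded set by at most δ times a constant times T(M^(k+3))^T
(`abs_realize_mapWeights_sub_le`), so a mesh M^(-e) with e of order T preserves the approximation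
rate. The rounded network is evaluated by a word of length at most M + T over an alphabet of size
M^O(e) (`exists_word`), hence is determined by M times polylog(M) bits (`eventually_hasCode`). A
rate γ therefore gives code length O(ε^(-1/γ')) for every γ' < γ.

The left inequality (`dictionaryRate_le_networkRate`) turns M-term approximants into networks. Each
wavelet is almost everywhere a combination of at most 3m-1 dilates and shifts of N_m. On an interval
inside Ω the number of distinct wavelets of scale n is of order 2^n, so in the canonical order
2^scale grows at most linearly with the index (`exists_two_pow_splineScale_le`). Indices polynomial
in M thus mean dilations, shifts and coefficients polynomial in M. One network of size O(log M)
approximates N_m with error M^(-q), and copies of it work in parallel (`ReLUNetwork.combine`), for a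
total of O(M log M) weights. The logarithm is absorbed by an arbitrarily small loss in the exponent.

Assertion 2 rests on fast approximation of squares. The function w - 4^s w^2 equals a tent function
plus a function of the same kind at scale s+1, evaluated at the tent; each recursion step costs one
layer and divides the error by 4. Repeated squaring gives x^(2^m). N_m is a combination of truncated
powers of degree m-1, and these are combinations of shifted powers of degree 2^m, by invertibility
of a Vandermonde matrix. Large coefficients are divided by 2^s and restored by s doublings, so that
all weights stay at most 1.

Assertion 3 follows by differentiating N_2m m times, which yields m-th backward differences of N_m,
and collecting equal shifts. -/

theorem maxWeight_le_iff {d d' : ℕ} {A : Matrix (Fin d') (Fin d) ℝ} {b : Fin d' → ℝ} {B : ℝ≥0} :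
    maxWeight A b ≤ B ↔ (∀ i j, ‖A i j‖₊ ≤ B) ∧ ∀ i, ‖b i‖₊ ≤ B := by
  simp [maxWeight, Finset.sup_le_iff, Prod.forall]

theorem nonzeroWeights_eq_sum {d d' : ℕ} (A : Matrix (Fin d') (Fin d) ℝ) (b : Fin d' → ℝ) :
    nonzeroWeights A b =
      (∑ i, ∑ j, if A i j ≠ 0 then 1 else 0) + ∑ i, if b i ≠ 0 then 1 else 0 := by
  rw [nonzeroWeights, Finset.card_filter, Finset.card_filter, Fintype.sum_prod_type]

theorem nonzeroWeights_le {d d' : ℕ} (A : Matrix (Fin d') (Fin d) ℝ) (b : Fin d' → ℝ) :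
    nonzeroWeights A b ≤ d' * d + d' := by
  unfold nonzeroWeights
  refine add_le_add ?_ ?_
  · exact (Finset.card_filter_le _ _).trans (by simp)
  · exact (Finset.card_filter_le _ _).trans (by simp)

/-- If every column of `A` contains a non-zero entry, then `A` has at least as many non-zero
entries as columns. -/
theorem le_nonzeroWeights {d d' : ℕ} {A : Matrix (Fin d') (Fin d) ℝ} {b : Fin d' → ℝ}
    (h : ∀ j, ∃ i, A i j ≠ 0) : d ≤ nonzeroWeights A b := by
  choose f hf using h
  refine le_trans ?_ (Nat.le_add_right _ _)
  have := Finset.card_le_card_of_injOn (s := (Finset.univ : Finset (Fin d)))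
    (t := Finset.univ.filter fun p : Fin d' × Fin d => A p.1 p.2 ≠ 0)
    (fun j => (f j, j)) (by intro j _; simpa using hf j) (by intro a _ b _ hab; simpa using (congrArg Prod.snd hab))
  simpa using this

/-- The block diagonal matrix with `P` copies of `A` on the diagonal. -/
def blockCopies (P : ℕ) {d d' : ℕ} (A : Matrix (Fin d') (Fin d) ℝ) :
    Matrix (Fin (P * d')) (Fin (P * d)) ℝ :=
  fun i j => if i.divNat = j.divNat then A i.modNat j.modNat else 0

theorem blockCopies_apply {P d d' : ℕ} (A : Matrix (Fin d') (Fin d) ℝ) (p q : Fin P)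
    (i : Fin d') (j : Fin d) :
    blockCopies P A (finProdFinEquiv (p, i)) (finProdFinEquiv (q, j)) =
      if p = q then A i j else 0 := by
  have h1 := finProdFinEquiv.symm_apply_apply (p, i)
  have h2 := finProdFinEquiv.symm_apply_apply (q, j)
  simp only [finProdFinEquiv_symm_apply, Prod.mk.injEq] at h1 h2
  simp only [blockCopies, h1.1, h1.2, h2.1, h2.2]

/-- The vector made of `P` copies of `b`. -/
def vecCopies (P : ℕ) {d : ℕ} (b : Fin d → ℝ) : Fin (P * d) → ℝ :=
  fun i => b i.modNat

theorem vecCopies_apply {P d : ℕ} (b : Fin d → ℝ) (p : Fin P) (i : Fin d) :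
    vecCopies P b (finProdFinEquiv (p, i)) = b i := by
  have h1 := finProdFinEquiv.symm_apply_apply (p, i)
  simp only [finProdFinEquiv_symm_apply, Prod.mk.injEq] at h1
  simp only [vecCopies, h1.2]

theorem nonzeroWeights_copies (P : ℕ) {d d' : ℕ} (A : Matrix (Fin d') (Fin d) ℝ)
    (b : Fin d' → ℝ) :
    nonzeroWeights (blockCopies P A) (vecCopies P b) = P * nonzeroWeights A b := by
  rw [nonzeroWeights_eq_sum, nonzeroWeights_eq_sum]
  simp only [← finProdFinEquiv.sum_comp, Fintype.sum_prod_type, blockCopies_apply,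
    vecCopies_apply]
  have h : ∀ (p q : Fin P) (i : Fin d') (j : Fin d),
      (if (if p = q then A i j else 0) ≠ 0 then 1 else 0) =
        if p = q then (if A i j ≠ 0 then 1 else 0) else 0 := by
    intro p q i j
    by_cases hpq : p = q <;> simp [hpq]
  simp only [h]
  have h2 : ∀ (p : Fin P) (i : Fin d'),
      (∑ q : Fin P, ∑ j : Fin d, if p = q then (if A i j ≠ 0 then 1 else 0) else 0) =
        ∑ j : Fin d, if A i j ≠ 0 then 1 else 0 := by
    intro p i
    rw [Finset.sum_comm]
    simp
  simp only [h2]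
  simp only [Finset.sum_const, Finset.card_univ, Fintype.card_fin, smul_eq_mul]
  ring

theorem affineMap_copies {P d d' : ℕ} (A : Matrix (Fin d') (Fin d) ℝ) (b : Fin d' → ℝ)
    (x : Fin (P * d) → ℝ) (p : Fin P) (i : Fin d') :
    affineMap (blockCopies P A) (vecCopies P b) x (finProdFinEquiv (p, i)) =
      affineMap A b (fun j => x (finProdFinEquiv (p, j))) i := by
  simp only [affineMap, Pi.add_apply, Matrix.mulVec, dotProduct, vecCopies_apply,
    ← finProdFinEquiv.sum_comp, Fintype.sum_prod_type, blockCopies_apply, ite_mul, zero_mul]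
  rw [Finset.sum_comm]
  simp

theorem maxWeight_copies_le (P : ℕ) {d d' : ℕ} (A : Matrix (Fin d') (Fin d) ℝ)
    (b : Fin d' → ℝ) :
    maxWeight (blockCopies P A) (vecCopies P b) ≤ maxWeight A b := by
  obtain ⟨h1, h2⟩ := maxWeight_le_iff.1 (le_refl (maxWeight A b))
  refine maxWeight_le_iff.2 ⟨fun i j => ?_, fun i => h2 _⟩
  unfold blockCopies
  split_ifs
  · exact h1 _ _
  · simp

namespace ReLUNetwork

/-- The network `Ψ ∘ ρ ∘ Φ`. -/
def append : {d k d' : ℕ} → ReLUNetwork d k → ReLUNetwork k d' → ReLUNetwork d d'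
  | _, _, _, affine A b, Ψ => layer A b Ψ
  | _, _, _, layer A b Φ, Ψ => layer A b (append Φ Ψ)

theorem realize_append : ∀ {d k d' : ℕ} (Φ : ReLUNetwork d k) (Ψ : ReLUNetwork k d')
    (x : Fin d → ℝ), (append Φ Ψ).realize x = Ψ.realize fun i => max (Φ.realize x i) 0
  | _, _, _, affine A b, Ψ, x => rfl
  | _, _, _, layer A b Φ, Ψ, x => by
    simp only [append, realize]
    exact realize_append Φ Ψ _

theorem connectivity_append : ∀ {d k d' : ℕ} (Φ : ReLUNetwork d k) (Ψ : ReLUNetwork k d'),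
    (append Φ Ψ).connectivity = Φ.connectivity + Ψ.connectivity
  | _, _, _, affine A b, Ψ => rfl
  | _, _, _, layer A b Φ, Ψ => by
    simp only [append, connectivity, connectivity_append Φ Ψ, add_assoc]

theorem depth_append : ∀ {d k d' : ℕ} (Φ : ReLUNetwork d k) (Ψ : ReLUNetwork k d'),
    (append Φ Ψ).depth = Φ.depth + Ψ.depth
  | _, _, _, affine A b, Ψ => rfl
  | _, _, _, layer A b Φ, Ψ => by
    simp only [append, depth, depth_append Φ Ψ, add_assoc]

theorem weightMagnitude_append : ∀ {d k d' : ℕ} (Φ : ReLUNetwork d k) (Ψ : ReLUNetwork k d'),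
    (append Φ Ψ).weightMagnitude = Φ.weightMagnitude ⊔ Ψ.weightMagnitude
  | _, _, _, affine A b, Ψ => rfl
  | _, _, _, layer A b Φ, Ψ => by
    simp only [append, weightMagnitude, weightMagnitude_append Φ Ψ, sup_assoc]

theorem Nondegenerate.append : ∀ {d k d' : ℕ} {Φ : ReLUNetwork d k} {Ψ : ReLUNetwork k d'},
    Φ.Nondegenerate → Ψ.Nondegenerate → (append Φ Ψ).Nondegenerate
  | _, _, _, affine _ _, _, h1, h2 => ⟨h1.1, h2⟩
  | _, _, _, layer _ _ _, _, h1, h2 => ⟨h1.1, Nondegenerate.append h1.2 h2⟩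

/-- `P` copies of a network, working in parallel on separate inputs. -/
def copies (P : ℕ) : {d d' : ℕ} → ReLUNetwork d d' → ReLUNetwork (P * d) (P * d')
  | _, _, affine A b => affine (blockCopies P A) (vecCopies P b)
  | _, _, layer A b Ψ => layer (blockCopies P A) (vecCopies P b) (copies P Ψ)

theorem realize_copies {P : ℕ} : ∀ {d d' : ℕ} (Φ : ReLUNetwork d d') (x : Fin (P * d) → ℝ)
    (p : Fin P) (i : Fin d'), (copies P Φ).realize x (finProdFinEquiv (p, i)) =
      Φ.realize (fun j => x (finProdFinEquiv (p, j))) i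
  | _, _, affine A b, x, p, i => affineMap_copies A b x p i
  | _, _, layer A b Ψ, x, p, i => by
    simp only [copies, realize, realize_copies Ψ, affineMap_copies]

theorem connectivity_copies {P : ℕ} : ∀ {d d' : ℕ} (Φ : ReLUNetwork d d'),
    (copies P Φ).connectivity = P * Φ.connectivity
  | _, _, affine A b => nonzeroWeights_copies P A b
  | _, _, layer A b Ψ => by
    simp only [copies, connectivity, connectivity_copies Ψ, nonzeroWeights_copies, mul_add]

theorem depth_copies {P : ℕ} : ∀ {d d' : ℕ} (Φ : ReLUNetwork d d'),
    (copies P Φ).depth = Φ.depth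
  | _, _, affine A b => rfl
  | _, _, layer A b Ψ => by
    simp only [copies, depth, depth_copies Ψ]

theorem weightMagnitude_copies_le {P : ℕ} : ∀ {d d' : ℕ} (Φ : ReLUNetwork d d'),
    (copies P Φ).weightMagnitude ≤ Φ.weightMagnitude
  | _, _, affine A b => maxWeight_copies_le P A b
  | _, _, layer A b Ψ => sup_le_sup (maxWeight_copies_le P A b) (weightMagnitude_copies_le Ψ)

theorem exists_blockCopies_ne_zero {P d d' : ℕ} {A : Matrix (Fin d') (Fin d) ℝ}
    (h : ∀ j, ∃ i, A i j ≠ 0) (j : Fin (P * d)) : ∃ i, blockCopies P A i j ≠ 0 := by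
  obtain ⟨⟨p, j⟩, rfl⟩ := finProdFinEquiv.surjective j
  obtain ⟨i, hi⟩ := h j
  exact ⟨finProdFinEquiv (p, i), by simpa [blockCopies_apply] using hi⟩

theorem Nondegenerate.copies (P : ℕ) : ∀ {d d' : ℕ} {Φ : ReLUNetwork d d'},
    Φ.Nondegenerate → (copies P Φ).Nondegenerate
  | _, _, affine A b, h => by
    refine ⟨exists_blockCopies_ne_zero h.1, fun i => ?_⟩
    obtain ⟨⟨p, i⟩, rfl⟩ := finProdFinEquiv.surjective i
    obtain ⟨j, hj⟩ := h.2 i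
    exact ⟨finProdFinEquiv (p, j), by simpa [blockCopies_apply] using hj⟩
  | _, _, layer A b Ψ, h => ⟨exists_blockCopies_ne_zero h.1, Nondegenerate.copies P h.2⟩

/-- Nondegeneracy is what lets the number of weights control the width. Applied to all tails of a
network it bounds every hidden width, which both the rounding estimate and the count of words need.
-/
theorem Nondegenerate.input_le_connectivity : ∀ {d d' : ℕ} {Φ : ReLUNetwork d d'},
    Φ.Nondegenerate → d ≤ Φ.connectivity
  | _, _, affine _ _, h => le_nonzeroWeights h.1
  | _, _, layer _ _ _, h => (le_nonzeroWeights h.1).trans (Nat.le_add_right _ _)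

/-- Every layer has a node, and each node has an outgoing edge, so each layer contributes at least
one weight. This yields depth bounds without tracking depth in the constructions. -/
theorem Nondegenerate.depth_le_connectivity : ∀ {d d' : ℕ} {Φ : ReLUNetwork d d'},
    Φ.Nondegenerate → 0 < d → Φ.depth ≤ Φ.connectivity
  | _, _, affine A b, h, hd => hd.trans_le (le_nonzeroWeights h.1)
  | _, _, layer A b Ψ, h, hd => by
    obtain ⟨i, -⟩ := h.1 ⟨0, hd⟩
    exact add_le_add (hd.trans_le (le_nonzeroWeights h.1)) (h.2.depth_le_connectivity i.pos)

/-- The network computing `2 ρ(Φ(x))`. -/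
def double {d : ℕ} (Φ : ReLUNetwork d 1) : ReLUNetwork d 1 :=
  append Φ (layer (fun (_ : Fin 2) (_ : Fin 1) => 1) 0 (affine (fun (_ : Fin 1) (_ : Fin 2) => 1) 0))

theorem realize_double {d : ℕ} (Φ : ReLUNetwork d 1) (x : Fin d → ℝ) (i : Fin 1) :
    (double Φ).realize x i = 2 * max (Φ.realize x 0) 0 := by
  simp [double, realize_append, realize, affineMap, Matrix.mulVec, dotProduct, two_mul]

theorem connectivity_double_le {d : ℕ} (Φ : ReLUNetwork d 1) :
    (double Φ).connectivity ≤ Φ.connectivity + 7 := by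
  rw [double, connectivity_append]
  simp only [connectivity]
  have h1 := nonzeroWeights_le (fun (_ : Fin 2) (_ : Fin 1) => (1 : ℝ)) 0
  have h2 := nonzeroWeights_le (fun (_ : Fin 1) (_ : Fin 2) => (1 : ℝ)) 0
  omega

theorem weightMagnitude_double_le {d : ℕ} {Φ : ReLUNetwork d 1} (h : Φ.weightMagnitude ≤ 1) :
    (double Φ).weightMagnitude ≤ 1 := by
  rw [double, weightMagnitude_append]
  refine sup_le h (sup_le ?_ ?_) <;> exact maxWeight_le_iff.2 ⟨by simp, by simp⟩

theorem Nondegenerate.double {d : ℕ} {Φ : ReLUNetwork d 1} (h : Φ.Nondegenerate) :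
    (double Φ).Nondegenerate :=
  h.append ⟨fun _ => ⟨0, one_ne_zero⟩, fun _ => ⟨0, one_ne_zero⟩, fun _ => ⟨0, one_ne_zero⟩⟩

theorem continuous_realize : ∀ {d d' : ℕ} (Φ : ReLUNetwork d d'), Continuous Φ.realize
  | _, _, affine A b => by
    simp only [realize, affineMap]
    fun_prop
  | _, _, layer A b Ψ => by
    have h := continuous_realize Ψ
    have h2 : Continuous fun x => fun i => max (affineMap A b x i) 0 := by
      refine continuous_pi fun i => Continuous.max ?_ continuous_const
      have : Continuous (affineMap A b) := by unfold affineMap; fun_prop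
      exact (continuous_apply i).comp this
    exact h.comp h2

/-- The network computing `∑ p, a p * ρ(Φ(ρ(G(x) p)))`. -/
def combine {d P : ℕ} (G : ReLUNetwork d (P * 1)) (Φ : ReLUNetwork 1 1) (a : Fin P → ℝ) :
    ReLUNetwork d 1 :=
  append G (append (copies P Φ) (affine (fun _ j => a j.divNat) 0))

theorem realize_combine {d P : ℕ} (G : ReLUNetwork d (P * 1)) (Φ : ReLUNetwork 1 1)
    (a : Fin P → ℝ) (x : Fin d → ℝ) (i : Fin 1) :
    (combine G Φ a).realize x i =
      ∑ p, a p * max (Φ.toRealFun (max (G.realize x (finProdFinEquiv (p, 0))) 0)) 0 := by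
  have h (p : Fin P) (q : Fin 1) : (finProdFinEquiv (p, q)).divNat = p :=
    congrArg Prod.fst (finProdFinEquiv.symm_apply_apply (p, q))
  simp only [combine, realize_append, realize, affineMap, Matrix.mulVec, dotProduct,
    Pi.add_apply, Pi.zero_apply, add_zero, ← finProdFinEquiv.sum_comp, Fintype.sum_prod_type,
    realize_copies, h, toRealFun, Fin.sum_univ_one, Fin.isValue]
  refine Finset.sum_congr rfl fun p _ => ?_
  congr 4
  funext j
  rw [Subsingleton.elim j 0]

theorem connectivity_combine_le {d P : ℕ} (G : ReLUNetwork d (P * 1)) (Φ : ReLUNetwork 1 1)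
    (a : Fin P → ℝ) :
    (combine G Φ a).connectivity ≤ G.connectivity + P * Φ.connectivity + P := by
  rw [combine, connectivity_append, connectivity_append, connectivity_copies]
  have : (affine (fun (_ : Fin 1) (j : Fin (P * 1)) => a j.divNat) 0).connectivity ≤ P := by
    simp only [connectivity, nonzeroWeights]
    refine add_le_of_le_of_nonpos ((Finset.card_filter_le _ _).trans (by simp)) (by simp)
  omega

theorem depth_combine {d P : ℕ} (G : ReLUNetwork d (P * 1)) (Φ : ReLUNetwork 1 1)
    (a : Fin P → ℝ) : (combine G Φ a).depth = G.depth + Φ.depth + 1 := by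
  rw [combine, depth_append, depth_append, depth_copies, add_assoc]
  rfl

theorem weightMagnitude_combine_le {d P : ℕ} {G : ReLUNetwork d (P * 1)} {Φ : ReLUNetwork 1 1}
    {a : Fin P → ℝ} {B : ℝ≥0} (hG : G.weightMagnitude ≤ B) (hΦ : Φ.weightMagnitude ≤ B)
    (ha : ∀ p, ‖a p‖₊ ≤ B) : (combine G Φ a).weightMagnitude ≤ B := by
  rw [combine, weightMagnitude_append, weightMagnitude_append]
  exact sup_le hG (sup_le ((weightMagnitude_copies_le Φ).trans hΦ)
    (maxWeight_le_iff.2 ⟨fun _ j => ha _, by simp⟩))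

theorem Nondegenerate.combine {d P : ℕ} {G : ReLUNetwork d (P * 1)} {Φ : ReLUNetwork 1 1}
    {a : Fin P → ℝ} (hP : 0 < P) (hG : G.Nondegenerate) (hΦ : Φ.Nondegenerate)
    (ha : ∀ p, a p ≠ 0) : (combine G Φ a).Nondegenerate :=
  hG.append ((hΦ.copies P).append
    ⟨fun _ => ⟨0, ha _⟩, fun _ => ⟨finProdFinEquiv (⟨0, hP⟩, 0), ha _⟩⟩)

end ReLUNetwork

/-! ### Approximation of powers -/

namespace ReLUNetwork

/-- The network that maps `(w, ρ(w - 4 ^ (-s) / 2), a)` to an approximation of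
`a - (w - 4 ^ s * w ^ 2)` for `0 ≤ w ≤ 4 ^ (-s)`. -/
def squareCore (s : ℕ) : ℕ → ReLUNetwork 3 1
  | 0 => affine !![-1 / 2, 1, 1] 0
  | T + 1 => layer !![1 / 2, -1, 0; 1 / 2, -1, 0; -1 / 2, 1, 1] ![0, -(4 ^ (s + 1))⁻¹ / 2, 0]
      (squareCore (s + 1) T)

/-- Induction on the number T of refinements. The hypothesis on `a` keeps the accumulator
non-negative, so the rectifier leaves it unchanged. The final affine map drops a remainder lying
between 0 and 4^(-(s+T)), hence the approximation is from above. The last bound records that only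
non-negative tents are subtracted from `a`. -/
theorem realize_squareCore_bounds (T : ℕ) : ∀ (s : ℕ) (w a : ℝ), 0 ≤ w → 4 ^ s * w ≤ 1 →
    w - 4 ^ s * w ^ 2 ≤ a →
    0 ≤ (squareCore s T).realize ![w, max (w - (4 ^ s)⁻¹ / 2) 0, a] 0 - (a - (w - 4 ^ s * w ^ 2)) ∧
    (squareCore s T).realize ![w, max (w - (4 ^ s)⁻¹ / 2) 0, a] 0 - (a - (w - 4 ^ s * w ^ 2)) ≤
      (4 ^ (s + T))⁻¹ ∧
    (squareCore s T).realize ![w, max (w - (4 ^ s)⁻¹ / 2) 0, a] 0 ≤ a := by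
  induction T with
  | zero =>
    intro s w a hw hw1 ha
    have hp : (0 : ℝ) < 4 ^ s := by positivity
    simp only [squareCore, realize, affineMap]
    simp
    set c : ℝ := 4 ^ s with hc
    have hci : c * c⁻¹ = 1 := mul_inv_cancel₀ hp.ne'
    have hci0 : 0 < c⁻¹ := inv_pos.2 hp
    have hsq : 0 ≤ c⁻¹ := hci0.le
    have hwc : w ≤ c⁻¹ := by rw [← one_div, le_div_iff₀ hp]; linarith
    rcases le_total w (c⁻¹ / 2) with h | h
    · rw [max_eq_right (by linarith)]
      refine ⟨?_, ?_, ?_⟩ <;> nlinarith [mul_nonneg hw hw, mul_nonneg hp.le hw]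
    · rw [max_eq_left (by linarith)]
      refine ⟨?_, ?_, by linarith⟩
      · nlinarith [mul_nonneg hp.le (mul_nonneg (sub_nonneg.2 hwc) (sub_nonneg.2 h)), mul_nonneg hp.le (sub_nonneg.2 hwc)]
      · nlinarith [mul_nonneg hp.le (mul_nonneg (sub_nonneg.2 hwc) (sub_nonneg.2 h)), mul_nonneg hp.le (sub_nonneg.2 hwc)]
  | succ T ih =>
    intro s w a hw hw1 ha
    have hp : (0 : ℝ) < 4 ^ s := by positivity
    -- Half the tent: `w'` is half of min(w, 4^(-s) - w). It lies in [0, 4^(-(s+1))], which is the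
    -- input range at the next scale.
    set w' : ℝ := w / 2 - max (w - (4 ^ s)⁻¹ / 2) 0 with hw'
    have key : 0 ≤ w' ∧ 4 ^ (s + 1) * w' ≤ 1 ∧
        w - 4 ^ s * w ^ 2 = w' + (w' - 4 ^ (s + 1) * w' ^ 2) := by
      rw [pow_succ]
      set c : ℝ := 4 ^ s with hc
      have hci : c * c⁻¹ = 1 := mul_inv_cancel₀ hp.ne'
      have hci0 : 0 < c⁻¹ := inv_pos.2 hp
      have hwc : w ≤ c⁻¹ := by rw [← one_div, le_div_iff₀ hp]; linarith
      rcases le_total w (c⁻¹ / 2) with h | h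
      · have : w' = w / 2 := by rw [hw', max_eq_right (by linarith)]; ring
        rw [this]
        refine ⟨by linarith, by nlinarith, by ring⟩
      · have : w' = (c⁻¹ - w) / 2 := by rw [hw', max_eq_left (by linarith)]; ring
        rw [this]
        refine ⟨by linarith, by nlinarith, ?_⟩
        linear_combination (c⁻¹ - 2 * w) * hci
    obtain ⟨k1, k2, k3⟩ := key
    have hle : w' - 4 ^ (s + 1) * w' ^ 2 ≤ a - w' := by linarith
    have h0 : 0 ≤ w' - 4 ^ (s + 1) * w' ^ 2 := by nlinarith
    obtain ⟨i1, i2, i3⟩ := ih (s + 1) w' (a - w') k1 k2 hle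
    have hr : (squareCore s (T + 1)).realize ![w, max (w - (4 ^ s)⁻¹ / 2) 0, a] =
        (squareCore (s + 1) T).realize ![w', max (w' - (4 ^ (s + 1))⁻¹ / 2) 0, a - w'] := by
      simp only [squareCore, realize]
      congr 1
      funext i
      fin_cases i
      · simp [affineMap]
        rw [max_eq_left]
        · rw [hw']; ring
        · have := k1; rw [hw'] at this; linarith
      · simp [affineMap]
        rw [hw']; congr 1; ring
      · simp [affineMap]
        rw [max_eq_left]
        · rw [hw']; ring
        · have := h0.trans hle; rw [hw'] at this; linarith
    rw [hr, k3]
    have e : s + 1 + T = s + (T + 1) := by ring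
    rw [e] at i2
    refine ⟨?_, ?_, ?_⟩ <;> linarith

/-- The network that approximates `x ^ 2` on `[0, 1]` up to the error `4 ^ (-T)`. -/
def square (T : ℕ) : ReLUNetwork 1 1 :=
  layer !![1; 1; 1] ![0, -1 / 2, 0] (squareCore 0 T)

/-- Start the recursion at s = 0 with w = a = x, since x - (x - x^2) = x^2. The bound by `x` keeps
the output in [0, 1], so that the network can be iterated. -/
theorem toRealFun_square_bounds (T : ℕ) {x : ℝ} (h0 : 0 ≤ x) (h1 : x ≤ 1) :
    x ^ 2 ≤ (square T).toRealFun x ∧ (square T).toRealFun x ≤ x ^ 2 + (4 ^ T)⁻¹ ∧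
      (square T).toRealFun x ≤ x := by
  have h := realize_squareCore_bounds T 0 x x h0 (by simpa using h1) (by nlinarith)
  have hr : (square T).toRealFun x =
      (squareCore 0 T).realize ![x, max (x - (4 ^ 0)⁻¹ / 2) 0, x] 0 := by
    simp only [toRealFun, square, realize]
    congr 1
    funext i
    fin_cases i <;> simp [affineMap, dotProduct, h0]; ring_nf
  rw [← hr] at h
  simp only [pow_zero, one_mul, zero_add] at h
  refine ⟨?_, ?_, h.2.2⟩ <;> linarith [h.1, h.2.1]

theorem connectivity_squareCore_le (T : ℕ) : ∀ s, (squareCore s T).connectivity ≤ 12 * T + 4 := by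
  induction T with
  | zero => exact fun s => nonzeroWeights_le _ _
  | succ T ih =>
    intro s
    have := add_le_add (nonzeroWeights_le !![1 / 2, -1, 0; 1 / 2, -1, 0; -1 / 2, 1, 1]
      ![0, -(4 ^ (s + 1))⁻¹ / 2, 0]) (ih (s + 1))
    simp only [squareCore, connectivity]
    omega

theorem connectivity_square_le (T : ℕ) : (square T).connectivity ≤ 12 * T + 10 := by
  have := add_le_add (nonzeroWeights_le !![1; 1; 1] ![0, -1 / 2, 0])
    (connectivity_squareCore_le T 0)
  simp only [square, connectivity]
  omega

theorem weightMagnitude_squareCore_le (T : ℕ) : ∀ s, (squareCore s T).weightMagnitude ≤ 1 := by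
  induction T with
  | zero =>
    refine fun s => maxWeight_le_iff.2 ⟨fun i j => ?_, by simp⟩
    rw [← NNReal.coe_le_coe]
    fin_cases i; fin_cases j <;> norm_num
  | succ T ih =>
    refine fun s => sup_le (maxWeight_le_iff.2 ⟨fun i j => ?_, fun i => ?_⟩) (ih _)
    · rw [← NNReal.coe_le_coe]
      fin_cases i <;> fin_cases j <;> norm_num
    · rw [← NNReal.coe_le_coe]
      fin_cases i
      · simp
      · have h : ((4 : ℝ) ^ (s + 1))⁻¹ ≤ 1 := inv_le_one_of_one_le₀ (one_le_pow₀ (by norm_num))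
        have h0 : 0 ≤ ((4 : ℝ) ^ (s + 1))⁻¹ := by positivity
        show |(-(4 ^ (s + 1))⁻¹ / 2 : ℝ)| ≤ 1
        rw [abs_le]
        constructor <;> linarith
      · simp

theorem weightMagnitude_square_le (T : ℕ) : (square T).weightMagnitude ≤ 1 := by
  refine sup_le (maxWeight_le_iff.2 ⟨fun i j => ?_, fun i => ?_⟩)
    (weightMagnitude_squareCore_le T 0)
  · fin_cases i <;> fin_cases j <;> simp
  · rw [← NNReal.coe_le_coe]
    fin_cases i <;> norm_num

theorem nondegenerate_squareCore (T : ℕ) : ∀ s, (squareCore s T).Nondegenerate := by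
  induction T with
  | zero =>
    refine fun s => ⟨fun j => ⟨0, ?_⟩, fun i => ⟨1, ?_⟩⟩
    · fin_cases j <;> norm_num
    · fin_cases i; norm_num
  | succ T ih =>
    refine fun s => ⟨fun j => ⟨2, ?_⟩, ih _⟩
    fin_cases j
    · show (-1 / 2 : ℝ) ≠ 0
      norm_num
    · exact one_ne_zero (α := ℝ)
    · exact one_ne_zero (α := ℝ)

theorem nondegenerate_square (T : ℕ) : (square T).Nondegenerate := by
  refine ⟨fun j => ⟨0, ?_⟩, nondegenerate_squareCore T 0⟩
  fin_cases j; norm_num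

/-- The network that approximates `x ^ (2 ^ r)` on `[0, 1]` by repeated squaring. -/
def power (T : ℕ) : ℕ → ReLUNetwork 1 1
  | 0 => affine !![1] 0
  | r + 1 => append (square T) (power T r)

theorem toRealFun_append (Φ Ψ : ReLUNetwork 1 1) (x : ℝ) :
    (append Φ Ψ).toRealFun x = Ψ.toRealFun (max (Φ.toRealFun x) 0) := by
  simp only [toRealFun, realize_append]
  congr 1
  funext i
  rw [Subsingleton.elim i 0]

/-- On [0, 1] the map z ↦ z^(2^r) has Lipschitz constant 2^r, so an error 4^(-T) in the first
squaring grows to at most 2^r 4^(-T). Adding the error of the remaining squarings doubles the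
constant at each step. -/
theorem toRealFun_power_bounds (T r : ℕ) : ∀ {x : ℝ}, 0 ≤ x → x ≤ 1 →
    x ^ (2 ^ r) ≤ (power T r).toRealFun x ∧
      (power T r).toRealFun x ≤ x ^ (2 ^ r) + 2 ^ r * (4 ^ T)⁻¹ := by
  induction r with
  | zero =>
    intro x h0 h1
    have : (power T 0).toRealFun x = x := by simp [power, toRealFun, realize, affineMap]
    rw [this]
    simp
  | succ r ih =>
    intro x h0 h1
    obtain ⟨b0, b1, b2⟩ := toRealFun_square_bounds T h0 h1
    set y := (square T).toRealFun x with hy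
    have hx2 : 0 ≤ x ^ 2 := sq_nonneg x
    have hx1 : x ^ 2 ≤ 1 := pow_le_one₀ h0 h1
    have hy0 : 0 ≤ y := hx2.trans b0
    have hy1 : y ≤ 1 := b2.trans h1
    obtain ⟨c0, c1⟩ := ih hy0 hy1
    rw [power, toRealFun_append, ← hy, max_eq_left hy0]
    have e : x ^ 2 ^ (r + 1) = (x ^ 2) ^ 2 ^ r := by rw [← pow_mul, pow_succ']
    rw [e]
    refine ⟨(pow_le_pow_left₀ hx2 b0 _).trans c0, c1.trans ?_⟩
    have h := abs_pow_sub_pow_le y (x ^ 2) (2 ^ r)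
    have hm : max |y| |x ^ 2| ≤ 1 := max_le (by rwa [abs_of_nonneg hy0]) (by rwa [abs_of_nonneg hx2])
    have h2 : max |y| |x ^ 2| ^ (2 ^ r - 1) ≤ 1 := pow_le_one₀ (by positivity) hm
    have h3 : |y - x ^ 2| ≤ (4 ^ T)⁻¹ := by rw [abs_of_nonneg (by linarith)]; linarith
    have h4 : |y ^ 2 ^ r - (x ^ 2) ^ 2 ^ r| ≤ (4 ^ T)⁻¹ * 2 ^ r * 1 := by
      refine h.trans ?_
      push_cast
      gcongr
    rw [pow_succ (2 : ℝ) r]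
    linarith [le_abs_self (y ^ 2 ^ r - (x ^ 2) ^ 2 ^ r)]

theorem connectivity_power_le (T r : ℕ) : (power T r).connectivity ≤ r * (12 * T + 10) + 2 := by
  induction r with
  | zero => exact (nonzeroWeights_le _ _).trans (by omega)
  | succ r ih =>
    rw [power, connectivity_append, add_mul]
    have := connectivity_square_le T
    omega

theorem weightMagnitude_power_le (T r : ℕ) : (power T r).weightMagnitude ≤ 1 := by
  induction r with
  | zero => exact maxWeight_le_iff.2 ⟨fun i j => by fin_cases i; fin_cases j; simp, by simp⟩
  | succ r ih =>
    rw [power, weightMagnitude_append]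
    exact sup_le (weightMagnitude_square_le T) ih

theorem nondegenerate_power (T r : ℕ) : (power T r).Nondegenerate := by
  induction r with
  | zero =>
    refine ⟨fun j => ⟨0, ?_⟩, fun i => ⟨0, ?_⟩⟩
    · fin_cases j; norm_num
    · fin_cases i; norm_num
  | succ r ih => exact (nondegenerate_square T).append ih

end ReLUNetwork

/-! ### Cardinal B-splines -/

theorem cardinalBSpline_one : cardinalBSpline 1 = Set.indicator (Set.Icc 0 1) 1 := rfl

theorem cardinalBSpline_succ_eq (l : ℕ) (hl : 1 ≤ l) (x : ℝ) :
    cardinalBSpline (l + 1) x = ∫ t in (x - 1)..x, cardinalBSpline l t := by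
  obtain ⟨m, rfl⟩ : ∃ m, l = m + 1 := ⟨l - 1, by omega⟩
  have h : ∀ t : ℝ, (ContinuousLinearMap.mul ℝ ℝ) (Set.indicator (Set.Icc (0 : ℝ) 1) 1 t)
      (cardinalBSpline (m + 1) (x - t)) =
      Set.indicator (Set.Icc (0 : ℝ) 1) (fun t => cardinalBSpline (m + 1) (x - t)) t := by
    intro t
    by_cases ht : t ∈ Set.Icc (0 : ℝ) 1 <;> simp [ht]
  rw [cardinalBSpline, convolution]
  simp only [h]
  rw [integral_indicator measurableSet_Icc, integral_Icc_eq_integral_Ioc,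
    ← intervalIntegral.integral_of_le zero_le_one,
    intervalIntegral.integral_comp_sub_left (fun t => cardinalBSpline (m + 1) t)]
  simp

theorem cardinalBSpline_continuous_aux (l : ℕ) (hl : 1 ≤ l)
    (h : ∀ a b, IntervalIntegrable (cardinalBSpline l) volume a b) :
    Continuous (cardinalBSpline (l + 1)) := by
  have h1 : cardinalBSpline (l + 1) = fun x => (∫ t in (0 : ℝ)..x, cardinalBSpline l t) -
      ∫ t in (0 : ℝ)..(x - 1), cardinalBSpline l t := by
    funext x
    rw [cardinalBSpline_succ_eq l hl, intervalIntegral.integral_interval_sub_left (h _ _) (h _ _)]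
  have h2 := intervalIntegral.continuous_primitive h 0
  rw [h1]
  exact h2.sub (h2.comp (by fun_prop))

theorem intervalIntegrable_cardinalBSpline {l : ℕ} (hl : 1 ≤ l) :
    ∀ a b, IntervalIntegrable (cardinalBSpline l) volume a b := by
  induction l, hl using Nat.le_induction with
  | base =>
    intro a b
    rw [cardinalBSpline_one]
    exact ((integrable_indicator_iff measurableSet_Icc).2
      (integrableOn_const (by simp))).intervalIntegrable
  | succ l hl ih => exact fun a b => (cardinalBSpline_continuous_aux l hl ih).intervalIntegrable a b

theorem continuous_cardinalBSpline {l : ℕ} (hl : 2 ≤ l) : Continuous (cardinalBSpline l) := by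
  obtain ⟨m, rfl⟩ : ∃ m, l = m + 1 := ⟨l - 1, by omega⟩
  exact cardinalBSpline_continuous_aux m (by omega) (intervalIntegrable_cardinalBSpline (by omega))

theorem measurable_cardinalBSpline {l : ℕ} (hl : 1 ≤ l) : Measurable (cardinalBSpline l) := by
  rcases hl.eq_or_lt with rfl | hl
  · rw [cardinalBSpline_one]
    exact measurable_one.indicator measurableSet_Icc
  · exact (continuous_cardinalBSpline hl).measurable

theorem cardinalBSpline_nonneg {l : ℕ} (hl : 1 ≤ l) : ∀ x, 0 ≤ cardinalBSpline l x := by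
  induction l, hl using Nat.le_induction with
  | base =>
    intro x
    rw [cardinalBSpline_one]
    exact Set.indicator_nonneg (by simp) x
  | succ l hl ih =>
    intro x
    rw [cardinalBSpline_succ_eq l hl]
    exact intervalIntegral.integral_nonneg (by linarith) fun t _ => ih t

theorem cardinalBSpline_le_one {l : ℕ} (hl : 1 ≤ l) : ∀ x, cardinalBSpline l x ≤ 1 := by
  induction l, hl using Nat.le_induction with
  | base =>
    intro x
    rw [cardinalBSpline_one]
    by_cases hx : x ∈ Set.Icc (0 : ℝ) 1 <;> simp [Set.indicator_of_mem, Set.indicator_of_notMem, hx]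
  | succ l hl ih =>
    intro x
    rw [cardinalBSpline_succ_eq l hl]
    calc _ ≤ ∫ t in (x - 1)..x, (1 : ℝ) := intervalIntegral.integral_mono_on (by linarith)
          (intervalIntegrable_cardinalBSpline hl _ _) (by simp) fun t _ => ih t
      _ = 1 := by simp

theorem cardinalBSpline_eq_zero_of_neg {l : ℕ} (hl : 1 ≤ l) :
    ∀ {x : ℝ}, x < 0 → cardinalBSpline l x = 0 := by
  induction l, hl using Nat.le_induction with
  | base =>
    intro x hx
    rw [cardinalBSpline_one]
    exact Set.indicator_of_notMem (fun h => absurd h.1 (by linarith)) _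
  | succ l hl ih =>
    intro x hx
    rw [cardinalBSpline_succ_eq l hl]
    refine (intervalIntegral.integral_congr (g := fun _ => 0) fun t ht => ?_).trans (by simp)
    rw [Set.uIcc_of_le (by linarith)] at ht
    exact ih (by linarith [ht.2])

theorem cardinalBSpline_eq_zero_of_gt {l : ℕ} (hl : 1 ≤ l) :
    ∀ {x : ℝ}, (l : ℝ) < x → cardinalBSpline l x = 0 := by
  induction l, hl using Nat.le_induction with
  | base =>
    intro x hx
    rw [cardinalBSpline_one]
    exact Set.indicator_of_notMem (fun h => absurd h.2 (by push_cast at hx; linarith)) _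
  | succ l hl ih =>
    intro x hx
    push_cast at hx
    rw [cardinalBSpline_succ_eq l hl]
    refine (intervalIntegral.integral_congr (g := fun _ => 0) fun t ht => ?_).trans (by simp)
    rw [Set.uIcc_of_le (by linarith)] at ht
    exact ih (by linarith [ht.1])

theorem cardinalBSpline_eq_zero_of_nonpos {l : ℕ} (hl : 2 ≤ l) {x : ℝ} (hx : x ≤ 0) :
    cardinalBSpline l x = 0 := by
  have hc : closure (Set.Iio (0 : ℝ)) ⊆ {x | cardinalBSpline l x = 0} :=
    closure_minimal (fun x hx => cardinalBSpline_eq_zero_of_neg (by omega) hx)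
      (isClosed_eq (continuous_cardinalBSpline hl) continuous_const)
  rw [closure_Iio] at hc
  exact hc hx

theorem cardinalBSpline_eq_zero_of_ge {l : ℕ} (hl : 2 ≤ l) {x : ℝ} (hx : (l : ℝ) ≤ x) :
    cardinalBSpline l x = 0 := by
  have hc : closure (Set.Ioi (l : ℝ)) ⊆ {x | cardinalBSpline l x = 0} :=
    closure_minimal (fun x hx => cardinalBSpline_eq_zero_of_gt (by omega) hx)
      (isClosed_eq (continuous_cardinalBSpline hl) continuous_const)
  rw [closure_Ioi] at hc
  exact hc hx

/-- N_(l+1) is a moving average of N_l, so its derivative is a difference of endpoint values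
wherever these are points of continuity. The continuity hypotheses matter only for l = 1. -/
theorem hasDerivAt_cardinalBSpline {l : ℕ} (hl : 1 ≤ l) {x : ℝ}
    (h0 : ContinuousAt (cardinalBSpline l) x) (h1 : ContinuousAt (cardinalBSpline l) (x - 1)) :
    HasDerivAt (cardinalBSpline (l + 1)) (cardinalBSpline l x - cardinalBSpline l (x - 1)) x := by
  have hi := intervalIntegrable_cardinalBSpline hl
  have e : cardinalBSpline (l + 1) = fun x => (∫ t in (0 : ℝ)..x, cardinalBSpline l t) -
      ∫ t in (0 : ℝ)..(x - 1), cardinalBSpline l t := by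
    funext x
    rw [cardinalBSpline_succ_eq l hl, intervalIntegral.integral_interval_sub_left (hi _ _) (hi _ _)]
  have hm : ∀ y, StronglyMeasurableAtFilter (cardinalBSpline l) (𝓝 y) volume := fun y =>
    (measurable_cardinalBSpline hl).stronglyMeasurable.stronglyMeasurableAtFilter
  rw [e]
  have d0 := intervalIntegral.integral_hasDerivAt_right (hi 0 x) (hm x) h0
  have d1 := intervalIntegral.integral_hasDerivAt_right (hi 0 (x - 1)) (hm _) h1
  exact d0.sub (d1.comp_sub_const x 1)

theorem continuousAt_cardinalBSpline {l : ℕ} (hl : 1 ≤ l) {x : ℝ}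
    (hx : x ∉ Set.range ((↑) : ℤ → ℝ)) : ContinuousAt (cardinalBSpline l) x := by
  rcases hl.eq_or_lt with rfl | hl
  · rw [cardinalBSpline_one]
    have h0 : x ≠ 0 := fun h => hx ⟨0, by simp [h]⟩
    have h1 : x ≠ 1 := fun h => hx ⟨1, by simp [h]⟩
    rcases lt_or_gt_of_ne h0 with h | h
    · refine ContinuousAt.congr (f := fun _ => (0 : ℝ)) continuousAt_const ?_
      filter_upwards [Iio_mem_nhds h] with y hy
      exact (Set.indicator_of_notMem (fun h : y ∈ Set.Icc (0 : ℝ) 1 => absurd h.1 (not_le.2 hy)) _).symm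
    rcases lt_or_gt_of_ne h1 with h' | h'
    · refine ContinuousAt.congr (f := fun _ => (1 : ℝ)) continuousAt_const ?_
      filter_upwards [Ioo_mem_nhds h h'] with y hy
      rw [Set.indicator_of_mem (show y ∈ Set.Icc (0 : ℝ) 1 from Set.Ioo_subset_Icc_self hy)]
      rfl
    · refine ContinuousAt.congr (f := fun _ => (0 : ℝ)) continuousAt_const ?_
      filter_upwards [Ioi_mem_nhds h'] with y hy
      exact (Set.indicator_of_notMem (fun h : y ∈ Set.Icc (0 : ℝ) 1 => absurd h.2 (not_le.2 hy)) _).symm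
  · exact (continuous_cardinalBSpline hl).continuousAt

/-- Pascal's rule: a (k+1)-st difference is the k-th difference of a first difference. It drives
both the truncated power formula and the formula for iterated derivatives. -/
theorem alternating_choose_sum (k : ℕ) (f : ℕ → ℝ) :
    ∑ i ∈ Finset.range (k + 2), (-1) ^ i * ((k + 1).choose i : ℝ) * f i =
      ∑ i ∈ Finset.range (k + 1), (-1) ^ i * (k.choose i : ℝ) * (f i - f (i + 1)) := by
  rw [Finset.sum_range_succ']
  simp only [mul_sub, Finset.sum_sub_distrib]
  have h1 : ∑ i ∈ Finset.range (k + 1), (-1 : ℝ) ^ i * (k.choose i : ℝ) * f i =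
      ∑ i ∈ Finset.range (k + 1), (-1) ^ (i + 1) * (k.choose (i + 1) : ℝ) * f (i + 1) + f 0 := by
    rw [Finset.sum_range_succ', Finset.sum_range_succ]
    simp
  rw [h1, add_sub_right_comm, ← Finset.sum_sub_distrib]
  simp only [pow_zero, Nat.choose_zero_right, Nat.cast_one, one_mul]
  congr 1
  refine Finset.sum_congr rfl fun i _ => ?_
  rw [Nat.choose_succ_succ]
  push_cast
  ring

theorem integral_max_sub_pow (n : ℕ) (a b c : ℝ) :
    ∫ t in a..b, max (t - c) 0 ^ (n + 1) =
      (max (b - c) 0 ^ (n + 2) - max (a - c) 0 ^ (n + 2)) / (n + 2) := by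
  have hc : Continuous fun t : ℝ => max (t - c) 0 ^ (n + 1) := by fun_prop
  have h := MeasureTheory.integral_eq_of_hasDerivAt_off_countable
    (fun t : ℝ => max (t - c) 0 ^ (n + 2) / (n + 2)) (fun t => max (t - c) 0 ^ (n + 1)) (a := a)
    (b := b) (Set.countable_singleton c) (Continuous.continuousOn (by fun_prop)) ?_
    (hc.intervalIntegrable a b)
  · rw [h, sub_div]
  · rintro x ⟨-, hx⟩
    rcases lt_or_gt_of_ne (show x ≠ c from hx) with h | h
    · rw [max_eq_right (by linarith), zero_pow (by omega)]
      refine (hasDerivAt_const x (0 : ℝ)).congr_of_eventuallyEq ?_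
      filter_upwards [Iio_mem_nhds h] with y hy
      rw [max_eq_right (by linarith [Set.mem_Iio.1 hy]), zero_pow (by omega), zero_div]
    · have h2 : HasDerivAt (fun t : ℝ => (t - c) ^ (n + 2) / (n + 2)) ((x - c) ^ (n + 1)) x := by
        have h3 : HasDerivAt (fun t : ℝ => (t - c) ^ (n + 2) / (n + 2)) _ x :=
          (((hasDerivAt_id x).sub_const c).pow (n + 2)).div_const ((n : ℝ) + 2)
        refine h3.congr_deriv ?_
        have : (n : ℝ) + 2 ≠ 0 := by positivity
        simp only [id, Nat.add_succ_sub_one]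
        push_cast
        field_simp
      rw [max_eq_left (by linarith)]
      refine h2.congr_of_eventuallyEq ?_
      filter_upwards [Ioi_mem_nhds h] with y hy
      rw [max_eq_left (by linarith [Set.mem_Ioi.1 hy])]

theorem cardinalBSpline_two (x : ℝ) :
    cardinalBSpline 2 x = max x 0 - 2 * max (x - 1) 0 + max (x - 2) 0 := by
  rw [cardinalBSpline_succ_eq 1 le_rfl, cardinalBSpline_one,
    intervalIntegral.integral_of_le (by linarith), ← integral_Icc_eq_integral_Ioc,
    setIntegral_indicator measurableSet_Icc, Set.Icc_inter_Icc]
  simp only [Pi.one_apply, integral_const, MeasurableSet.univ, measureReal_restrict_apply,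
    Set.univ_inter, smul_eq_mul, mul_one, Real.volume_real_Icc]
  rcases le_total x 0 with h0 | h0
  · rw [max_eq_right h0, max_eq_right (by linarith : x - 1 ≤ 0),
      max_eq_right (by linarith : x - 2 ≤ 0), min_eq_left (by linarith : x ≤ 1)]
    simpa using h0
  rcases le_total x 1 with h1 | h1
  · rw [max_eq_left h0, max_eq_right (by linarith : x - 1 ≤ 0),
      max_eq_right (by linarith : x - 2 ≤ 0), min_eq_left (by linarith : x ≤ 1)]
    simpa using h0
  rcases le_total x 2 with h2 | h2
  · rw [max_eq_left h0, max_eq_left (by linarith : 0 ≤ x - 1),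
      max_eq_right (by linarith : x - 2 ≤ 0), min_eq_right (by linarith : 1 ≤ x)]
    rw [max_eq_left (by linarith)]
    ring
  · rw [max_eq_left h0, max_eq_left (by linarith : 0 ≤ x - 1),
      max_eq_left (by linarith : 0 ≤ x - 2), min_eq_right (by linarith : 1 ≤ x)]
    rw [max_eq_right (by linarith)]
    ring

/-- Truncated power representation of the cardinal B-spline. -/
theorem cardinalBSpline_eq_sum (l : ℕ) (x : ℝ) :
    cardinalBSpline (l + 2) x = ((l + 1).factorial : ℝ)⁻¹ *
      ∑ i ∈ Finset.range (l + 3), (-1) ^ i * ((l + 2).choose i : ℝ) * max (x - i) 0 ^ (l + 1) := by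
  induction l generalizing x with
  | zero =>
    rw [cardinalBSpline_two]
    simp [Finset.sum_range_succ]
    ring
  | succ l ih =>
    rw [cardinalBSpline_succ_eq _ (by omega)]
    simp only [ih, intervalIntegral.integral_const_mul]
    rw [intervalIntegral.integral_finsetSum]
    · simp only [intervalIntegral.integral_const_mul, integral_max_sub_pow]
      -- Integrating a truncated power over [x-1, x] gives a first difference of the next truncated
      -- power, which raises the order of the binomial difference by one.
      rw [alternating_choose_sum (l + 2) fun i => max (x - i) 0 ^ (l + 1 + 1),
        Nat.factorial_succ (l + 1), Finset.mul_sum, Finset.mul_sum]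
      refine Finset.sum_congr rfl fun i _ => ?_
      have e : x - 1 - (i : ℝ) = x - ((i + 1 : ℕ) : ℝ) := by push_cast; ring
      rw [e]
      have : (l : ℝ) + 2 ≠ 0 := by positivity
      push_cast
      field_simp
      ring
    · intro i _
      exact Continuous.intervalIntegrable (by fun_prop) _ _

theorem cardinalBSpline_eq_pow {l : ℕ} (hl : 1 ≤ l) {x : ℝ} (h0 : 0 ≤ x) (h1 : x ≤ 1) :
    cardinalBSpline l x = ((l - 1).factorial : ℝ)⁻¹ * x ^ (l - 1) := by
  rcases hl.eq_or_lt with rfl | hl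
  · rw [cardinalBSpline_one, Set.indicator_of_mem (show x ∈ Set.Icc (0 : ℝ) 1 from ⟨h0, h1⟩)]
    simp
  · obtain ⟨m, rfl⟩ : ∃ m, l = m + 2 := ⟨l - 2, by omega⟩
    rw [cardinalBSpline_eq_sum, Finset.sum_range_succ', Finset.sum_eq_zero]
    · simp [h0]
    · intro i _
      rw [max_eq_right (by push_cast; linarith [(i.cast_nonneg : (0 : ℝ) ≤ i)]),
        zero_pow (by omega), mul_zero]

/-! ### Uniform approximation of cardinal B-splines -/

/-- The powers (y+i)^D at the D+1 distinct nodes i = 0, ..., D span all polynomials of degree at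
most D. This allows passing from degree m-1 to a power of two, which repeated squaring can produce.
-/
theorem exists_pow_eq_sum_shifted_pow {D k : ℕ} (hk : k ≤ D) :
    ∃ c : Fin (D + 1) → ℝ, ∀ y : ℝ, y ^ k = ∑ i, c i * (y + (i : ℕ)) ^ D := by
  set V : Matrix (Fin (D + 1)) (Fin (D + 1)) ℝ := Matrix.vandermonde fun i => ((i : ℕ) : ℝ)
    with hV
  have hdet : IsUnit V.transpose.det := by
    rw [Matrix.det_transpose, isUnit_iff_ne_zero, hV, Matrix.det_vandermonde_ne_zero_iff]
    intro i j hij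
    exact Fin.ext (Nat.cast_injective (R := ℝ) hij)
  -- By the binomial theorem, y^(D-l) has coefficient binom(D, l) Σ c_i i^l on the right. The
  -- moments of `c` are therefore prescribed to vanish except at l = D-k, where the coefficient must
  -- be 1.
  set r : Fin (D + 1) → ℝ := fun l => if (l : ℕ) = D - k then ((D.choose l : ℕ) : ℝ)⁻¹ else 0
    with hr
  refine ⟨V.transpose⁻¹.mulVec r, fun y => ?_⟩
  set c := V.transpose⁻¹.mulVec r with hc
  have h1 : V.transpose.mulVec c = r := by
    rw [hc, Matrix.mulVec_mulVec, Matrix.mul_nonsing_inv _ hdet, Matrix.one_mulVec]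
  have h2 : ∀ l : Fin (D + 1), ∑ i, c i * ((i : ℕ) : ℝ) ^ (l : ℕ) = r l := by
    intro l
    rw [← h1]
    simp only [Matrix.mulVec, dotProduct, Matrix.transpose_apply, hV, Matrix.vandermonde_apply]
    exact Finset.sum_congr rfl fun i _ => mul_comm _ _
  have h3 : ∀ i : Fin (D + 1), c i * (y + (i : ℕ)) ^ D =
      ∑ l : Fin (D + 1), c i * ((i : ℕ) : ℝ) ^ (l : ℕ) * (y ^ (D - l) * (D.choose l : ℕ)) := by
    intro i
    rw [add_comm, add_pow, Finset.mul_sum, Finset.sum_range]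
    exact Finset.sum_congr rfl fun l _ => by ring
  simp only [h3]
  rw [Finset.sum_comm]
  simp only [← Finset.sum_mul, h2, hr]
  rw [Finset.sum_eq_single ⟨D - k, by omega⟩]
  · have : ((D.choose (D - k) : ℕ) : ℝ) ≠ 0 := by
      exact_mod_cast (Nat.choose_pos (Nat.sub_le D k)).ne'
    simp only [if_true]
    rw [Nat.sub_sub_self hk]
    field_simp
  · intro l _ hl
    rw [if_neg (fun h => hl (Fin.ext h)), zero_mul]
  · simp

/-- The scaled and shifted truncations of `x` through whose powers the B-spline of order `m` is
expressed. -/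
def clipArg (m D : ℕ) (x : ℝ) (q : Fin m × Fin (D + 1)) : ℝ :=
  max (x / (m + D) - (q.1 : ℕ) / (m + D)) 0 - max (x / (m + D) - m / (m + D)) 0 +
    (q.2 : ℕ) / (m + D)

theorem clipArg_eq {m : ℕ} (D : ℕ) (x : ℝ) (q : Fin m × Fin (D + 1)) :
    clipArg m D x q = (max (min x m - (q.1 : ℕ)) 0 + (q.2 : ℕ)) / (m + D) := by
  have hm : 0 < m := q.1.pos
  have hS : (0 : ℝ) < m + D := by positivity
  have hq : ((q.1 : ℕ) : ℝ) ≤ m := by exact_mod_cast q.1.2.le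
  unfold clipArg
  rw [← sub_div, ← sub_div]
  have h (z : ℝ) : max (z / ((m : ℝ) + D)) 0 = max z 0 / (m + D) := by
    have := max_div_div_right hS.le z 0
    rwa [zero_div] at this
  rw [h, h, ← sub_div, ← add_div]
  congr 2
  rcases le_total x m with h | h
  · rw [min_eq_left h, max_eq_right (by linarith : x - m ≤ 0), sub_zero]
  · rw [min_eq_right h, max_eq_left (by linarith : 0 ≤ x - m), max_eq_left (by linarith),
      max_eq_left (by linarith)]
    ring

theorem clipArg_nonneg {m : ℕ} (D : ℕ) (x : ℝ) (q : Fin m × Fin (D + 1)) :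
    0 ≤ clipArg m D x q := by
  rw [clipArg_eq]
  positivity

theorem clipArg_le_one {m : ℕ} (D : ℕ) (x : ℝ) (q : Fin m × Fin (D + 1)) :
    clipArg m D x q ≤ 1 := by
  have hm : 0 < m := q.1.pos
  have hS : (0 : ℝ) < m + D := by positivity
  rw [clipArg_eq, div_le_one hS]
  have h2 : ((q.2 : ℕ) : ℝ) ≤ D := by exact_mod_cast Nat.lt_succ_iff.1 q.2.2
  have h1 : (0 : ℝ) ≤ (q.1 : ℕ) := by positivity
  have : max (min x m - ((q.1 : ℕ) : ℝ)) 0 ≤ m :=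
    max_le (by linarith [min_le_right x (m : ℝ)]) (by positivity)
  linarith

/-- Truncated powers are unbounded and cancel only in the sum for x > m. Clipping the argument at m
first makes every summand bounded; after division by m + D all bases lie in [0, 1], where the power
network is accurate. -/
theorem exists_cardinalBSpline_eq_sum {m D : ℕ} (hm : 2 ≤ m) (hD : m ≤ D) :
    ∃ a : Fin m × Fin (D + 1) → ℝ, ∀ x,
      cardinalBSpline m x = ∑ q, a q * clipArg m D x q ^ D := by
  obtain ⟨c, hc⟩ := exists_pow_eq_sum_shifted_pow (D := D) (k := m - 1) (by omega)
  have hS : (0 : ℝ) < m + D := by positivity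
  obtain ⟨l, rfl⟩ : ∃ l, m = l + 2 := ⟨m - 2, by omega⟩
  refine ⟨fun q => ((l + 1).factorial : ℝ)⁻¹ * ((-1) ^ (q.1 : ℕ) * ((l + 2).choose q.1 : ℝ)) *
    (c q.2 * (((l + 2 : ℕ) : ℝ) + D) ^ D), fun x => ?_⟩
  -- N_m vanishes at and beyond m, so clipping changes nothing. After clipping, the truncated power
  -- centred at m is zero, and only the shifts 0, ..., m-1 remain.
  have hx : cardinalBSpline (l + 2) x = cardinalBSpline (l + 2) (min x (l + 2 : ℕ)) := by
    rcases le_total x (l + 2 : ℕ) with h | h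
    · rw [min_eq_left h]
    · rw [min_eq_right h, cardinalBSpline_eq_zero_of_ge hm h,
        cardinalBSpline_eq_zero_of_ge hm le_rfl]
  rw [hx, cardinalBSpline_eq_sum, Finset.sum_range_succ,
    max_eq_right (by linarith [min_le_right x ((l + 2 : ℕ) : ℝ)]), zero_pow (by omega), mul_zero,
    add_zero, Finset.sum_range, Finset.mul_sum, Fintype.sum_prod_type]
  refine Finset.sum_congr rfl fun j _ => ?_
  have := hc (max (min x (l + 2 : ℕ) - (j : ℕ)) 0)
  rw [show l + 2 - 1 = l + 1 from rfl] at this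
  rw [this, Finset.mul_sum, Finset.mul_sum]
  refine Finset.sum_congr rfl fun i _ => ?_
  rw [clipArg_eq, div_pow]
  field_simp

namespace ReLUNetwork

/-- The network computing all values `clipArg m D x`. -/
def clip (m D : ℕ) : ReLUNetwork 1 (m * (D + 1) * 1) :=
  layer (fun (_ : Fin (m + 1)) (_ : Fin 1) => 1 / ((m : ℝ) + D))
    (fun j => -((j : ℕ) / ((m : ℝ) + D)))
    (affine (fun p l => (if l = (p.divNat.divNat).castSucc then 1 else 0) -
      (if l = Fin.last m then 1 else 0)) (fun p => (p.divNat.modNat : ℕ) / ((m : ℝ) + D)))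

theorem divNat_finProdFinEquiv {m n : ℕ} (q : Fin m × Fin n) :
    (finProdFinEquiv q).divNat = q.1 :=
  congrArg Prod.fst (finProdFinEquiv.symm_apply_apply q)

theorem modNat_finProdFinEquiv {m n : ℕ} (q : Fin m × Fin n) :
    (finProdFinEquiv q).modNat = q.2 :=
  congrArg Prod.snd (finProdFinEquiv.symm_apply_apply q)

theorem realize_clip (m D : ℕ) (x : ℝ) (q : Fin m × Fin (D + 1)) (i : Fin 1) :
    (clip m D).realize (fun _ => x) (finProdFinEquiv (finProdFinEquiv q, i)) =
      clipArg m D x q := by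
  simp only [clip, realize, affineMap, Matrix.mulVec, dotProduct, Pi.add_apply,
    divNat_finProdFinEquiv, modNat_finProdFinEquiv, sub_mul, ite_mul, one_mul, zero_mul,
    Finset.sum_sub_distrib, Finset.sum_ite_eq', Finset.mem_univ, if_true, clipArg,
    Fin.sum_univ_one, Fin.val_castSucc, Fin.val_last]
  ring_nf

theorem weightMagnitude_clip_le {m D : ℕ} (hm : 0 < m) : (clip m D).weightMagnitude ≤ 1 := by
  have hS : (1 : ℝ) ≤ m + D := by exact_mod_cast (by omega : 1 ≤ m + D)
  have hS0 : (0 : ℝ) < m + D := by linarith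
  have hdiv : ∀ k : ℕ, k ≤ m + D → |(k : ℝ) / (m + D)| ≤ 1 := by
    intro k hk
    rw [abs_of_nonneg (by positivity), div_le_one hS0]
    exact_mod_cast hk
  refine sup_le (maxWeight_le_iff.2 ⟨fun i j => ?_, fun i => ?_⟩)
    (maxWeight_le_iff.2 ⟨fun i j => ?_, fun i => ?_⟩)
  · have := hdiv 1 (by omega)
    rw [← NNReal.coe_le_coe]
    simpa using this
  · rw [nnnorm_neg, ← NNReal.coe_le_coe]
    exact hdiv i (by omega)
  · rw [← NNReal.coe_le_coe]
    show |_| ≤ (1 : ℝ)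
    split_ifs <;> simp
  · rw [← NNReal.coe_le_coe]
    exact hdiv _ (by have := (i.divNat.modNat).2; omega)

theorem nondegenerate_clip {m D : ℕ} (hm : 0 < m) : (clip m D).Nondegenerate := by
  have hS : (0 : ℝ) < m + D := by positivity
  refine ⟨fun j => ⟨0, by positivity⟩, fun l => ?_, fun p => ⟨Fin.last m, ?_⟩⟩
  · induction l using Fin.lastCases with
    | last =>
      refine ⟨finProdFinEquiv (finProdFinEquiv (⟨0, hm⟩, 0), 0), ?_⟩
      simp only [divNat_finProdFinEquiv]
      rw [if_neg (Fin.castSucc_lt_last _).ne']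
      norm_num
    | cast l =>
      refine ⟨finProdFinEquiv (finProdFinEquiv (l, 0), 0), ?_⟩
      simp only [divNat_finProdFinEquiv]
      rw [if_neg (Fin.castSucc_lt_last _).ne]
      norm_num
  · simp only
    rw [if_neg (Fin.castSucc_lt_last _).ne']
    norm_num

/-- If `Φ` approximates a nonnegative function up to `E`, then `s`-fold doubling approximates its
`2 ^ s`-fold multiple up to `2 ^ s * E`. -/
theorem exists_iterated_double {Φ : ReLUNetwork 1 1} {f : ℝ → ℝ} {E : ℝ} (hf : ∀ x, 0 ≤ f x)
    (hΦ : Φ.Nondegenerate) (hw : Φ.weightMagnitude ≤ 1) (h : ∀ x, |Φ.toRealFun x - f x| ≤ E)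
    (s : ℕ) :
    ∃ Ψ : ReLUNetwork 1 1, Ψ.Nondegenerate ∧ Ψ.weightMagnitude ≤ 1 ∧
      Ψ.connectivity ≤ Φ.connectivity + 7 * s ∧
      ∀ x, |Ψ.toRealFun x - 2 ^ s * f x| ≤ 2 ^ s * E := by
  induction s with
  | zero => exact ⟨Φ, hΦ, hw, by simp, by simpa using h⟩
  | succ s ih =>
    obtain ⟨Ψ, h1, h2, h3, h4⟩ := ih
    refine ⟨Ψ.double, h1.double, weightMagnitude_double_le h2, ?_, fun x => ?_⟩
    · have := connectivity_double_le Ψ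
      omega
    · have hr : Ψ.double.toRealFun x = 2 * max (Ψ.toRealFun x) 0 := realize_double _ _ _
      have h0 : (0 : ℝ) ≤ 2 ^ s * f x := mul_nonneg (by positivity) (hf x)
      have h5 : |max (Ψ.toRealFun x) 0 - max (2 ^ s * f x) 0| ≤ |Ψ.toRealFun x - 2 ^ s * f x| :=
        abs_max_sub_max_le_abs _ _ _
      rw [max_eq_left h0] at h5
      rw [hr, pow_succ, show 2 * max (Ψ.toRealFun x) 0 - 2 ^ s * 2 * f x =
        2 * (max (Ψ.toRealFun x) 0 - 2 ^ s * f x) by ring, abs_mul, abs_two]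
      linarith [h4 x]

/-- The polynomial representation has fixed coefficients and a fixed number of terms, so only the
power networks grow with T, and linearly. The coefficients, scaled down by 2^s to obey the weight
bound, are restored by doublings; positivity of N_m makes the rectifiers inside the doublings
harmless. -/
theorem exists_approx_cardinalBSpline {m : ℕ} (hm : 2 ≤ m) :
    ∃ K : ℕ, 0 < K ∧ ∀ T : ℕ, ∃ Φ : ReLUNetwork 1 1, Φ.Nondegenerate ∧ Φ.weightMagnitude ≤ 1 ∧
      Φ.connectivity ≤ K * (T + 1) ∧
      ∀ x, |Φ.toRealFun x - cardinalBSpline m x| ≤ K * (4 ^ T)⁻¹ := by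
  obtain ⟨a, ha⟩ := exists_cardinalBSpline_eq_sum hm (Nat.lt_two_pow_self (n := m)).le
  obtain ⟨s, hs⟩ : ∃ s : ℕ, ∀ q, |a q| ≤ 2 ^ s := by
    obtain ⟨s, hs⟩ := pow_unbounded_of_one_lt (∑ q, |a q|) (one_lt_two)
    exact ⟨s, fun q => (Finset.single_le_sum (f := fun q => |a q|) (fun _ _ => abs_nonneg _)
      (Finset.mem_univ q)).trans hs.le⟩
  set P : ℕ := m * (2 ^ m + 1) with hP
  have hP0 : 0 < P := by positivity
  set C : ℕ := (clip m (2 ^ m)).connectivity with hC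
  -- The constant collects the clipping network, P power networks with their output weights, and 7
  -- weights per doubling. Its last summand is the error constant: P terms, each contributing (2^m +
  -- 1) 4^(-T), magnified by 2^s.
  refine ⟨C + P * (10 * m + 12 * m + 3) + 7 * s + 2 ^ s * (P * (2 ^ m + 1)), by positivity,
    fun T => ?_⟩
  have hT0 : (0 : ℝ) < (4 ^ T)⁻¹ := by positivity
  have hT1 : ((4 : ℝ) ^ T)⁻¹ ≤ 1 := inv_le_one_of_one_le₀ (one_le_pow₀ (by norm_num))
  have h2s : (0 : ℝ) < 2 ^ s := by positivity
  -- A vanishing coefficient would leave an output node of a copy without outgoing edge. Replacing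
  -- it by 4^(-T) keeps the network nondegenerate at the cost of an admissible error.
  set a' : Fin m × Fin (2 ^ m + 1) → ℝ := fun q => if a q = 0 then (4 ^ T)⁻¹ else a q / 2 ^ s
    with ha'
  have ha'0 : ∀ q, a' q ≠ 0 := by
    intro q
    simp only [ha']
    split_ifs with h
    · exact hT0.ne'
    · exact div_ne_zero h h2s.ne'
  have ha'1 : ∀ q, |a' q| ≤ 1 := by
    intro q
    simp only [ha']
    split_ifs with h
    · rwa [abs_of_pos hT0]
    · rw [abs_div, abs_of_pos h2s, div_le_one h2s]
      exact hs q
  have ha'2 : ∀ q, |a' q - a q / 2 ^ s| ≤ (4 ^ T)⁻¹ := by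
    intro q
    simp only [ha']
    split_ifs with h
    · rw [h, zero_div, sub_zero, abs_of_pos hT0]
    · rw [sub_self, abs_zero]
      exact hT0.le
  set Φ : ReLUNetwork 1 1 :=
    combine (clip m (2 ^ m)) (power T m) (fun p => a' (finProdFinEquiv.symm p)) with hΦ
  have hval : ∀ x, Φ.toRealFun x =
      ∑ q, a' q * max ((power T m).toRealFun (clipArg m (2 ^ m) x q)) 0 := by
    intro x
    rw [hΦ, toRealFun, realize_combine, ← finProdFinEquiv.sum_comp]
    refine Finset.sum_congr rfl fun q _ => ?_
    rw [realize_clip, Equiv.symm_apply_apply, max_eq_left (clipArg_nonneg _ _ _)]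
  have herr : ∀ x, |Φ.toRealFun x - cardinalBSpline m x / 2 ^ s| ≤
      P * (2 ^ m + 1) * (4 ^ T)⁻¹ := by
    intro x
    rw [hval, ha, Finset.sum_div, ← Finset.sum_sub_distrib]
    refine (Finset.abs_sum_le_sum_abs _ _).trans ?_
    have : ∀ q ∈ (Finset.univ : Finset (Fin m × Fin (2 ^ m + 1))),
        |a' q * max ((power T m).toRealFun (clipArg m (2 ^ m) x q)) 0 -
          a q * clipArg m (2 ^ m) x q ^ 2 ^ m / 2 ^ s| ≤ (2 ^ m + 1) * (4 ^ T)⁻¹ := by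
      intro q _
      set u := clipArg m (2 ^ m) x q with hu
      have hu0 : 0 ≤ u := clipArg_nonneg _ _ _
      have hu1 : u ≤ 1 := clipArg_le_one _ _ _
      obtain ⟨b0, b1⟩ := toRealFun_power_bounds T m hu0 hu1
      have hp0 : 0 ≤ u ^ 2 ^ m := by positivity
      have hp1 : u ^ 2 ^ m ≤ 1 := pow_le_one₀ hu0 hu1
      rw [max_eq_left (hp0.trans b0)]
      have e : a' q * (power T m).toRealFun u - a q * u ^ 2 ^ m / 2 ^ s =
          a' q * ((power T m).toRealFun u - u ^ 2 ^ m) + (a' q - a q / 2 ^ s) * u ^ 2 ^ m := by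
        ring
      rw [e]
      refine (abs_add_le _ _).trans ?_
      rw [abs_mul, abs_mul, abs_of_nonneg hp0, abs_of_nonneg (sub_nonneg.2 b0)]
      have k1 : |a' q| * ((power T m).toRealFun u - u ^ 2 ^ m) ≤ 1 * (2 ^ m * (4 ^ T)⁻¹) := by
        refine mul_le_mul (ha'1 q) (by linarith) (by linarith) zero_le_one
      have k2 : |a' q - a q / 2 ^ s| * u ^ 2 ^ m ≤ (4 ^ T)⁻¹ * 1 :=
        mul_le_mul (ha'2 q) hp1 hp0 hT0.le
      linarith
    refine (Finset.sum_le_card_nsmul _ _ _ this).trans (le_of_eq ?_)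
    simp only [Finset.card_univ, Fintype.card_prod, Fintype.card_fin, ← hP, nsmul_eq_mul]
    ring
  obtain ⟨Ψ, h1, h2, h3, h4⟩ := exists_iterated_double
    (fun x => div_nonneg (cardinalBSpline_nonneg (by omega) x) h2s.le)
    ((nondegenerate_clip (by omega)).combine hP0 (nondegenerate_power T m) fun p => ha'0 _)
    (weightMagnitude_combine_le (weightMagnitude_clip_le (by omega)) (weightMagnitude_power_le T m)
      fun p => ha'1 _) herr s
  refine ⟨Ψ, h1, h2, h3.trans ?_, fun x => ?_⟩
  · have k1 := connectivity_combine_le (clip m (2 ^ m)) (power T m)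
      (fun p => a' (finProdFinEquiv.symm p))
    change _ ≤ C + P * (power T m).connectivity + P at k1
    have k2 := Nat.mul_le_mul_left P (connectivity_power_le T m)
    have k3 : P * (m * (12 * T + 10) + 2) = 12 * (P * m * T) + 10 * (P * m) + 2 * P := by ring
    have k4 : (C + P * (10 * m + 12 * m + 3) + 7 * s + 2 ^ s * (P * (2 ^ m + 1))) * (T + 1) =
      C * T + C + 22 * (P * m * T) + 3 * (P * T) + 22 * (P * m) + 3 * P + 7 * s * T + 7 * s +
        2 ^ s * (P * (2 ^ m + 1)) * (T + 1) := by ring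
    refine (Nat.add_le_add_right k1 _).trans ?_
    rw [k4]
    have := Nat.zero_le (7 * s * T)
    have := Nat.zero_le (2 ^ s * (P * (2 ^ m + 1)) * (T + 1))
    omega
  · have := h4 x
    rw [mul_div_cancel₀ _ h2s.ne'] at this
    refine this.trans ?_
    push_cast
    rw [← mul_assoc]
    refine mul_le_mul_of_nonneg_right ?_ hT0.le
    have : (0 : ℝ) ≤ (C : ℝ) + P * (10 * m + 12 * m + 3) + 7 * s := by positivity
    linarith

theorem exists_approx_cardinalBSpline_logb {m : ℕ} (hm : 2 ≤ m) :
    ∃ K : ℝ, 0 < K ∧ ∀ ε : ℝ, 0 < ε → ε < 1 / 2 →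
      ∃ Φ : ReLUNetwork 1 1, Φ.Nondegenerate ∧
        (∀ x : ℝ, |Φ.toRealFun x - cardinalBSpline m x| ≤ ε) ∧
        (Φ.connectivity : ℝ) ≤ K * Real.logb 2 ε⁻¹ ∧ Φ.weightMagnitude ≤ 1 := by
  obtain ⟨K, hK, h⟩ := exists_approx_cardinalBSpline hm
  refine ⟨K * (K + 3), by positivity, fun ε h0 h1 => ?_⟩
  set L := Real.logb 2 ε⁻¹ with hL
  have hεinv : 2 < ε⁻¹ := by
    rw [lt_inv_comm₀ two_pos h0]
    linarith
  have hL1 : 1 ≤ L := by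
    rw [hL, Real.le_logb_iff_rpow_le one_lt_two (by positivity), Real.rpow_one]
    exact hεinv.le
  -- 4^⌈L⌉ is at least ε⁻¹, and the extra factor 4^K absorbs the error constant K.
  obtain ⟨Φ, a1, a2, a3, a4⟩ := h (⌈L⌉₊ + K)
  have hceil : (⌈L⌉₊ : ℝ) ≤ L + 1 := (Nat.ceil_lt_add_one (by linarith)).le
  refine ⟨Φ, a1, fun x => (a4 x).trans ?_, ?_, a2⟩
  · have e1 : (K : ℝ) ≤ 4 ^ K := by exact_mod_cast (Nat.lt_pow_self (by norm_num)).le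
    have e2 : ε⁻¹ ≤ 4 ^ ⌈L⌉₊ := by
      calc ε⁻¹ = (2 : ℝ) ^ L := (Real.rpow_logb two_pos (by norm_num) (by positivity)).symm
        _ ≤ (2 : ℝ) ^ (⌈L⌉₊ : ℝ) := Real.rpow_le_rpow_of_exponent_le one_le_two (Nat.le_ceil L)
        _ = 2 ^ ⌈L⌉₊ := Real.rpow_natCast _ _
        _ ≤ 4 ^ ⌈L⌉₊ := pow_le_pow_left₀ two_pos.le (by norm_num) _
    rw [pow_add, mul_inv]
    calc (K : ℝ) * ((4 ^ ⌈L⌉₊)⁻¹ * (4 ^ K)⁻¹) ≤ 4 ^ K * (ε * (4 ^ K)⁻¹) := by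
          gcongr
          exact inv_le_of_inv_le₀ h0 e2
      _ = ε := by field_simp
  · calc (Φ.connectivity : ℝ) ≤ K * ((⌈L⌉₊ : ℝ) + K + 1) := by exact_mod_cast a3
      _ ≤ K * ((K + 3) * L) := by
          refine mul_le_mul_of_nonneg_left ?_ (by positivity)
          nlinarith [(K.cast_nonneg : (0 : ℝ) ≤ K)]
      _ = K * (K + 3) * L := by ring

end ReLUNetwork

/-! ### Spline wavelets -/

/-- Each derivative is a backward difference that lowers the order by one. Integers are excluded
because N_1 jumps; as they form a closed set, the induction hypothesis holds in a neighbourhood of y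
and may be differentiated. -/
theorem iteratedDeriv_cardinalBSpline (k : ℕ) : ∀ {l : ℕ}, 1 ≤ l → ∀ {y : ℝ},
    y ∉ Set.range ((↑) : ℤ → ℝ) → iteratedDeriv k (cardinalBSpline (l + k)) y =
      ∑ i ∈ Finset.range (k + 1), (-1) ^ i * (k.choose i : ℝ) * cardinalBSpline l (y - i) := by
  induction k with
  | zero =>
    intro l hl y hy
    simp
  | succ k ih =>
    intro l hl y hy
    have hopen : IsOpen (Set.range ((↑) : ℤ → ℝ))ᶜ :=
      Int.isClosedEmbedding_coe_real.isClosed_range.isOpen_compl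
    have hev : iteratedDeriv k (cardinalBSpline (l + (k + 1))) =ᶠ[𝓝 y] fun y =>
        ∑ i ∈ Finset.range (k + 1),
          (-1) ^ i * (k.choose i : ℝ) * cardinalBSpline (l + 1) (y - i) := by
      filter_upwards [hopen.mem_nhds hy] with z hz
      rw [show l + (k + 1) = l + 1 + k by ring]
      exact ih (by omega) hz
    have hint : ∀ i : ℕ, y - i ∉ Set.range ((↑) : ℤ → ℝ) := by
      rintro i ⟨z, hz⟩
      exact hy ⟨z + i, by push_cast; linarith⟩
    have hd : ∀ i : ℕ, HasDerivAt (fun y => cardinalBSpline (l + 1) (y - i))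
        (cardinalBSpline l (y - i) - cardinalBSpline l (y - (i + 1 : ℕ))) y := by
      intro i
      have h := hasDerivAt_cardinalBSpline hl (continuousAt_cardinalBSpline hl (hint i))
        (by
          have := continuousAt_cardinalBSpline hl (hint (i + 1))
          convert this using 1
          push_cast
          ring)
      have e : y - ((i + 1 : ℕ) : ℝ) = y - i - 1 := by push_cast; ring
      rw [e]
      exact h.comp_sub_const y (i : ℝ)
    rw [iteratedDeriv_succ, hev.deriv_eq,
      (HasDerivAt.fun_sum fun i _ => (hd i).const_mul _).deriv,
      alternating_choose_sum k fun i => cardinalBSpline l (y - i)]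

/-- The two-scale relation for the spline wavelet. -/
theorem splineWavelet_eq_sum {m : ℕ} (hm : 1 ≤ m) {x : ℝ}
    (hx : 2 * x ∉ Set.range ((↑) : ℤ → ℝ)) :
    splineWavelet m x = ∑ n ∈ Finset.Icc 1 (3 * m - 1),
      twoScaleCoeff m n * cardinalBSpline m (2 * x - n + 1) := by
  have hint : ∀ i : ℕ, 2 * x - i ∉ Set.range ((↑) : ℤ → ℝ) := by
    rintro i ⟨z, hz⟩
    exact hx ⟨z + i, by push_cast; linarith⟩
  have hd : ∀ j : ℕ, iteratedDeriv m (cardinalBSpline (2 * m)) (2 * x - j) =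
      ∑ i ∈ Finset.range (m + 1), (-1) ^ i * (m.choose i : ℝ) *
        cardinalBSpline m (2 * x - j - i) := by
    intro j
    rw [two_mul m]
    exact iteratedDeriv_cardinalBSpline m hm (hint j)
  -- Reindex by n = j + 1 + i, the total shift. The values of n not reached contribute nothing,
  -- since N_2m vanishes at integers outside 1, ..., 2m-1.
  have key : ∀ i ∈ Finset.range (m + 1),
      ∑ j ∈ Finset.range (2 * m - 1), (-1 : ℝ) ^ j * cardinalBSpline (2 * m) (j + 1) *
        ((-1) ^ i * (m.choose i : ℝ) * cardinalBSpline m (2 * x - j - i)) =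
      ∑ n ∈ Finset.Icc 1 (3 * m - 1), (-1 : ℝ) ^ (n + 1) * ((m.choose i : ℝ) *
        cardinalBSpline (2 * m) (n - i)) * cardinalBSpline m (2 * x - n + 1) := by
    intro i hi
    have hi' : i ≤ m := Nat.lt_succ_iff.1 (Finset.mem_range.1 hi)
    refine Finset.sum_of_injOn (fun j => j + 1 + i) (fun a _ b _ h => by simpa using h) ?_ ?_ ?_
    · intro j hj
      simp only [Finset.coe_range, Set.mem_Iio] at hj
      simp only [Finset.coe_Icc, Set.mem_Icc]
      omega
    · intro n hn hn'
      have h0 : cardinalBSpline (2 * m) ((n : ℝ) - i) = 0 := by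
        rcases le_or_gt n i with h | h
        · exact cardinalBSpline_eq_zero_of_nonpos (by omega)
            (sub_nonpos.2 (by exact_mod_cast h))
        · rcases lt_or_ge (n - 1 - i) (2 * m - 1) with h2 | h2
          · exact absurd ⟨n - 1 - i, by simpa using h2, by simp only; omega⟩ hn'
          · refine cardinalBSpline_eq_zero_of_ge (by omega) ?_
            rw [le_sub_iff_add_le]
            exact_mod_cast (by omega : 2 * m + i ≤ n)
      rw [h0]
      ring
    · intro j _
      have e1 : ((j + 1 + i : ℕ) : ℝ) - i = j + 1 := by push_cast; ring
      have e2 : 2 * x - ((j + 1 + i : ℕ) : ℝ) + 1 = 2 * x - j - i := by push_cast; ring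
      rw [e1, e2, pow_add, pow_add, pow_add]
      ring
  unfold splineWavelet twoScaleCoeff
  simp only [hd, Finset.mul_sum, Finset.sum_mul]
  rw [Finset.sum_comm, Finset.sum_comm (s := Finset.Icc 1 (3 * m - 1))]
  refine Finset.sum_congr rfl fun i hi => ?_
  rw [← Finset.mul_sum, key i hi, Finset.mul_sum]
  refine Finset.sum_congr rfl fun n _ => ?_
  ring

theorem ae_affine_notMem_range_intCast {a : ℝ} (ha : a ≠ 0) (b : ℝ) :
    ∀ᵐ x : ℝ, a * x + b ∉ Set.range ((↑) : ℤ → ℝ) := by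
  have hc : ((fun x : ℝ => a * x + b) ⁻¹' Set.range ((↑) : ℤ → ℝ)).Countable :=
    (Set.countable_range _).preimage_of_injOn fun x _ y _ h => by
      simpa [ha] using h
  exact hc.ae_notMem volume

theorem splineWavelet_ae_eq {m : ℕ} (hm : 1 ≤ m) :
    splineWavelet m =ᵐ[volume] fun x => ∑ n ∈ Finset.Icc 1 (3 * m - 1),
      twoScaleCoeff m n * cardinalBSpline m (2 * x - n + 1) := by
  filter_upwards [ae_affine_notMem_range_intCast two_ne_zero 0] with x hx
  rw [add_zero] at hx
  exact splineWavelet_eq_sum hm hx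

/-- Only j = 0 survives, and the coefficient is N_2m(1)/2^(m-1) with N_2m(1) = 1/(2m-1)!. -/
theorem twoScaleCoeff_one_pos {m : ℕ} (hm : 1 ≤ m) : 0 < twoScaleCoeff m 1 := by
  unfold twoScaleCoeff
  rw [Finset.sum_range_succ', Finset.sum_eq_zero]
  · have h := cardinalBSpline_eq_pow (l := 2 * m) (by omega) zero_le_one le_rfl
    simp [h]
    positivity
  · intro j _
    rw [cardinalBSpline_eq_zero_of_nonpos (by omega) (by push_cast; linarith [(j.cast_nonneg : (0 : ℝ) ≤ j)]), mul_zero]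

/-- On (0, 1/2) only the first B-spline of the two-scale relation is active, so the wavelet is a
positive multiple of a monomial in 2x. This is the local information that distinguishes different
shifts in L²(Ω). -/
theorem splineWavelet_ne_zero {m : ℕ} (hm : 1 ≤ m) {x : ℝ} (h0 : 0 < x) (h1 : x < 1 / 2) :
    splineWavelet m x ≠ 0 := by
  have hx : 2 * x ∉ Set.range ((↑) : ℤ → ℝ) := by
    rintro ⟨z, hz⟩
    have h2 : (0 : ℝ) < z := by linarith
    have h3 : (z : ℝ) < 1 := by linarith
    have : 0 < z := by exact_mod_cast h2
    have : z < 1 := by exact_mod_cast h3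
    omega
  rw [splineWavelet_eq_sum hm hx, Finset.sum_eq_single_of_mem 1 (by simp; omega)]
  · rw [show 2 * x - ((1 : ℕ) : ℝ) + 1 = 2 * x by push_cast; ring,
      cardinalBSpline_eq_pow hm (by linarith) (by linarith)]
    have := twoScaleCoeff_one_pos hm
    positivity
  · intro n hn hn1
    have : 2 ≤ n := by
      have := (Finset.mem_Icc.1 hn).1
      omega
    have h2 : (2 : ℝ) ≤ n := by exact_mod_cast this
    rw [cardinalBSpline_eq_zero_of_neg hm (by linarith), mul_zero]

theorem splineWavelet_eq_zero_of_neg {m : ℕ} (hm : 1 ≤ m) {x : ℝ} (h : x < 0)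
    (hx : 2 * x ∉ Set.range ((↑) : ℤ → ℝ)) : splineWavelet m x = 0 := by
  rw [splineWavelet_eq_sum hm hx]
  refine Finset.sum_eq_zero fun n hn => ?_
  have h2 : (1 : ℝ) ≤ n := by exact_mod_cast (Finset.mem_Icc.1 hn).1
  rw [cardinalBSpline_eq_zero_of_neg hm (by linarith), mul_zero]

theorem splineWavelet_eq_zero_of_gt {m : ℕ} (hm : 1 ≤ m) {x : ℝ} (h : 2 * (m : ℝ) < x)
    (hx : 2 * x ∉ Set.range ((↑) : ℤ → ℝ)) : splineWavelet m x = 0 := by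
  rw [splineWavelet_eq_sum hm hx]
  refine Finset.sum_eq_zero fun n hn => ?_
  have h2 : (n : ℝ) ≤ 3 * m := by exact_mod_cast ((Finset.mem_Icc.1 hn).2.trans (Nat.sub_le _ _))
  rw [cardinalBSpline_eq_zero_of_gt hm (by linarith), mul_zero]

/-- The integer shift in the label of a member of the spline wavelet system. -/
def splineShift : (ℕ × ℤ) ⊕ ℤ → ℤ
  | Sum.inl (_, k) => k
  | Sum.inr k => k

/-- The members of the spline wavelet system are combinations of dilated and shifted B-splines. -/
theorem exists_splineFun_ae_eq_sum {m : ℕ} (hm : 1 ≤ m) :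
    ∃ Q : ℝ, 1 ≤ Q ∧ ∀ ι : (ℕ × ℤ) ⊕ ℤ, ∃ (c β : ℕ → ℝ) (α : ℝ), 1 ≤ α ∧
      α ≤ 2 * 2 ^ splineScale ι ∧ (∀ n ∈ Finset.Icc 1 (3 * m - 1), |c n| ≤ Q * 2 ^ splineScale ι) ∧
      (∀ n ∈ Finset.Icc 1 (3 * m - 1), |β n| ≤ 2 * |(splineShift ι : ℝ)| + 3 * m) ∧
      splineFun m ι =ᵐ[volume] fun x => ∑ n ∈ Finset.Icc 1 (3 * m - 1),
        c n * cardinalBSpline m (α * x + β n) := by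
  refine ⟨1 + ∑ n ∈ Finset.Icc 1 (3 * m - 1), |twoScaleCoeff m n|,
    le_add_of_nonneg_right (Finset.sum_nonneg fun _ _ => abs_nonneg _), ?_⟩
  have hQ : 0 ≤ ∑ n ∈ Finset.Icc 1 (3 * m - 1), |twoScaleCoeff m n| :=
    Finset.sum_nonneg fun _ _ => abs_nonneg _
  rintro (⟨s, k⟩ | k)
  · have hs1 : (1 : ℝ) ≤ 2 ^ s := one_le_pow₀ one_le_two
    refine ⟨fun n => (2 : ℝ) ^ ((s : ℝ) / 2) * twoScaleCoeff m n, fun n => -2 * k - n + 1,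
      2 * 2 ^ s, by linarith, le_rfl, fun n hn => ?_, fun n hn => ?_, ?_⟩
    · have h1 : (2 : ℝ) ^ ((s : ℝ) / 2) ≤ 2 ^ s := by
        rw [← Real.rpow_natCast]
        refine Real.rpow_le_rpow_of_exponent_le one_le_two ?_
        linarith [(s.cast_nonneg : (0 : ℝ) ≤ s)]
      rw [abs_mul, abs_of_pos (by positivity : (0 : ℝ) < 2 ^ ((s : ℝ) / 2)), mul_comm]
      refine mul_le_mul ?_ h1 (by positivity) (by positivity)
      linarith [Finset.single_le_sum (f := fun n => |twoScaleCoeff m n|)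
        (fun _ _ => abs_nonneg _) hn]
    · have h1 : (1 : ℝ) ≤ n := by exact_mod_cast (Finset.mem_Icc.1 hn).1
      have h2 : (n : ℝ) ≤ 3 * m := by
        exact_mod_cast ((Finset.mem_Icc.1 hn).2.trans (Nat.sub_le _ _))
      simp only [splineShift]
      rw [abs_le]
      constructor <;> linarith [neg_abs_le (k : ℝ), le_abs_self (k : ℝ)]
    · filter_upwards [ae_affine_notMem_range_intCast
        (by positivity : (2 * 2 ^ s : ℝ) ≠ 0) (-2 * k)] with x hx
      simp only [splineFun]
      rw [splineWavelet_eq_sum hm (by convert hx using 1; ring_nf), Finset.mul_sum]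
      refine Finset.sum_congr rfl fun n _ => ?_
      rw [mul_assoc]
      congr 3
      ring
  -- A scaling function is a single B-spline; it is padded with zero coefficients to share the
  -- format of the wavelets.
  · refine ⟨fun n => if n = 1 then 1 else 0, fun _ => -k, 1, le_rfl, ?_, fun n _ => ?_,
      fun n _ => ?_, ?_⟩
    · simp [splineScale]
    · simp only [splineScale, pow_zero, mul_one]
      split_ifs
      · rw [abs_one]
        linarith
      · rw [abs_zero]
        linarith
    · simp only [splineShift, abs_neg]
      linarith [abs_nonneg (k : ℝ), (m.cast_nonneg : (0 : ℝ) ≤ m)]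
    · filter_upwards with x
      rw [Finset.sum_eq_single_of_mem 1 (by simp; omega)]
      · simp [splineFun, sub_eq_add_neg]
      · intro n _ hn
        simp [hn]

/-- On a bounded set only few shifts of each scale are non-zero. -/
theorem abs_splineShift_le {m : ℕ} (hm : 1 ≤ m) {Ω : Set ℝ} {R : ℝ}
    (hΩ : ∀ x ∈ Ω, |x| ≤ R) (hΩm : MeasurableSet Ω) {ι : (ℕ × ℤ) ⊕ ℤ}
    (h : ¬ splineFun m ι =ᵐ[volume.restrict Ω] 0) :
    |(splineShift ι : ℝ)| ≤ 2 ^ splineScale ι * (R + 2 * m) := by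
  have hm' : (1 : ℝ) ≤ m := by exact_mod_cast hm
  by_contra hcon
  rw [not_le] at hcon
  refine h ?_
  rcases ι with ⟨s, k⟩ | k
  · simp only [splineShift, splineScale] at hcon
    have hs1 : (1 : ℝ) ≤ 2 ^ s := one_le_pow₀ one_le_two
    have hae := ae_affine_notMem_range_intCast (by positivity : (2 * 2 ^ s : ℝ) ≠ 0) (-2 * k)
    filter_upwards [ae_restrict_of_ae hae, ae_restrict_mem hΩm] with x hx hxΩ
    have hx2 : 2 * (2 ^ s * x - k) ∉ Set.range ((↑) : ℤ → ℝ) := by convert hx using 1; ring_nf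
    have hxR := abs_le.1 (hΩ x hxΩ)
    have e1 : (2 : ℝ) ^ s * x ≤ 2 ^ s * R := mul_le_mul_of_nonneg_left hxR.2 (by positivity)
    have e2 : (2 : ℝ) ^ s * (-R) ≤ 2 ^ s * x := mul_le_mul_of_nonneg_left hxR.1 (by positivity)
    have e3 : 2 * (m : ℝ) ≤ 2 ^ s * (2 * m) := le_mul_of_one_le_left (by positivity) hs1
    simp only [splineFun, Pi.zero_apply]
    rcases lt_abs.1 hcon with h1 | h1
    · rw [splineWavelet_eq_zero_of_neg hm (by linarith) hx2, mul_zero]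
    · rw [splineWavelet_eq_zero_of_gt hm (by linarith) hx2, mul_zero]
  · simp only [splineShift, splineScale, pow_zero, one_mul] at hcon
    filter_upwards [ae_restrict_mem hΩm] with x hxΩ
    have hxR := abs_le.1 (hΩ x hxΩ)
    simp only [splineFun, Pi.zero_apply]
    rcases lt_abs.1 hcon with h1 | h1
    · rw [cardinalBSpline_eq_zero_of_neg hm (by linarith)]
    · rw [cardinalBSpline_eq_zero_of_gt hm (by linarith)]

theorem not_ae_eq_of_Ioo_subset {f g : ℝ → ℝ} {Ω : Set ℝ} {c d : ℝ} (hcd : c < d)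
    (hΩ : Set.Ioo c d ⊆ Ω) (hf : ∀ x ∈ Set.Ioo c d, f x ≠ 0)
    (hg : ∀ᵐ x : ℝ, x ∈ Set.Ioo c d → g x = 0) : ¬ f =ᵐ[volume.restrict Ω] g := by
  intro h
  have h1 : ∀ᵐ x ∂volume.restrict (Set.Ioo c d), f x = g x :=
    h.filter_mono (ae_mono (Measure.restrict_mono hΩ le_rfl))
  rw [ae_restrict_iff' measurableSet_Ioo] at h1
  have h2 : ∀ᵐ x : ℝ, x ∉ Set.Ioo c d := by
    filter_upwards [h1, hg] with x hx hgx hmem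
    exact hf x hmem ((hx hmem).trans (hgx hmem))
  have h3 : volume (Set.Ioo c d) = 0 := by
    rw [ae_iff] at h2
    simpa only [not_not, Set.ofPred_mem_eq] using h2
  rw [Real.volume_Ioo, ENNReal.ofReal_eq_zero] at h3
  linarith

/-- The scale grows at most logarithmically with the index in a canonically ordered spline
wavelet system. -/
theorem exists_two_pow_splineScale_le {m : ℕ} (hm : 1 ≤ m) {Ω : Set ℝ}
    (hΩ : (interior Ω).Nonempty) {φ : ℕ → L2On Ω} {σ : ℕ → (ℕ × ℤ) ⊕ ℤ}
    (hmono : Monotone fun i => splineScale (σ i))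
    (hall : ∀ ι, ¬ (splineFun m ι =ᵐ[volume.restrict Ω] 0) →
      ∃ i, splineScale (σ i) ≤ splineScale ι ∧ φ i =ᵐ[volume.restrict Ω] splineFun m ι) :
    ∃ C : ℝ, 1 ≤ C ∧ ∀ i : ℕ, (2 : ℝ) ^ splineScale (σ i) ≤ C * (i + 1) := by
  obtain ⟨x0, hx0⟩ := hΩ
  obtain ⟨δ, hδ, hball⟩ := Metric.isOpen_iff.1 isOpen_interior x0 hx0
  have hsub : Set.Ioo (x0 - δ) (x0 + δ) ⊆ Ω := by
    rw [← Real.ball_eq_Ioo]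
    exact hball.trans interior_subset
  set a := x0 - δ with ha
  set b := x0 + δ with hb
  have hab : 0 < b - a := by rw [ha, hb]; linarith
  -- The summand 1 covers scale 0. For scale n+1 the count 2^n (b-a) - 2 ≤ i gives 2^(n+1) ≤
  -- 2(i+2)/(b-a) ≤ 4(i+1)/(b-a).
  refine ⟨1 + 4 / (b - a), le_add_of_nonneg_right (by positivity), fun i => ?_⟩
  have hi1 : (1 : ℝ) ≤ (i : ℝ) + 1 := by linarith [(i.cast_nonneg : (0 : ℝ) ≤ i)]
  rcases Nat.eq_zero_or_pos (splineScale (σ i)) with h0 | hpos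
  · rw [h0, pow_zero]
    nlinarith [(by positivity : 0 < 4 / (b - a))]
  obtain ⟨n, hn⟩ : ∃ n, splineScale (σ i) = n + 1 := ⟨splineScale (σ i) - 1, by omega⟩
  have h2n : (0 : ℝ) < 2 ^ n := by positivity
  -- The shifts for which [k, k+1]/2^n lies in [a, b]; there are more than 2^n (b-a) - 2 of them.
  set Kset : Finset ℤ := Finset.Icc ⌈2 ^ n * a⌉ (⌊2 ^ n * b⌋ - 1) with hK
  have hsubk : ∀ k ∈ Kset, Set.Ioo ((k : ℝ) / 2 ^ n) ((k + 1 / 2) / 2 ^ n) ⊆ Ω := by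
    intro k hk x hx
    obtain ⟨k1, k2⟩ := Finset.mem_Icc.1 hk
    have k1' : 2 ^ n * a ≤ k := Int.ceil_le.1 k1
    have k2' : (k : ℝ) + 1 ≤ 2 ^ n * b := by
      have := Int.le_floor.1 (show k + 1 ≤ ⌊2 ^ n * b⌋ by omega)
      push_cast at this
      exact this
    obtain ⟨x1, x2⟩ := hx
    rw [div_lt_iff₀ h2n] at x1
    rw [lt_div_iff₀ h2n] at x2
    refine hsub ⟨?_, ?_⟩
    · by_contra hc
      nlinarith [not_lt.1 hc]
    · by_contra hc
      nlinarith [not_lt.1 hc]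
  have hlt : ∀ k : ℤ, (k : ℝ) / 2 ^ n < (k + 1 / 2) / 2 ^ n := fun k => by
    gcongr
    linarith
  have hne : ∀ k : ℤ, ∀ x ∈ Set.Ioo ((k : ℝ) / 2 ^ n) ((k + 1 / 2) / 2 ^ n),
      splineFun m (Sum.inl (n, k)) x ≠ 0 := by
    intro k x ⟨x1, x2⟩
    rw [div_lt_iff₀ h2n] at x1
    rw [lt_div_iff₀ h2n] at x2
    exact mul_ne_zero (by positivity) (splineWavelet_ne_zero hm (by linarith) (by linarith))
  have hex : ∀ k ∈ Kset, ∃ j, splineScale (σ j) ≤ n ∧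
      φ j =ᵐ[volume.restrict Ω] splineFun m (Sum.inl (n, k)) := by
    intro k hk
    exact hall (Sum.inl (n, k)) (not_ae_eq_of_Ioo_subset (hlt k) (hsubk k hk) (hne k)
      (ae_of_all _ fun _ _ => rfl))
  choose! J hJ1 hJ2 using hex
  -- Repetitions may be omitted from the list, so the functions must be shown to differ on Ω. For k
  -- < k' the wavelet of shift k is non-zero on (k, k+1/2)/2^n, while that of shift k' vanishes
  -- almost everywhere there.
  have hdist : ∀ k ∈ Kset, ∀ k' ∈ Kset, k < k' → J k ≠ J k' := by
    intro k hk k' hk' hkk hJ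
    have e : splineFun m (Sum.inl (n, k)) =ᵐ[volume.restrict Ω]
        splineFun m (Sum.inl (n, k')) := by
      refine (hJ2 k hk).symm.trans ?_
      rw [hJ]
      exact hJ2 k' hk'
    refine not_ae_eq_of_Ioo_subset (hlt k) (hsubk k hk) (hne k) ?_ e
    filter_upwards [ae_affine_notMem_range_intCast
      (by positivity : (2 * 2 ^ n : ℝ) ≠ 0) (-2 * k')] with x hx hmem
    have x2 := hmem.2
    rw [lt_div_iff₀ h2n] at x2
    have hk1 : (k : ℝ) + 1 ≤ k' := by exact_mod_cast hkk
    simp only [splineFun]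
    rw [splineWavelet_eq_zero_of_neg hm (by linarith) (by convert hx using 1; ring_nf), mul_zero]
  have hcard : Kset.card ≤ i := by
    have := Finset.card_le_card_of_injOn (s := Kset) (t := Finset.range i) J ?_ ?_
    · simpa using this
    · intro k hk
      simp only [Finset.coe_range, Set.mem_Iio]
      by_contra hc
      -- Canonical order: an index not below i would have scale at least n+1, but the elements found
      -- have scale at most n.
      have h1 : splineScale (σ i) ≤ splineScale (σ (J k)) := hmono (not_lt.1 hc)
      have h2 := hJ1 k hk
      omega
    · intro k hk k' hk' hkk
      rcases lt_trichotomy k k' with h | h | h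
      · exact absurd hkk (hdist k hk k' hk' h)
      · exact h
      · exact absurd hkk.symm (hdist k' hk' k hk h)
  have hcard2 : 2 ^ n * (b - a) - 2 ≤ (i : ℝ) := by
    have h1 : (Kset.card : ℤ) ≥ ⌊(2 : ℝ) ^ n * b⌋ - 1 + 1 - ⌈(2 : ℝ) ^ n * a⌉ := by
      rw [hK, Int.card_Icc]
      exact Int.self_le_toNat _
    have h2 : (⌊(2 : ℝ) ^ n * b⌋ : ℝ) - ⌈(2 : ℝ) ^ n * a⌉ ≤ (Kset.card : ℝ) := by
      exact_mod_cast (by omega : ⌊(2 : ℝ) ^ n * b⌋ - ⌈(2 : ℝ) ^ n * a⌉ ≤ (Kset.card : ℤ))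
    have h3 : (Kset.card : ℝ) ≤ i := by exact_mod_cast hcard
    linarith [Int.lt_floor_add_one ((2 : ℝ) ^ n * b), Int.ceil_lt_add_one ((2 : ℝ) ^ n * a)]
  rw [hn, pow_succ]
  have h4 : (2 : ℝ) ^ n ≤ ((i : ℝ) + 2) / (b - a) := by
    rw [le_div_iff₀ hab]
    linarith
  calc (2 : ℝ) ^ n * 2 ≤ ((i : ℝ) + 2) / (b - a) * 2 := by linarith
    _ ≤ (2 * ((i : ℝ) + 1)) / (b - a) * 2 := by gcongr; linarith
    _ = 4 / (b - a) * (i + 1) := by ring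
    _ ≤ (1 + 4 / (b - a)) * (i + 1) := by nlinarith

/-! ### Encoding networks by words -/

namespace ReLUNetwork

/-- Apply a function to all weights. -/
def mapWeights (g : ℝ → ℝ) : {d d' : ℕ} → ReLUNetwork d d' → ReLUNetwork d d'
  | _, _, affine A b => affine (A.map g) (fun i => g (b i))
  | _, _, layer A b Ψ => layer (A.map g) (fun i => g (b i)) (mapWeights g Ψ)

/-! ### Stability of realizations under rounding of the weights -/

theorem abs_affineMap_le {d d' W : ℕ} {A : Matrix (Fin d') (Fin d) ℝ} {b : Fin d' → ℝ}
    {B X : ℝ} (hd : d ≤ W) (hB : 0 ≤ B) (hX : 1 ≤ X) (hA : ∀ i j, |A i j| ≤ B)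
    (hb : ∀ i, |b i| ≤ B) {x : Fin d → ℝ} (hx : ∀ j, |x j| ≤ X) (i : Fin d') :
    |affineMap A b x i| ≤ (B + 1) * (W + 1) * X := by
  have h1 : |∑ j, A i j * x j| ≤ W * (B * X) := by
    refine (Finset.abs_sum_le_sum_abs _ _).trans ?_
    refine (Finset.sum_le_card_nsmul _ _ (B * X) fun j _ => ?_).trans ?_
    · rw [abs_mul]
      exact mul_le_mul (hA i j) (hx j) (abs_nonneg _) hB
    · rw [Finset.card_univ, Fintype.card_fin, nsmul_eq_mul]
      refine mul_le_mul_of_nonneg_right (by exact_mod_cast hd) (by positivity)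
  have h2 : |affineMap A b x i| ≤ W * (B * X) + B := (abs_add_le _ _).trans (add_le_add h1 (hb i))
  have hW : (0 : ℝ) ≤ W := W.cast_nonneg
  have h3 : (0 : ℝ) ≤ W * X := by positivity
  nlinarith [mul_le_mul_of_nonneg_left hX hB]

/-- The error is measured as δ·E·X, relative to the bound X on the exact values. In this form a
layer multiplies X by (B+1)(W+1) and increases E by 1, so the estimate iterates without further
bookkeeping. -/
theorem abs_affineMap_sub_le {d d' W : ℕ} {A : Matrix (Fin d') (Fin d) ℝ} {b : Fin d' → ℝ}
    {B X δ E : ℝ} (hd : d ≤ W) (hB : 0 ≤ B) (hX : 1 ≤ X) (hδ : 0 ≤ δ) (hδ1 : δ ≤ 1) (hE : 0 ≤ E)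
    {g : ℝ → ℝ} (hg : ∀ v, |g v - v| ≤ δ)
    (hA : ∀ i j, |A i j| ≤ B) {x x' : Fin d → ℝ}
    (hx : ∀ j, |x j| ≤ X) (hx' : ∀ j, |x' j - x j| ≤ δ * E * X) (i : Fin d') :
    |affineMap (A.map g) (fun i => g (b i)) x' i - affineMap A b x i| ≤
      δ * (E + 1) * ((B + 1) * (W + 1) * X) := by
  have e : affineMap (A.map g) (fun i => g (b i)) x' i - affineMap A b x i =
      (∑ j, (g (A i j) * (x' j - x j) + (g (A i j) - A i j) * x j)) + (g (b i) - b i) := by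
    simp only [affineMap, Pi.add_apply, Matrix.mulVec, dotProduct, Matrix.map_apply]
    rw [add_sub_add_comm, ← Finset.sum_sub_distrib]
    congr 1
    exact Finset.sum_congr rfl fun j _ => by ring
  have hW : (0 : ℝ) ≤ W := W.cast_nonneg
  have h1 : |∑ j, (g (A i j) * (x' j - x j) + (g (A i j) - A i j) * x j)| ≤
      W * ((B + 1) * (δ * E * X) + δ * X) := by
    refine (Finset.abs_sum_le_sum_abs _ _).trans ?_
    refine (Finset.sum_le_card_nsmul _ _ ((B + 1) * (δ * E * X) + δ * X) fun j _ => ?_).trans ?_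
    · refine (abs_add_le _ _).trans ?_
      rw [abs_mul, abs_mul]
      have hgA : |g (A i j)| ≤ B + 1 := by
        have h2 := abs_add_le (g (A i j) - A i j) (A i j)
        rw [sub_add_cancel] at h2
        linarith [hg (A i j), hA i j]
      exact add_le_add (mul_le_mul hgA (hx' j) (abs_nonneg _) (by positivity))
        (mul_le_mul (hg _) (hx j) (abs_nonneg _) hδ)
    · rw [Finset.card_univ, Fintype.card_fin, nsmul_eq_mul]
      refine mul_le_mul_of_nonneg_right (by exact_mod_cast hd) (by positivity)
  rw [e]
  refine (abs_add_le _ _).trans ((add_le_add h1 (hg (b i))).trans ?_)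
  have k1 : 0 ≤ δ * E * X := by positivity
  have k2 : 0 ≤ δ * X := by positivity
  have k3 : δ ≤ δ * X := le_mul_of_one_le_right hδ hX
  have k4 : 0 ≤ W * B * (δ * X) := by positivity
  have k5 : 0 ≤ (B + 1) * (δ * E * X) := by positivity
  have k6 : 0 ≤ B * (δ * X) := by positivity
  nlinarith

/-- The rectifier is 1-Lipschitz and fixes 0, so it preserves both the size bound and the error
bound of a layer; the one-layer estimate is then iterated. -/
theorem abs_realize_mapWeights_sub_le {W : ℕ} {B δ : ℝ} (hB : 0 ≤ B) (hδ : 0 ≤ δ) (hδ1 : δ ≤ 1)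
    {g : ℝ → ℝ} (hg : ∀ v, |g v - v| ≤ δ) : ∀ {d d' : ℕ} (Φ : ReLUNetwork d d'),
    Φ.Nondegenerate → Φ.connectivity ≤ W → (Φ.weightMagnitude : ℝ) ≤ B →
    ∀ {X E : ℝ}, 1 ≤ X → 0 ≤ E → ∀ {x x' : Fin d → ℝ}, (∀ j, |x j| ≤ X) →
    (∀ j, |x' j - x j| ≤ δ * E * X) → ∀ i, |(mapWeights g Φ).realize x' i - Φ.realize x i| ≤
      δ * (E + Φ.depth) * (((B + 1) * (W + 1)) ^ Φ.depth * X)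
  | d, _, affine A b, hnd, hW, hw, X, E, hX, hE, x, x', hx, hx', i => by
    obtain ⟨hA, hb⟩ := maxWeight_le_iff.1 (le_refl (maxWeight A b))
    have hA' : ∀ i j, |A i j| ≤ B := fun i j => (NNReal.coe_le_coe.2 (hA i j)).trans hw
    have := abs_affineMap_sub_le (b := b) (hnd.input_le_connectivity.trans hW) hB hX hδ hδ1 hE hg
      hA' hx hx' i
    simpa [mapWeights, realize, depth] using this
  | d, _, layer (k := k) A b Ψ, hnd, hW, hw, X, E, hX, hE, x, x', hx, hx', i => by
    obtain ⟨hA, hb⟩ := maxWeight_le_iff.1 (le_refl (maxWeight A b))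
    have hw1 : (maxWeight A b : ℝ) ≤ B := (NNReal.coe_le_coe.2 le_sup_left).trans hw
    have hw2 : (Ψ.weightMagnitude : ℝ) ≤ B := (NNReal.coe_le_coe.2 le_sup_right).trans hw
    have hA' : ∀ i j, |A i j| ≤ B := fun i j => (NNReal.coe_le_coe.2 (hA i j)).trans hw1
    have hb' : ∀ i, |b i| ≤ B := fun i => (NNReal.coe_le_coe.2 (hb i)).trans hw1
    have hdW : d ≤ W := hnd.input_le_connectivity.trans hW
    have h1 := abs_affineMap_sub_le (b := b) hdW hB hX hδ hδ1 hE hg hA' hx hx'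
    have h2 := abs_affineMap_le hdW hB hX hA' hb' hx
    have hG : 1 ≤ (B + 1) * ((W : ℝ) + 1) := by
      nlinarith [(W.cast_nonneg : (0 : ℝ) ≤ W)]
    have hWΨ : Ψ.connectivity ≤ W := le_trans (Nat.le_add_left _ _) hW
    have h3 := abs_realize_mapWeights_sub_le hB hδ hδ1 hg Ψ hnd.2 hWΨ hw2
      (X := (B + 1) * (W + 1) * X) (E := E + 1) (one_le_mul_of_one_le_of_one_le hG hX)
      (by linarith) (x := fun i => max (affineMap A b x i) 0)
      (x' := fun i => max (affineMap (A.map g) (fun i => g (b i)) x' i) 0)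
      (fun j => ?_) (fun j => ?_) i
    · simp only [mapWeights, realize, depth]
      refine h3.trans (le_of_eq ?_)
      push_cast
      rw [pow_add, pow_one]
      ring
    · have := abs_max_sub_max_le_abs (affineMap A b x j) 0 0
      simp only [max_self, sub_zero] at this
      exact this.trans (h2 j)
    · exact (abs_max_sub_max_le_abs _ _ _).trans (h1 j)

/-- Evaluation of a word on registers `x` (read) and `y` (written): the letter `some (i, j, v)`
adds `v * x j` to `y i`, the letter `none` moves the rectified content of `y` to `x`, with a
constant `1` in register `0`. -/
def runWord : List (Option (ℕ × ℕ × ℝ)) → (ℕ → ℝ) → (ℕ → ℝ) → ℝ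
  | [], _, y => y 1
  | some t :: w, x, y => runWord w x fun n => y n + if t.1 = n then t.2.2 * x t.2.1 else 0
  | none :: w, _, y => runWord w (fun n => if n = 0 then 1 else max (y n) 0) 0

theorem runWord_map_append (l : List (ℕ × ℕ × ℝ)) (w : List (Option (ℕ × ℕ × ℝ)))
    (x : ℕ → ℝ) : ∀ y, runWord (l.map some ++ w) x y =
      runWord w x fun n => y n + (l.map fun t => if t.1 = n then t.2.2 * x t.2.1 else 0).sum := by
  induction l with
  | nil => intro y; simp
  | cons t l ih =>
    intro y
    simp only [List.map_cons, List.cons_append, runWord, ih, List.sum_cons, add_assoc]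

/-- The vector `x` in the registers `1, 2, …`, the number `c` in register `0`. -/
def register {d : ℕ} (c : ℝ) (x : Fin d → ℝ) : ℕ → ℝ
  | 0 => c
  | n + 1 => if h : n < d then x ⟨n, h⟩ else 0

theorem register_succ {d : ℕ} (c : ℝ) (x : Fin d → ℝ) (j : Fin d) :
    register c x (j + 1) = x j := by
  simp [register]

/-- The letters for one affine map, with the function `g` applied to the non-zero weights. -/
def affineWord (g : ℝ → ℝ) {d d' : ℕ} (A : Matrix (Fin d') (Fin d) ℝ) (b : Fin d' → ℝ) :
    List (ℕ × ℕ × ℝ) :=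
  ((Finset.univ.filter fun p : Fin d' × Fin d => A p.1 p.2 ≠ 0).toList.map
    fun p : Fin d' × Fin d => ((p.1 : ℕ) + 1, (p.2 : ℕ) + 1, g (A p.1 p.2))) ++
  ((Finset.univ.filter fun i : Fin d' => b i ≠ 0).toList.map
    fun i : Fin d' => ((i : ℕ) + 1, 0, g (b i)))

theorem length_affineWord (g : ℝ → ℝ) {d d' : ℕ} (A : Matrix (Fin d') (Fin d) ℝ)
    (b : Fin d' → ℝ) : (affineWord g A b).length = nonzeroWeights A b := by
  simp [affineWord, nonzeroWeights]

/-- Rows and columns are numbered from 1, so register 0 is free to hold the constant 1 that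
multiplies biases. The condition g 0 = 0 makes the zero weights, absent from the word, contribute
nothing after rounding as well. -/
theorem sum_affineWord {g : ℝ → ℝ} (hg : g 0 = 0) {d d' : ℕ} (A : Matrix (Fin d') (Fin d) ℝ)
    (b : Fin d' → ℝ) (x : Fin d → ℝ) (n : ℕ) :
    ((affineWord g A b).map
      fun t => if t.1 = n then t.2.2 * register 1 x t.2.1 else 0).sum =
      register 0 (affineMap (A.map g) (fun i => g (b i)) x) n := by
  have h1 : ∀ f : Fin d' × Fin d → ℝ, (∀ p, A p.1 p.2 = 0 → f p = 0) →
      ((Finset.univ.filter fun p : Fin d' × Fin d => A p.1 p.2 ≠ 0).toList.map f).sum =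
        ∑ i, ∑ j, f (i, j) := by
    intro f hf
    rw [Finset.sum_map_toList, Finset.sum_filter, ← Fintype.sum_prod_type]
    refine Finset.sum_congr rfl fun p _ => ?_
    split_ifs with h
    · rfl
    · exact (hf p (not_not.1 h)).symm
  have h2 : ∀ f : Fin d' → ℝ, (∀ i, b i = 0 → f i = 0) →
      ((Finset.univ.filter fun i : Fin d' => b i ≠ 0).toList.map f).sum = ∑ i, f i := by
    intro f hf
    rw [Finset.sum_map_toList, Finset.sum_filter]
    refine Finset.sum_congr rfl fun p _ => ?_
    split_ifs with h
    · rfl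
    · exact (hf p (not_not.1 h)).symm
  rw [affineWord, List.map_append, List.sum_append, List.map_map, List.map_map, h1, h2]
  · simp only [Function.comp_apply, register_succ]
    rw [show register 1 x 0 = 1 from rfl]
    cases n with
    | zero => simp [register]
    | succ n =>
      simp only [Nat.add_right_cancel_iff, register, mul_one]
      by_cases hn : n < d'
      · have e : ∑ i : Fin d', (if (i : ℕ) = n then g (b i) else 0) = g (b ⟨n, hn⟩) := by
          rw [Finset.sum_eq_single ⟨n, hn⟩, if_pos rfl]
          · exact fun i _ hi => if_neg fun h => hi (Fin.ext h)
          · simp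
        rw [dif_pos hn, e, Finset.sum_eq_single ⟨n, hn⟩]
        · simp [affineMap, Matrix.mulVec, dotProduct]
        · exact fun i _ hi => Finset.sum_eq_zero fun j _ => if_neg fun h => hi (Fin.ext h)
        · simp
      · have hne : ∀ i : Fin d', (i : ℕ) ≠ n := fun i h => hn (h ▸ i.2)
        simp [hne, hn]
  · intro i hi
    simp [hi, hg]
  · intro p hp
    simp [hp, hg]

theorem mem_affineWord {g : ℝ → ℝ} {d d' W : ℕ} {A : Matrix (Fin d') (Fin d) ℝ}
    {b : Fin d' → ℝ} (hd : d ≤ W) (hd' : d' ≤ W) {t : ℕ × ℕ × ℝ} (ht : t ∈ affineWord g A b) :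
    t.1 ≤ W ∧ t.2.1 ≤ W ∧ ∃ u, |u| ≤ (maxWeight A b : ℝ) ∧ t.2.2 = g u := by
  obtain ⟨hA, hb⟩ := maxWeight_le_iff.1 (le_refl (maxWeight A b))
  rw [affineWord, List.mem_append, List.mem_map, List.mem_map] at ht
  rcases ht with ⟨p, -, rfl⟩ | ⟨i, -, rfl⟩
  · exact ⟨p.1.2.trans_le hd', p.2.2.trans_le hd, _, hA p.1 p.2, rfl⟩
  · exact ⟨i.2.trans_le hd', Nat.zero_le _, _, hb i, rfl⟩

/-- Every network is evaluated by a short word. -/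
theorem exists_word {g : ℝ → ℝ} (hg : g 0 = 0) {W : ℕ} {B : ℝ} : ∀ {d : ℕ}
    (Φ : ReLUNetwork d 1), Φ.Nondegenerate → 1 ≤ W → Φ.connectivity ≤ W →
    (Φ.weightMagnitude : ℝ) ≤ B →
    ∃ w : List (Option (ℕ × ℕ × ℝ)), w.length ≤ Φ.connectivity + Φ.depth ∧
      (∀ t, some t ∈ w → t.1 ≤ W ∧ t.2.1 ≤ W ∧ ∃ u, |u| ≤ B ∧ t.2.2 = g u) ∧
      ∀ x : Fin d → ℝ, runWord w (register 1 x) 0 = (mapWeights g Φ).realize x 0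
  | d, affine A b, hnd, hW1, hW, hw => by
    refine ⟨(affineWord g A b).map some ++ [], ?_, ?_, fun x => ?_⟩
    · simp [length_affineWord, connectivity, depth]
    · intro t ht
      simp only [List.append_nil, List.mem_map, Option.some.injEq, exists_eq_right] at ht
      obtain ⟨h1, h2, u, h3, h4⟩ := mem_affineWord (hnd.input_le_connectivity.trans hW) hW1 ht
      exact ⟨h1, h2, u, h3.trans hw, h4⟩
    · rw [runWord_map_append]
      simp only [runWord, sum_affineWord hg, Pi.zero_apply, zero_add]
      rfl
  | d, layer (k := k) A b Ψ, hnd, hW1, hW, hw => by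
    have hw1 : (maxWeight A b : ℝ) ≤ B := (NNReal.coe_le_coe.2 le_sup_left).trans hw
    have hw2 : (Ψ.weightMagnitude : ℝ) ≤ B := (NNReal.coe_le_coe.2 le_sup_right).trans hw
    have hWΨ : Ψ.connectivity ≤ W := le_trans (Nat.le_add_left _ _) hW
    obtain ⟨w, k1, k2, k3⟩ := exists_word hg Ψ hnd.2 hW1 hWΨ hw2
    refine ⟨(affineWord g A b).map some ++ none :: w, ?_, ?_, fun x => ?_⟩
    · simp only [List.length_append, List.length_map, length_affineWord, List.length_cons,
        connectivity, depth]
      omega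
    · intro t ht
      simp only [List.mem_append, List.mem_map, Option.some.injEq, exists_eq_right,
        List.mem_cons, reduceCtorEq, false_or] at ht
      rcases ht with ht | ht
      · obtain ⟨h1, h2, u, h3, h4⟩ := mem_affineWord (hnd.input_le_connectivity.trans hW)
          (hnd.2.input_le_connectivity.trans hWΨ) ht
        exact ⟨h1, h2, u, h3.trans hw1, h4⟩
      · exact k2 t ht
    · rw [runWord_map_append]
      simp only [runWord, sum_affineWord hg, Pi.zero_apply, zero_add]
      rw [mapWeights, realize, ← k3]
      congr 1
      funext n
      cases n with
      | zero => rfl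
      | succ n =>
        simp only [register]
        rw [if_neg (Nat.succ_ne_zero n)]
        split_ifs <;> simp

end ReLUNetwork

/-- Encode by the value of F and decode to any member of C with that value. No reconstruction from
the value itself is needed, only small diameter of the fibres. -/
theorem hasCode_of_finset {Ω : Set ℝ} {C : Set (L2On Ω)} {ε : ℝ} {ℓ : ℕ} {α : Type*}
    (F : C → α) (t : Finset α) (hF : ∀ f, F f ∈ t) (ht : t.card ≤ 2 ^ ℓ)
    (h : ∀ f g : C, F f = F g → ‖(f : L2On Ω) - g‖ ≤ ε) : HasCode C ε ℓ := by
  classical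
  obtain ⟨e⟩ : Nonempty (t ↪ (Fin ℓ → Bool)) :=
    Function.Embedding.nonempty_of_card_le (by simpa using ht)
  refine ⟨fun f => e ⟨F f, hF f⟩,
    fun b => if h : ∃ f : C, e ⟨F f, hF f⟩ = b then (h.choose : L2On Ω) else 0, fun f => ?_⟩
  have hex : ∃ f' : C, e ⟨F f', hF f'⟩ = e ⟨F f, hF f⟩ := ⟨f, rfl⟩
  beta_reduce
  rw [dif_pos hex]
  refine h _ _ ?_
  simpa using hex.choose_spec

theorem hasCode_mono {Ω : Set ℝ} {C : Set (L2On Ω)} {ε ε' : ℝ} {ℓ : ℕ} (h : ε ≤ ε')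
    (hc : HasCode C ε ℓ) : HasCode C ε' ℓ := by
  obtain ⟨E, D, hED⟩ := hc
  exact ⟨E, D, fun f => (hED f).trans h⟩

open ReLUNetwork in
/-- A class that is approximated by networks with few weights has a short code. -/
theorem hasCode_of_networks {Ω : Set ℝ} {C : Set (L2On Ω)} {R V η δ B : ℝ} {M T Z ℓ : ℕ}
    (hΩ : ∀ x ∈ Ω, |x| ≤ R) (hΩm : MeasurableSet Ω) (hR : 1 ≤ R)
    (hV : volume Ω ^ (1 / 2 : ℝ) ≤ ENNReal.ofReal V) (hV0 : 0 ≤ V) (hη : 0 ≤ η)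
    (hδ : 0 < δ) (hδ1 : δ ≤ 1) (hB : 0 ≤ B) (hM : 1 ≤ M) (hZ : B / δ + 1 ≤ Z)
    (h : ∀ f ∈ C, ∃ Φ : ReLUNetwork 1 1, Φ.Nondegenerate ∧ Φ.connectivity ≤ M ∧ Φ.depth ≤ T ∧
      (Φ.weightMagnitude : ℝ) ≤ B ∧
      eLpNorm (fun x => f x - Φ.toRealFun x) 2 (volume.restrict Ω) ≤ ENNReal.ofReal η)
    (hℓ : (2 + (M + 1) ^ 2 * (2 * Z + 1)) ^ (M + T) ≤ 2 ^ ℓ) :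
    HasCode C (2 * (η + V * (δ * T * (((B + 1) * (M + 1)) ^ T * R)))) ℓ := by
  classical
  -- Rounding down to the grid δℤ.
  set g : ℝ → ℝ := fun v => δ * ⌊v / δ⌋ with hg
  have hg0 : g 0 = 0 := by simp [hg]
  have hgδ : ∀ v, |g v - v| ≤ δ := by
    intro v
    have h1 := Int.floor_le (v / δ)
    have h2 := Int.lt_floor_add_one (v / δ)
    rw [le_div_iff₀ hδ] at h1
    rw [div_lt_iff₀ hδ] at h2
    rw [abs_le]
    constructor <;> simp only [hg] <;> linarith
  have : Nonempty (ReLUNetwork 1 1) := ⟨affine 0 0⟩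
  choose! N hnd hconn hdepth hw herr using h
  have hword : ∀ f : C, ∃ w : List (Option (ℕ × ℕ × ℝ)), w.length ≤ M + T ∧
      (∀ t, some t ∈ w → t.1 ≤ M ∧ t.2.1 ≤ M ∧ ∃ u, |u| ≤ B ∧ t.2.2 = g u) ∧
      ∀ x : Fin 1 → ℝ, runWord w (register 1 x) 0 = (mapWeights g (N f)).realize x 0 := by
    intro f
    obtain ⟨w, h1, h2, h3⟩ := exists_word hg0 (N f) (hnd f f.2) hM (hconn f f.2) (hw f f.2)
    exact ⟨w, h1.trans (add_le_add (hconn f f.2) (hdepth f f.2)), h2, h3⟩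
  choose w hwl hwm hwr using hword
  set S : Finset (ℕ × ℕ × ℝ) := Finset.range (M + 1) ×ˢ Finset.range (M + 1) ×ˢ
    (Finset.Icc (-(Z : ℤ)) Z).image (fun z : ℤ => δ * z) with hS
  have hScard : S.card ≤ (M + 1) ^ 2 * (2 * Z + 1) := by
    rw [hS, Finset.card_product, Finset.card_product, Finset.card_range, ← mul_assoc, ← sq]
    refine Nat.mul_le_mul_left _ (Finset.card_image_le.trans ?_)
    rw [Int.card_Icc]
    omega
  -- Words of different lengths are padded to length M + T: `none` marks a position past the end,
  -- `some none` the letter that closes a layer.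
  set S' : Finset (Option (Option (ℕ × ℕ × ℝ))) :=
    insert none (insert (some none) (S.image fun t => some (some t))) with hS'
  have hS'card : S'.card ≤ 2 + (M + 1) ^ 2 * (2 * Z + 1) := by
    rw [hS']
    refine (Finset.card_insert_le _ _).trans ?_
    refine (Nat.add_le_add_right (Finset.card_insert_le _ _) 1).trans ?_
    have h3 := Finset.card_image_le (s := S) (f := fun t => some (some t))
    omega
  refine hasCode_of_finset (fun f => fun k : Fin (M + T) => (w f)[(k : ℕ)]?)
    (Fintype.piFinset fun _ => S') (fun f => ?_) ?_ (fun f f' hff => ?_)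
  · rw [Fintype.mem_piFinset]
    intro k
    rcases hk : (w f)[(k : ℕ)]? with _ | (_ | t)
    · simp [hS']
    · simp [hS']
    · have hmem : some t ∈ w f := List.mem_of_getElem? hk
      obtain ⟨h1, h2, u, h3, h4⟩ := hwm f t hmem
      simp only [hS', Finset.mem_insert, reduceCtorEq, Option.some.injEq, Finset.mem_image,
        exists_eq_right, false_or]
      rw [hS, Finset.mem_product, Finset.mem_product, Finset.mem_image]
      refine ⟨Finset.mem_range.2 (by omega), Finset.mem_range.2 (by omega), ⌊u / δ⌋, ?_, h4.symm⟩
      obtain ⟨u1, u2⟩ := abs_le.1 h3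
      have hu1 : -(B / δ) ≤ u / δ := by
        rw [← neg_div]
        gcongr
      have hu2 : u / δ ≤ B / δ := by gcongr
      have f1 := Int.floor_le (u / δ)
      have f2 := Int.lt_floor_add_one (u / δ)
      rw [Finset.mem_Icc]
      constructor
      · have : -(Z : ℝ) ≤ (⌊u / δ⌋ : ℝ) := by linarith
        exact_mod_cast this
      · have : (⌊u / δ⌋ : ℝ) ≤ (Z : ℝ) := by linarith
        exact_mod_cast this
  · rw [Fintype.card_piFinset_const]
    exact (Nat.pow_le_pow_left hS'card _).trans hℓ
  · have hww : w f = w f' := by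
      refine List.ext_getElem? fun k => ?_
      by_cases hk : k < M + T
      · exact congrFun hff ⟨k, hk⟩
      · rw [List.getElem?_eq_none (by have := hwl f; omega),
          List.getElem?_eq_none (by have := hwl f'; omega)]
    -- Equal words give equal rounded realizations. The distance between two functions with the same
    -- word is thus at most twice the approximation error plus twice the rounding error.
    have hq : ∀ x : ℝ, (mapWeights g (N f)).toRealFun x = (mapWeights g (N f')).toRealFun x := by
      intro x
      simp only [toRealFun]
      rw [← hwr f, ← hwr f', hww]
    have hG : 1 ≤ (B + 1) * ((M : ℝ) + 1) := by
      nlinarith [(M.cast_nonneg : (0 : ℝ) ≤ M)]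
    set D : ℝ := δ * T * (((B + 1) * (M + 1)) ^ T * R) with hD
    have hD0 : 0 ≤ D := by positivity
    have hquant : ∀ f : C, ∀ x ∈ Ω,
        |(mapWeights g (N f)).toRealFun x - (N f).toRealFun x| ≤ D := by
      intro f x hx
      refine (abs_realize_mapWeights_sub_le hB hδ.le hδ1 hgδ (N f) (hnd f f.2) (hconn f f.2)
        (hw f f.2) (X := R) (E := 0) hR le_rfl (fun _ => hΩ x hx) (by simp) 0).trans ?_
      rw [zero_add, hD]
      have := hdepth f f.2
      gcongr
    have hcont : ∀ Φ : ReLUNetwork 1 1, Continuous Φ.toRealFun := fun Φ =>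
      (continuous_apply 0).comp ((continuous_realize Φ).comp (by fun_prop))
    have hdiff : ∀ x ∈ Ω, ‖(N f).toRealFun x - (N f').toRealFun x‖ ≤ 2 * D := by
      intro x hx
      have h1 := abs_le.1 (hquant f x hx)
      have h2 := abs_le.1 (hquant f' x hx)
      rw [hq x] at h1
      rw [Real.norm_eq_abs, abs_le]
      constructor <;> linarith
    have hnorm : eLpNorm (fun x => (N f).toRealFun x - (N f').toRealFun x) 2
        (volume.restrict Ω) ≤ ENNReal.ofReal (2 * (V * D)) := by
      refine (eLpNorm_le_of_ae_bound (C := 2 * D)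
        ((ae_restrict_mem hΩm).mono fun x hx => hdiff x hx)).trans ?_
      rw [Measure.restrict_apply_univ, show 2 * (V * D) = V * (2 * D) by ring,
        ENNReal.ofReal_mul hV0]
      refine mul_le_mul' ?_ le_rfl
      simpa using hV
    have htri : eLpNorm (fun x => (f : L2On Ω) x - (f' : L2On Ω) x) 2 (volume.restrict Ω) ≤
        ENNReal.ofReal (2 * (η + V * D)) := by
      have m1 : AEStronglyMeasurable (fun x => (f : L2On Ω) x - (N f).toRealFun x)
          (volume.restrict Ω) :=
        (Lp.aestronglyMeasurable _).sub (hcont _).aestronglyMeasurable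
      have m2 : AEStronglyMeasurable (fun x => (N f).toRealFun x - (N f').toRealFun x)
          (volume.restrict Ω) :=
        ((hcont _).sub (hcont _)).aestronglyMeasurable
      have m3 : AEStronglyMeasurable (fun x => (f' : L2On Ω) x - (N f').toRealFun x)
          (volume.restrict Ω) :=
        (Lp.aestronglyMeasurable _).sub (hcont _).aestronglyMeasurable
      have e : (fun x => (f : L2On Ω) x - (f' : L2On Ω) x) =
          ((fun x => (f : L2On Ω) x - (N f).toRealFun x) +
            fun x => (N f).toRealFun x - (N f').toRealFun x) -
            fun x => (f' : L2On Ω) x - (N f').toRealFun x := by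
        funext x
        simp only [Pi.add_apply, Pi.sub_apply]
        ring
      rw [e]
      refine (eLpNorm_sub_le (m1.add m2) m3 one_le_two).trans ?_
      refine (add_le_add (eLpNorm_add_le m1 m2 one_le_two) le_rfl).trans ?_
      refine (add_le_add (add_le_add (herr f f.2) hnorm) (herr f' f'.2)).trans ?_
      rw [← ENNReal.ofReal_add hη (by positivity), ← ENNReal.ofReal_add (by positivity) hη]
      exact ENNReal.ofReal_le_ofReal (by linarith)
    rw [Lp.norm_def]
    refine ENNReal.toReal_le_of_le_ofReal (by positivity) ?_
    rwa [eLpNorm_congr_ae (Lp.coeFn_sub _ _)]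

/-! ### Effective network rates do not exceed the optimal exponent -/

theorem exists_eval_le_pow (p : ℝ[X]) :
    ∃ (k : ℕ) (x₀ : ℝ), 1 ≤ x₀ ∧ ∀ x, x₀ ≤ x → p.eval x ≤ x ^ k := by
  refine ⟨p.natDegree + 1, max 1 (∑ i ∈ Finset.range (p.natDegree + 1), |p.coeff i|),
    le_max_left _ _, fun x hx => ?_⟩
  have h1 : 1 ≤ x := (le_max_left _ _).trans hx
  have h2 := (le_max_right _ _).trans hx
  have h0 : 0 ≤ x := by linarith
  rw [Polynomial.eval_eq_sum_range]
  calc ∑ i ∈ Finset.range (p.natDegree + 1), p.coeff i * x ^ i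
      ≤ ∑ i ∈ Finset.range (p.natDegree + 1), |p.coeff i| * x ^ p.natDegree := by
        refine Finset.sum_le_sum fun i hi => ?_
        refine mul_le_mul (le_abs_self _) (pow_le_pow_right₀ h1 ?_) (by positivity) (abs_nonneg _)
        exact Nat.lt_succ_iff.1 (Finset.mem_range.1 hi)
    _ ≤ x * x ^ p.natDegree := by
        rw [← Finset.sum_mul]
        exact mul_le_mul_of_nonneg_right h2 (by positivity)
    _ = x ^ (p.natDegree + 1) := by rw [pow_succ']

theorem eventually_mul_logb_pow_le (c : ℝ) (k : ℕ) {s : ℝ} (hs : 0 < s) :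
    ∀ᶠ M : ℕ in atTop, c * Real.logb 2 M ^ k ≤ (M : ℝ) ^ s := by
  have h := ((isLittleO_log_rpow_rpow_atTop k hs).const_mul_left
    (c / Real.log 2 ^ k)).comp_tendsto tendsto_natCast_atTop_atTop
  filter_upwards [h.bound one_pos] with M hM
  simp only [Function.comp_apply, Real.rpow_natCast, one_mul] at hM
  have e : c * Real.logb 2 M ^ k = c / Real.log 2 ^ k * Real.log M ^ k := by
    rw [Real.logb, div_pow]
    ring
  rw [e]
  refine (le_abs_self _).trans (hM.trans (le_of_eq ?_))
  rw [Real.norm_eq_abs, abs_of_nonneg (by positivity)]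

theorem logb_natCast_le (M : ℕ) : Real.logb 2 M ≤ M := by
  rcases Nat.eq_zero_or_pos M with rfl | hM
  · simp
  · rw [Real.logb_le_iff_le_rpow one_lt_two (by positivity), Real.rpow_natCast]
    exact_mod_cast Nat.lt_two_pow_self.le

theorem tendsto_logb_natCast : Tendsto (fun M : ℕ => Real.logb 2 M) atTop atTop :=
  (Real.tendsto_logb_atTop one_lt_two).comp tendsto_natCast_atTop_atTop

/-- The amplification factor of a network is exponential in its depth, but the depth is
polylogarithmic. The mesh needed thus costs polylogarithmically many bits per weight, which M^s
absorbs. -/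
theorem eventually_hasCode {Ω : Set ℝ} (hΩm : MeasurableSet Ω) (hΩb : Bornology.IsBounded Ω)
    {C : Set (L2On Ω)} {γ : ℝ≥0} {p : ℝ[X]} (hdec : DecaysWithRate (networkError C p) γ)
    {s : ℝ} (hs : 0 < s) :
    ∃ c : ℝ, 0 < c ∧ ∀ᶠ M : ℕ in atTop, ∃ ℓ : ℕ, 1 ≤ ℓ ∧ (ℓ : ℝ) ≤ (M : ℝ) ^ (1 + s) ∧
      HasCode C (c * (M : ℝ) ^ (-(γ : ℝ))) ℓ := by
  obtain ⟨R₀, hR₀⟩ := hΩb.exists_norm_le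
  set R := max R₀ 1 with hR
  have hΩR : ∀ x ∈ Ω, |x| ≤ R := fun x hx => (hR₀ x hx).trans (le_max_left _ _)
  have hfin : volume Ω ^ (1 / 2 : ℝ) ≠ ∞ :=
    ENNReal.rpow_ne_top_of_nonneg (by norm_num) hΩb.measure_lt_top.ne
  set V : ℝ := (volume Ω ^ (1 / 2 : ℝ)).toReal with hV
  have hV0 : 0 ≤ V := ENNReal.toReal_nonneg
  obtain ⟨K, hK⟩ := hdec
  obtain ⟨k, x₀, hx₀, hp⟩ := exists_eval_le_pow p
  set g : ℕ := ⌈(γ : ℝ)⌉₊ with hg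
  refine ⟨2 * (K + 1 + 1), by positivity, ?_⟩
  filter_upwards [hK, eventually_mul_logb_pow_le (4 * (3 * k + g + 12)) (2 * k + 1) hs,
    tendsto_logb_natCast.eventually_ge_atTop x₀,
    tendsto_natCast_atTop_atTop.eventually_ge_atTop (max x₀ (V * R)), eventually_ge_atTop 2]
    with M hM hlog hL hMx hM2
  set L := Real.logb 2 (M : ℝ) with hLdef
  have hL1 : 1 ≤ L := hx₀.trans hL
  have hM2' : (2 : ℝ) ≤ M := by exact_mod_cast hM2
  have hM1 : (1 : ℝ) ≤ M := by linarith
  have hM0 : (0 : ℝ) < M := by linarith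
  set T : ℕ := ⌊L ^ k⌋₊ with hT
  have hLk : 1 ≤ L ^ k := one_le_pow₀ hL1
  have hTL : (T : ℝ) ≤ L ^ k := Nat.floor_le (by positivity)
  have hTM : (T : ℝ) ≤ (M : ℝ) ^ k :=
    hTL.trans (pow_le_pow_left₀ (by linarith) (logb_natCast_le M) k)
  -- In the rounding error, M^((k+3)T) bounds the amplification, M^k the factor T, M the constant
  -- VR; the remaining M^(-g) is at most M^(-γ).
  set e : ℕ := (k + 3) * T + k + 1 + g with he
  have hMe : (1 : ℝ) ≤ (M : ℝ) ^ e := one_le_pow₀ hM1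
  have hcode := hasCode_of_networks (C := C) (R := R) (V := V) (η := (K + 1) * (M : ℝ) ^ (-(γ : ℝ)))
    (δ := ((M : ℝ) ^ e)⁻¹) (B := (M : ℝ) ^ k) (M := M) (T := T) (Z := M ^ (k + e) + 1)
    (ℓ := (k + e + 8) * ⌈L⌉₊ * (M + T)) hΩR hΩm (le_max_right _ _)
    (by rw [hV, ENNReal.ofReal_toReal hfin]) hV0 (by positivity) (by positivity)
    (inv_le_one_of_one_le₀ hMe) (by positivity) (by omega)
    (by rw [div_inv_eq_mul, ← pow_add]; push_cast; exact le_rfl) ?_ ?_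
  · refine ⟨(k + e + 8) * ⌈L⌉₊ * (M + T), ?_, ?_, hasCode_mono ?_ hcode⟩
    · have h1 : 1 ≤ ⌈L⌉₊ := Nat.one_le_ceil_iff.2 (by linarith)
      exact Nat.one_le_iff_ne_zero.2
        (mul_ne_zero (mul_ne_zero (by omega) (by omega)) (by omega))
    · have h1 : (⌈L⌉₊ : ℝ) ≤ 2 * L := by
        have := (Nat.ceil_lt_add_one (by linarith : 0 ≤ L)).le
        linarith
      have h2 : ((k + e + 8 : ℕ) : ℝ) ≤ (3 * k + g + 12) * L ^ k := by
        rw [he]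
        push_cast
        nlinarith [mul_le_mul_of_nonneg_left hTL (by positivity : (0 : ℝ) ≤ (k : ℝ) + 3),
          mul_le_mul_of_nonneg_left hLk (by positivity : (0 : ℝ) ≤ 2 * (k : ℝ) + g + 9)]
      have h3 : ((M + T : ℕ) : ℝ) ≤ 2 * M * L ^ k := by
        push_cast
        nlinarith [mul_le_mul hM1 hLk zero_le_one hM0.le]
      calc (((k + e + 8) * ⌈L⌉₊ * (M + T) : ℕ) : ℝ)
          = ((k + e + 8 : ℕ) : ℝ) * ⌈L⌉₊ * ((M + T : ℕ) : ℝ) := by push_cast; ring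
        _ ≤ ((3 * k + g + 12) * L ^ k) * (2 * L) * (2 * M * L ^ k) := by gcongr
        _ = M * (4 * (3 * k + g + 12) * L ^ (2 * k + 1)) := by ring
        _ ≤ M * (M : ℝ) ^ s := by gcongr
        _ = (M : ℝ) ^ (1 + s) := by rw [Real.rpow_add hM0, Real.rpow_one]
    · have hG : ((M : ℝ) ^ k + 1) * (M + 1) ≤ (M : ℝ) ^ (k + 3) := by
        have h1 : (1 : ℝ) ≤ (M : ℝ) ^ k := one_le_pow₀ hM1
        calc ((M : ℝ) ^ k + 1) * (M + 1) ≤ (2 * (M : ℝ) ^ k) * (2 * M) := by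
              gcongr <;> linarith
          _ ≤ (M * (M : ℝ) ^ k) * (M * M) := by gcongr
          _ = (M : ℝ) ^ (k + 3) := by ring
      have hVR : V * R ≤ M := (le_max_right _ _).trans hMx
      have hR0 : 0 ≤ R := zero_le_one.trans (le_max_right _ _)
      have herr : V * (((M : ℝ) ^ e)⁻¹ * T * ((((M : ℝ) ^ k + 1) * (M + 1)) ^ T * R)) ≤
          (M : ℝ) ^ (-(γ : ℝ)) := by
        calc V * (((M : ℝ) ^ e)⁻¹ * T * ((((M : ℝ) ^ k + 1) * (M + 1)) ^ T * R))
            = (V * R) * T * (((M : ℝ) ^ k + 1) * (M + 1)) ^ T * ((M : ℝ) ^ e)⁻¹ := by ring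
          _ ≤ M * (M : ℝ) ^ k * ((M : ℝ) ^ (k + 3)) ^ T * ((M : ℝ) ^ e)⁻¹ := by gcongr
          _ = ((M : ℝ) ^ g)⁻¹ := by
              have : (M : ℝ) ^ e = M * (M : ℝ) ^ k * ((M : ℝ) ^ (k + 3)) ^ T * (M : ℝ) ^ g := by
                rw [he, ← pow_mul]
                ring
              rw [this]
              field_simp
          _ = (M : ℝ) ^ (-(g : ℝ)) := by rw [Real.rpow_neg hM0.le, Real.rpow_natCast]
          _ ≤ (M : ℝ) ^ (-(γ : ℝ)) :=
              Real.rpow_le_rpow_of_exponent_le hM1 (neg_le_neg (Nat.le_ceil _))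
      linarith
  · intro f hf
    have h1 : (⨅ Φ ∈ boundedNetworks p M,
        eLpNorm (fun x => f x - Φ.toRealFun x) 2 (volume.restrict Ω)) ≤
        K * ENNReal.ofReal ((M : ℝ) ^ (-(γ : ℝ))) :=
      (le_iSup₂ (f := fun f (_ : f ∈ C) => ⨅ Φ ∈ boundedNetworks p M,
        eLpNorm (fun x => f x - Φ.toRealFun x) 2 (volume.restrict Ω)) f hf).trans hM
    have hMγ : 0 < (M : ℝ) ^ (-(γ : ℝ)) := by positivity
    -- The infimum over networks need not be attained; passing from K to K + 1 creates the strict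
    -- inequality that produces a network.
    have h2 : K * ENNReal.ofReal ((M : ℝ) ^ (-(γ : ℝ))) <
        ENNReal.ofReal ((K + 1) * (M : ℝ) ^ (-(γ : ℝ))) := by
      rw [← ENNReal.ofReal_coe_nnreal, ← ENNReal.ofReal_mul K.coe_nonneg]
      refine (ENNReal.ofReal_lt_ofReal_iff (by positivity)).2 ?_
      linarith
    obtain ⟨Φ, hΦ⟩ := iInf_lt_iff.1 (h1.trans_lt h2)
    obtain ⟨⟨n1, n2, n3, n4⟩, hlt⟩ := iInf_lt_iff.1 hΦ
    refine ⟨Φ, n1, n2, Nat.le_floor (n3.trans (hp _ hL)),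
      n4.trans (hp _ ((le_max_left _ _).trans hMx)), hlt.le⟩
  · have hMpow : M ≤ 2 ^ ⌈L⌉₊ := by
      have : (M : ℝ) ≤ 2 ^ ⌈L⌉₊ := by
        calc (M : ℝ) = (2 : ℝ) ^ L := (Real.rpow_logb two_pos (by norm_num) hM0).symm
          _ ≤ (2 : ℝ) ^ (⌈L⌉₊ : ℝ) :=
            Real.rpow_le_rpow_of_exponent_le one_le_two (Nat.le_ceil L)
          _ = 2 ^ ⌈L⌉₊ := Real.rpow_natCast _ _
      exact_mod_cast this
    have h1 : 2 + (M + 1) ^ 2 * (2 * (M ^ (k + e) + 1) + 1) ≤ M ^ (k + e + 8) := by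
      have hx : 1 ≤ M ^ (k + e) := Nat.one_le_pow _ _ (by omega)
      have e1 : M + 1 ≤ M ^ 2 := by nlinarith
      have e2 : 2 * (M ^ (k + e) + 1) + 1 ≤ M ^ (k + e) * M ^ 3 := by
        have : 2 ^ 3 ≤ M ^ 3 := Nat.pow_le_pow_left hM2 3
        nlinarith
      have e3 : (M + 1) ^ 2 * (2 * (M ^ (k + e) + 1) + 1) ≤ M ^ (k + e + 7) := by
        calc (M + 1) ^ 2 * (2 * (M ^ (k + e) + 1) + 1) ≤ (M ^ 2) ^ 2 * (M ^ (k + e) * M ^ 3) :=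
              Nat.mul_le_mul (Nat.pow_le_pow_left e1 2) e2
          _ = M ^ (k + e + 7) := by ring
      have e4 : 2 ≤ M ^ (k + e + 7) := hM2.trans (Nat.le_self_pow (by omega) M)
      calc _ ≤ M ^ (k + e + 7) + M ^ (k + e + 7) := add_le_add e4 e3
        _ = M ^ (k + e + 7) * 2 := by ring
        _ ≤ M ^ (k + e + 7) * M := Nat.mul_le_mul_left _ hM2
        _ = M ^ (k + e + 8) := by ring
    calc _ ≤ (M ^ (k + e + 8)) ^ (M + T) := Nat.pow_le_pow_left h1 _
      _ ≤ ((2 ^ ⌈L⌉₊) ^ (k + e + 8)) ^ (M + T) :=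
        Nat.pow_le_pow_left (Nat.pow_le_pow_left hMpow _) _
      _ = 2 ^ ((k + e + 8) * ⌈L⌉₊ * (M + T)) := by
        rw [← pow_mul, ← pow_mul]
        congr 1
        ring

/-- It suffices to reach every γ' < γ. The gap between the two exponents pays for the factor M^s in
the code length. -/
theorem networkRate_le_optimalExponent {Ω : Set ℝ} (hΩm : MeasurableSet Ω)
    (hΩb : Bornology.IsBounded Ω) (C : Set (L2On Ω)) : networkRate C ≤ optimalExponent C := by
  refine iSup₂_le fun γ hγ => ?_
  obtain ⟨p, hp⟩ := hγ
  refine le_of_forall_lt fun a ha => ?_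
  obtain ⟨γ', hγ'a, hγ'γ⟩ := ENNReal.lt_iff_exists_nnreal_btwn.1 ha
  refine hγ'a.trans_le ?_
  have hlt : γ' < γ := by exact_mod_cast hγ'γ
  have hγ'0 : 0 < γ' := by
    have : (0 : ℝ≥0∞) < γ' := (zero_le).trans_lt hγ'a
    exact_mod_cast this
  have hγ0 : 0 < γ := hγ'0.trans hlt
  have hγ'r : (0 : ℝ) < γ' := by exact_mod_cast hγ'0
  have hγr : (0 : ℝ) < γ := by exact_mod_cast hγ0
  have hltr : (γ' : ℝ) < γ := by exact_mod_cast hlt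
  -- Chosen so that (1+s)/γ = 1/γ'. With M = ⌈(c/ε)^(1/γ)⌉ the error is at most ε and the length
  -- M^(1+s) is O(ε^(-1/γ')).
  set s : ℝ := γ / γ' - 1 with hs
  have hs0 : 0 < s := by
    rw [hs, sub_pos, one_lt_div hγ'r]
    exact hltr
  obtain ⟨c, hc, hev⟩ := eventually_hasCode hΩm hΩb hp hs0
  have hexp : (1 / (γ : ℝ)) * (1 + s) = 1 / γ' := by
    rw [hs]
    field_simp
    ring
  refine le_iSup₂_of_le γ' ⟨hγ'0, (2 * c ^ (1 / (γ : ℝ))).toNNReal ^ (1 + s), ?_⟩ le_rfl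
  have htend : Tendsto (fun ε : ℝ => (c / ε) ^ (1 / (γ : ℝ))) (𝓝[>] 0) atTop :=
    (tendsto_rpow_atTop (by positivity)).comp
      ((tendsto_inv_nhdsGT_zero).const_mul_atTop hc)
  have htend2 : Tendsto (fun ε : ℝ => ⌈(c / ε) ^ (1 / (γ : ℝ))⌉₊) (𝓝[>] 0) atTop :=
    tendsto_nat_ceil_atTop.comp htend
  filter_upwards [htend2.eventually hev, htend.eventually_ge_atTop 1, self_mem_nhdsWithin]
    with ε hε hε1 hε0
  have hε0 : 0 < ε := hε0
  obtain ⟨ℓ, h1, h2, h3⟩ := hε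
  set y := (c / ε) ^ (1 / (γ : ℝ)) with hy
  have hy0 : 0 < y := by linarith
  have hceil : (⌈y⌉₊ : ℝ) ≤ 2 * y := by
    have := (Nat.ceil_lt_add_one hy0.le).le
    linarith
  have hcε : c * (⌈y⌉₊ : ℝ) ^ (-(γ : ℝ)) ≤ ε := by
    have k1 : (⌈y⌉₊ : ℝ) ^ (-(γ : ℝ)) ≤ y ^ (-(γ : ℝ)) :=
      Real.rpow_le_rpow_of_nonpos hy0 (Nat.le_ceil y) (by linarith)
    have k2 : y ^ (-(γ : ℝ)) = ε / c := by
      rw [hy, ← Real.rpow_mul (by positivity), show 1 / (γ : ℝ) * -γ = -1 by field_simp,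
        Real.rpow_neg_one, inv_div]
    rw [k2] at k1
    calc c * (⌈y⌉₊ : ℝ) ^ (-(γ : ℝ)) ≤ c * (ε / c) := by gcongr
      _ = ε := by field_simp
  have hlen : minimaxCodeLength C ε ≤ ℓ := iInf₂_le ℓ ⟨h1, hasCode_mono hcε h3⟩
  have hlen' : (minimaxCodeLength C ε : ℝ≥0∞) ≤ (ℓ : ℝ≥0∞) := by exact_mod_cast hlen
  refine hlen'.trans ?_
  have hreal : (ℓ : ℝ) ≤ (2 * c ^ (1 / (γ : ℝ))) ^ (1 + s) * ε ^ (-1 / (γ' : ℝ)) := by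
    calc (ℓ : ℝ) ≤ (⌈y⌉₊ : ℝ) ^ (1 + s) := h2
      _ ≤ (2 * y) ^ (1 + s) := by gcongr
      _ = (2 * c ^ (1 / (γ : ℝ))) ^ (1 + s) * ε ^ (-1 / (γ' : ℝ)) := by
        rw [hy, Real.div_rpow hc.le hε0.le, mul_div_assoc', Real.div_rpow (by positivity) (by positivity),
          ← Real.rpow_mul hε0.le, hexp, neg_div, Real.rpow_neg hε0.le, div_eq_mul_inv]
  calc (ℓ : ℝ≥0∞) = ENNReal.ofReal ℓ := (ENNReal.ofReal_natCast ℓ).symm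
    _ ≤ ENNReal.ofReal ((2 * c ^ (1 / (γ : ℝ))) ^ (1 + s) * ε ^ (-1 / (γ' : ℝ))) :=
      ENNReal.ofReal_le_ofReal hreal
    _ = _ := by
      rw [ENNReal.ofReal_mul (by positivity)]
      congr 1
      rw [ENNReal.ofReal, Real.toNNReal_rpow_of_nonneg (by positivity)]

/-! ### Approximation of B-splines in the mean -/

namespace ReLUNetwork

theorem continuous_toRealFun (Φ : ReLUNetwork 1 1) : Continuous Φ.toRealFun :=
  (continuous_apply 0).comp ((continuous_realize Φ).comp (by fun_prop))

/-- The network realizing a trapezoid of height one with support `[0, 1]` and slopes `±s`. -/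
def trapezoid (s : ℝ) : ReLUNetwork 1 1 :=
  layer (fun (_ : Fin 4) (_ : Fin 1) => s) ![0, -1, -s + 1, -s] (affine !![1, -1, -1, 1] 0)

theorem toRealFun_trapezoid (s y : ℝ) : (trapezoid s).toRealFun y =
    (max (s * y) 0 - max (s * y - 1) 0) - (max (s * y - s + 1) 0 - max (s * y - s) 0) := by
  simp [trapezoid, toRealFun, realize, affineMap, Matrix.mulVec, dotProduct, Fin.sum_univ_four]
  ring_nf

/-- The discontinuous N_1 can be approximated only in the mean. The trapezoid differs from it only
on the two ramps, each of width 1/s. The outer and inner rectifications are those that `combine`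
inserts. -/
theorem abs_trapezoid_sub_le {s : ℝ} (hs : 1 ≤ s) (z : ℝ) :
    |max ((trapezoid s).toRealFun (max z 0)) 0 - cardinalBSpline 1 z| ≤
      Set.indicator (Set.Icc 0 (1 / s) ∪ Set.Icc (1 - 1 / s) 1) 1 z := by
  have hs0 : 0 < s := by linarith
  have hss : s * (1 / s) = 1 := by field_simp
  rw [toRealFun_trapezoid, cardinalBSpline_one]
  rcases lt_or_ge z 0 with h | h
  · rw [max_eq_right h.le, Set.indicator_of_notMem (s := Set.Icc (0 : ℝ) 1) (fun h' => absurd h'.1 (not_le.2 h))]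
    rw [mul_zero, max_self, max_eq_right (by linarith : (0 : ℝ) - 1 ≤ 0),
      max_eq_right (by linarith : 0 - s + 1 ≤ 0), max_eq_right (by linarith : 0 - s ≤ 0)]
    simp only [sub_self, max_self, abs_zero]
    exact Set.indicator_nonneg (by simp) z
  rw [max_eq_left h]
  rcases lt_or_ge 1 z with h1 | h1
  · rw [Set.indicator_of_notMem (s := Set.Icc (0 : ℝ) 1) (fun h' => absurd h'.2 (not_le.2 h1))]
    have : s ≤ s * z := le_mul_of_one_le_right hs0.le h1.le
    rw [max_eq_left (by linarith : 0 ≤ s * z), max_eq_left (by linarith : 0 ≤ s * z - 1),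
      max_eq_left (by linarith : 0 ≤ s * z - s + 1), max_eq_left (by linarith : 0 ≤ s * z - s)]
    ring_nf
    rw [max_self, abs_zero]
    exact Set.indicator_nonneg (by simp) z
  rw [Set.indicator_of_mem (s := Set.Icc (0 : ℝ) 1) ⟨h, h1⟩]
  by_cases hz : z ∈ Set.Icc 0 (1 / s) ∪ Set.Icc (1 - 1 / s) 1
  · rw [Set.indicator_of_mem hz]
    simp only [Pi.one_apply]
    have b0 : 0 ≤ max (max (s * z) 0 - max (s * z - 1) 0 -
        (max (s * z - s + 1) 0 - max (s * z - s) 0)) 0 := le_max_right _ _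
    have b1 : max (max (s * z) 0 - max (s * z - 1) 0 -
        (max (s * z - s + 1) 0 - max (s * z - s) 0)) 0 ≤ 1 := by
      refine max_le ?_ zero_le_one
      have k1 : max (s * z) 0 ≤ max (s * z - 1) 0 + 1 := max_le
        (by linarith [le_max_left (s * z - 1) 0]) (by linarith [le_max_right (s * z - 1) 0])
      have k2 : max (s * z - s) 0 ≤ max (s * z - s + 1) 0 :=
        max_le_max (by linarith) le_rfl
      linarith
    rw [abs_le]
    constructor <;> linarith
  · rw [Set.indicator_of_notMem hz]
    simp only [Set.mem_union, Set.mem_Icc, not_or, not_and, not_le] at hz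
    have h2 : 1 / s < z := hz.1 h
    have h3 : z < 1 - 1 / s := by
      by_contra hc
      linarith [hz.2 (not_lt.1 hc)]
    have e1 : 1 < s * z := by nlinarith
    have e2 : s * z < s - 1 := by nlinarith
    rw [max_eq_left (by linarith : 0 ≤ s * z), max_eq_left (by linarith : 0 ≤ s * z - 1),
      max_eq_right (by linarith : s * z - s + 1 ≤ 0), max_eq_right (by linarith : s * z - s ≤ 0)]
    norm_num

theorem volume_preimage_affine_le {α : ℝ} (hα : 1 ≤ α) (β c d : ℝ) :
    volume ((fun x : ℝ => α * x + β) ⁻¹' Set.Icc c d) ≤ ENNReal.ofReal (d - c) := by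
  have hα0 : 0 < α := by linarith
  have e : (fun x : ℝ => α * x + β) ⁻¹' Set.Icc c d = Set.Icc ((c - β) / α) ((d - β) / α) := by
    ext x
    simp only [Set.mem_preimage, Set.mem_Icc, div_le_iff₀ hα0, le_div_iff₀ hα0]
    constructor <;> rintro ⟨h1, h2⟩ <;> constructor <;> linarith
  rw [e, Real.volume_Icc, ← sub_div, sub_sub_sub_cancel_right]
  rcases le_total c d with h | h
  · exact ENNReal.ofReal_le_ofReal (div_le_self (by linarith) hα)
  · rw [ENNReal.ofReal_of_nonpos (div_nonpos_of_nonpos_of_nonneg (by linarith) hα0.le)]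
    exact zero_le

/-- Approximation in `L²(Ω)` of all dilates and shifts of a B-spline by one network. -/
theorem exists_eLpNorm_approx_cardinalBSpline {m : ℕ} (hm : 1 ≤ m) :
    ∃ K : ℕ, 0 < K ∧ ∀ T : ℕ, ∃ Φ : ReLUNetwork 1 1, Φ.Nondegenerate ∧
      Φ.weightMagnitude ≤ 4 ^ T ∧ Φ.connectivity ≤ K * (T + 1) ∧
      ∀ (Ω : Set ℝ) (V : ℝ), MeasurableSet Ω → 1 ≤ V →
        volume Ω ^ (1 / 2 : ℝ) ≤ ENNReal.ofReal V → ∀ α β : ℝ, 1 ≤ α →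
        eLpNorm (fun x => max (Φ.toRealFun (max (α * x + β) 0)) 0 -
          cardinalBSpline m (α * x + β)) 2 (volume.restrict Ω) ≤
          ENNReal.ofReal (K * V * (2 ^ T)⁻¹) := by
  have h24 : ∀ T : ℕ, ((4 : ℝ) ^ T)⁻¹ = (2 ^ T)⁻¹ * (2 ^ T)⁻¹ := by
    intro T
    rw [← mul_inv, ← mul_pow]
    norm_num
  have h2 : ∀ T : ℕ, ((2 : ℝ) ^ T)⁻¹ ≤ 1 := fun T => inv_le_one_of_one_le₀ (one_le_pow₀ one_le_two)
  rcases hm.eq_or_lt with rfl | hm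
  · refine ⟨16, by norm_num, fun T => ⟨trapezoid (4 ^ T), ?_, ?_, ?_, ?_⟩⟩
    · have h4 : (4 : ℝ) ^ T ≠ 0 := by positivity
      refine ⟨fun _ => ⟨0, h4⟩, fun j => ⟨0, ?_⟩, fun i => ⟨0, ?_⟩⟩
      · fin_cases j <;> norm_num
      · fin_cases i
        norm_num
    · have h4 : (1 : ℝ) ≤ 4 ^ T := one_le_pow₀ (by norm_num)
      have h4' : (1 : ℝ≥0) ≤ 4 ^ T := one_le_pow₀ (by norm_num)
      refine sup_le (maxWeight_le_iff.2 ⟨fun _ _ => ?_, fun i => ?_⟩)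
        (maxWeight_le_iff.2 ⟨fun i j => ?_, fun i => ?_⟩)
      · simp
      · rw [← NNReal.coe_le_coe, coe_nnnorm, Real.norm_eq_abs, abs_le]
        push_cast
        fin_cases i <;> constructor <;> simp <;> linarith
      · refine le_trans ?_ h4'
        fin_cases i
        fin_cases j <;> simp
      · simp
    · have := add_le_add (nonzeroWeights_le (fun (_ : Fin 4) (_ : Fin 1) => (4 : ℝ) ^ T)
        ![0, -1, -4 ^ T + 1, -4 ^ T]) (nonzeroWeights_le !![(1 : ℝ), -1, -1, 1] 0)
      simp only [trapezoid, connectivity]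
      omega
    · intro Ω V hΩ hV1 hV α β hα
      set s : ℝ := 4 ^ T with hs
      have hs1 : 1 ≤ s := one_le_pow₀ (by norm_num)
      set S : Set ℝ := (fun x : ℝ => α * x + β) ⁻¹' Set.Icc 0 (1 / s) ∪
        (fun x : ℝ => α * x + β) ⁻¹' Set.Icc (1 - 1 / s) 1 with hS
      have hSm : MeasurableSet S := by
        have : Measurable fun x : ℝ => α * x + β := by fun_prop
        exact (this measurableSet_Icc).union (this measurableSet_Icc)
      have hSvol : volume S ≤ ENNReal.ofReal (2 * ((2 ^ T)⁻¹ * (2 ^ T)⁻¹)) := by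
        refine (measure_union_le _ _).trans ((add_le_add (volume_preimage_affine_le hα β _ _)
          (volume_preimage_affine_le hα β _ _)).trans ?_)
        rw [← h24, ← hs, ← ENNReal.ofReal_add (by simp; positivity) (by simp; positivity)]
        exact ENNReal.ofReal_le_ofReal (by rw [one_div]; linarith)
      calc _ ≤ eLpNorm (S.indicator fun _ => (1 : ℝ)) 2 (volume.restrict Ω) := by
            refine eLpNorm_mono fun x => ?_
            have h := abs_trapezoid_sub_le hs1 (α * x + β)
            rw [Real.norm_eq_abs]
            refine h.trans (le_of_eq ?_)
            rw [Real.norm_eq_abs, abs_of_nonneg (Set.indicator_nonneg (by simp) x)]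
            by_cases hx : x ∈ S
            · rw [Set.indicator_of_mem hx, Set.indicator_of_mem (by simpa [hS] using hx)]
              rfl
            · rw [Set.indicator_of_notMem hx, Set.indicator_of_notMem (by simpa [hS] using hx)]
        _ ≤ eLpNorm (S.indicator fun _ => (1 : ℝ)) 2 volume :=
            eLpNorm_mono_measure _ Measure.restrict_le_self
        _ = volume S ^ (1 / 2 : ℝ) := by
            rw [eLpNorm_indicator_const hSm two_ne_zero ENNReal.ofNat_ne_top]
            simp
        -- The factor 2 is enlarged to 4 to make the square root exact.
        _ ≤ ENNReal.ofReal (4 * ((2 ^ T)⁻¹ * (2 ^ T)⁻¹)) ^ (1 / 2 : ℝ) := by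
            refine ENNReal.rpow_le_rpow (hSvol.trans (ENNReal.ofReal_le_ofReal ?_)) (by norm_num)
            have : 0 ≤ ((2 : ℝ) ^ T)⁻¹ * (2 ^ T)⁻¹ := by positivity
            linarith
        _ = ENNReal.ofReal (2 * (2 ^ T)⁻¹) := by
            rw [show 4 * (((2 : ℝ) ^ T)⁻¹ * (2 ^ T)⁻¹) = (2 * (2 ^ T)⁻¹) ^ (2 : ℝ) by
              rw [Real.rpow_two]; ring,
              ENNReal.ofReal_rpow_of_nonneg (by positivity) (by norm_num),
              ← Real.rpow_mul (by positivity)]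
            norm_num
        _ ≤ _ := by
            refine ENNReal.ofReal_le_ofReal (mul_le_mul_of_nonneg_right ?_ (by positivity))
            push_cast
            linarith
  · obtain ⟨K, hK, h⟩ := exists_approx_cardinalBSpline hm
    refine ⟨K, hK, fun T => ?_⟩
    obtain ⟨Φ, h1, h2', h3, h4⟩ := h T
    refine ⟨Φ, h1, h2'.trans (one_le_pow₀ (by norm_num)), h3, fun Ω V hΩ hV1 hV α β hα => ?_⟩
    have hpt : ∀ z : ℝ, ‖max (Φ.toRealFun (max z 0)) 0 - cardinalBSpline m z‖ ≤
        K * (2 ^ T)⁻¹ := by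
      intro z
      -- Rectifying the input is harmless because N_m vanishes on the negative half-line.
      have hz : cardinalBSpline m z = cardinalBSpline m (max z 0) := by
        rcases le_total z 0 with hz | hz
        · rw [max_eq_right hz, cardinalBSpline_eq_zero_of_nonpos hm hz,
            cardinalBSpline_eq_zero_of_nonpos hm le_rfl]
        · rw [max_eq_left hz]
      have h5 := abs_max_sub_max_le_abs (Φ.toRealFun (max z 0)) (cardinalBSpline m (max z 0)) 0
      rw [max_eq_left (cardinalBSpline_nonneg (by omega) _)] at h5
      rw [hz, Real.norm_eq_abs]
      refine h5.trans ((h4 _).trans ?_)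
      rw [h24]
      refine mul_le_mul_of_nonneg_left ?_ (by positivity)
      exact mul_le_of_le_one_right (by positivity) (h2 T)
    refine (eLpNorm_le_of_ae_bound (C := K * (2 ^ T)⁻¹) (ae_of_all _ fun x => hpt _)).trans ?_
    rw [Measure.restrict_apply_univ, show K * V * ((2 : ℝ) ^ T)⁻¹ = V * (K * (2 ^ T)⁻¹) by ring,
      ENNReal.ofReal_mul (p := V) (by linarith)]
    refine mul_le_mul' ?_ le_rfl
    simpa using hV

/-- Approximation in `L²(Ω)` of combinations of dilated and shifted B-splines. -/
theorem exists_eLpNorm_approx_sum {m : ℕ} (hm : 1 ≤ m) :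
    ∃ K : ℕ, 0 < K ∧ ∀ {Ω : Set ℝ} {V : ℝ}, MeasurableSet Ω → 1 ≤ V →
      volume Ω ^ (1 / 2 : ℝ) ≤ ENNReal.ofReal V → ∀ {κ : Type} (J : Finset κ) (a α β : κ → ℝ)
      (A : ℝ≥0) (T : ℕ), J.Nonempty → 1 ≤ A →
      (∀ q ∈ J, |a q| ≤ A ∧ 1 ≤ α q ∧ α q ≤ A ∧ |β q| ≤ A) →
      ∃ Ψ : ReLUNetwork 1 1, Ψ.Nondegenerate ∧ Ψ.connectivity ≤ J.card * (K * (T + 1) + 3) ∧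
        Ψ.depth ≤ K * (T + 1) + 2 ∧ Ψ.weightMagnitude ≤ A ⊔ 4 ^ T ∧
        eLpNorm (fun x => ∑ q ∈ J, a q * cardinalBSpline m (α q * x + β q) - Ψ.toRealFun x) 2
          (volume.restrict Ω) ≤ ENNReal.ofReal (J.card * ((K + 1) * A * V * (2 ^ T)⁻¹)) := by
  obtain ⟨K, hK, h⟩ := exists_eLpNorm_approx_cardinalBSpline hm
  refine ⟨K, hK, fun {Ω V} hΩ hV1 hV κ J a α β A T hJ hA hJA => ?_⟩
  obtain ⟨Φ, h1, h2, h3, h4⟩ := h T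
  have hT0 : (0 : ℝ) < (2 ^ T)⁻¹ := by positivity
  have hT1 : ((2 : ℝ) ^ T)⁻¹ ≤ 1 := inv_le_one_of_one_le₀ (one_le_pow₀ one_le_two)
  have hA1 : (1 : ℝ) ≤ A := by exact_mod_cast hA
  set P := J.card with hP
  have hP0 : 0 < P := Finset.card_pos.2 hJ
  set e : J ≃ Fin P := J.equivFin with he
  -- Zero coefficients are again replaced by small non-zero ones, to preserve nondegeneracy.
  set a' : κ → ℝ := fun q => if a q = 0 then (2 ^ T)⁻¹ else a q with ha'
  have ha'0 : ∀ q, a' q ≠ 0 := by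
    intro q
    simp only [ha']
    split_ifs with h
    · exact hT0.ne'
    · exact h
  have ha'1 : ∀ q ∈ J, |a' q| ≤ A := by
    intro q hq
    simp only [ha']
    split_ifs with h
    · rw [abs_of_pos hT0]
      linarith
    · exact (hJA q hq).1
  have ha'2 : ∀ q, |a q - a' q| ≤ (2 ^ T)⁻¹ := by
    intro q
    simp only [ha']
    split_ifs with h
    · rw [h, zero_sub, abs_neg, abs_of_pos hT0]
    · rw [sub_self, abs_zero]
      exact hT0.le
  set G : ReLUNetwork 1 (P * 1) :=
    affine (fun i _ => α (e.symm i.divNat)) (fun i => β (e.symm i.divNat)) with hG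
  have hGr : ∀ (x : ℝ) (p : Fin P), G.realize (fun _ => x) (finProdFinEquiv (p, 0)) =
      α (e.symm p) * x + β (e.symm p) := by
    intro x p
    simp only [hG, realize, affineMap, Matrix.mulVec, dotProduct, Fin.sum_univ_one, Pi.add_apply,
      divNat_finProdFinEquiv]
  have hα0 : ∀ p : Fin P, α (e.symm p) ≠ 0 := fun p =>
    (zero_lt_one.trans_le (hJA _ (e.symm p).2).2.1).ne'
  have hGn : G.Nondegenerate :=
    ⟨fun _ => ⟨finProdFinEquiv (⟨0, hP0⟩, 0), hα0 _⟩, fun i => ⟨0, hα0 _⟩⟩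
  have hGw : G.weightMagnitude ≤ A := by
    refine maxWeight_le_iff.2 ⟨fun i _ => ?_, fun i => ?_⟩
    · have := hJA _ (e.symm i.divNat).2
      rw [← NNReal.coe_le_coe, coe_nnnorm, Real.norm_eq_abs, abs_of_pos (by linarith)]
      exact this.2.2.1
    · rw [← NNReal.coe_le_coe]
      exact (hJA _ (e.symm i.divNat).2).2.2.2
  have hGc : G.connectivity ≤ 2 * P := by
    refine (nonzeroWeights_le _ _).trans ?_
    omega
  refine ⟨combine G Φ fun p => a' (e.symm p),
    hGn.combine hP0 h1 fun p => ha'0 _, ?_, ?_, ?_, ?_⟩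
  · refine (connectivity_combine_le _ _ _).trans ?_
    have := Nat.mul_le_mul_left P h3
    rw [mul_add]
    omega
  · rw [depth_combine]
    -- The copies run in parallel, so the depth is that of a single one and does not depend on the
    -- number of terms.
    have hd := (h1.depth_le_connectivity one_pos).trans h3
    have hd1 : G.depth = 1 := rfl
    omega
  · refine weightMagnitude_combine_le (hGw.trans le_sup_left) (h2.trans le_sup_right) fun p => ?_
    refine le_trans ?_ (le_sup_left (a := A))
    rw [← NNReal.coe_le_coe]
    exact ha'1 _ (e.symm p).2
  · set F : κ → ℝ → ℝ := fun q x => a' q * (max (Φ.toRealFun (max (α q * x + β q) 0)) 0 -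
      cardinalBSpline m (α q * x + β q)) with hF
    set F' : κ → ℝ → ℝ := fun q x => (a q - a' q) * cardinalBSpline m (α q * x + β q) with hF'
    have hval : ∀ x, (combine G Φ fun p => a' (e.symm p)).toRealFun x =
        ∑ q ∈ J, a' q * max (Φ.toRealFun (max (α q * x + β q) 0)) 0 := by
      intro x
      rw [toRealFun, realize_combine, ← e.sum_comp, ← Finset.sum_coe_sort J]
      refine Finset.sum_congr rfl fun q _ => ?_
      rw [hGr, Equiv.symm_apply_apply]
    have hfun : (fun x => ∑ q ∈ J, a q * cardinalBSpline m (α q * x + β q) -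
        (combine G Φ fun p => a' (e.symm p)).toRealFun x) = ∑ q ∈ J, (F' q - F q) := by
      funext x
      rw [hval, ← Finset.sum_sub_distrib, Finset.sum_apply]
      refine Finset.sum_congr rfl fun q _ => ?_
      simp only [hF, hF', Pi.sub_apply]
      ring
    have hmN : ∀ q, Measurable fun x => cardinalBSpline m (α q * x + β q) := fun q =>
      (measurable_cardinalBSpline hm).comp (by fun_prop)
    have hmF : ∀ q, Measurable (F q) := by
      intro q
      have h5 : Measurable fun x => max (Φ.toRealFun (max (α q * x + β q) 0)) 0 :=
        (((continuous_toRealFun Φ).comp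
          (by fun_prop : Continuous fun x => max (α q * x + β q) 0)).max continuous_const).measurable
      exact (h5.sub (hmN q)).const_mul _
    have hmF' : ∀ q, Measurable (F' q) := fun q => (hmN q).const_mul _
    rw [hfun]
    refine (eLpNorm_sum_le (fun q _ => ((hmF' q).sub (hmF q)).aestronglyMeasurable)
      one_le_two).trans ?_
    have hterm : ∀ q ∈ J, eLpNorm (F' q - F q) 2 (volume.restrict Ω) ≤
        ENNReal.ofReal ((K + 1) * A * V * (2 ^ T)⁻¹) := by
      intro q hq
      have b1 : eLpNorm (F' q) 2 (volume.restrict Ω) ≤ ENNReal.ofReal (V * (2 ^ T)⁻¹) := by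
        refine (eLpNorm_le_of_ae_bound (C := (2 ^ T)⁻¹) (ae_of_all _ fun x => ?_)).trans ?_
        · simp only [hF']
          rw [norm_mul, Real.norm_eq_abs, Real.norm_eq_abs,
            abs_of_nonneg (cardinalBSpline_nonneg hm _)]
          exact (mul_le_mul (ha'2 q) (cardinalBSpline_le_one hm _)
            (cardinalBSpline_nonneg hm _) hT0.le).trans (by rw [mul_one])
        · rw [Measure.restrict_apply_univ, ENNReal.ofReal_mul (by linarith)]
          refine mul_le_mul' ?_ le_rfl
          simpa using hV
      have b2 : eLpNorm (F q) 2 (volume.restrict Ω) ≤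
          ENNReal.ofReal (A * (K * V * (2 ^ T)⁻¹)) := by
        have hsm : F q = a' q • fun x => (max (Φ.toRealFun (max (α q * x + β q) 0)) 0 -
            cardinalBSpline m (α q * x + β q)) := rfl
        rw [hsm, eLpNorm_const_smul, ENNReal.ofReal_mul (by linarith)]
        refine mul_le_mul' ?_ (h4 Ω V hΩ hV1 hV _ _ (hJA q hq).2.1)
        rw [Real.enorm_eq_ofReal_abs]
        exact ENNReal.ofReal_le_ofReal (ha'1 q hq)
      refine (eLpNorm_sub_le (hmF' q).aestronglyMeasurable (hmF q).aestronglyMeasurable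
        one_le_two).trans ((add_le_add b1 b2).trans ?_)
      rw [← ENNReal.ofReal_add (by positivity) (by positivity)]
      refine ENNReal.ofReal_le_ofReal ?_
      have : V * (2 ^ T)⁻¹ ≤ A * (V * (2 ^ T)⁻¹) := le_mul_of_one_le_left (by positivity) hA1
      linarith
    refine (Finset.sum_le_card_nsmul _ _ _ hterm).trans (le_of_eq ?_)
    rw [ENNReal.ofReal_mul (p := (P : ℝ)) (by positivity), ENNReal.ofReal_natCast, nsmul_eq_mul]

end ReLUNetwork

/-! ### Transition from spline wavelets to networks -/

theorem exists_finset_of_dictionaryError_le {Ω : Set ℝ} {C : Set (L2On Ω)} {φ : ℕ → L2On Ω}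
    {p : ℝ[X]} {M : ℕ} {K : ℝ≥0} {y : ℝ} (hy : 0 < y)
    (h : dictionaryError C φ p M ≤ K * ENNReal.ofReal y) {f : L2On Ω} (hf : f ∈ C) :
    ∃ (I : Finset ℕ) (c : ℕ → ℝ), I.card = M ∧ (∀ i ∈ I, (i : ℝ) + 1 ≤ p.eval (M : ℝ)) ∧
      (∀ i ∈ I, |c i| ≤ p.eval (M : ℝ)) ∧
      ‖f - ∑ i ∈ I, c i • φ i‖ₑ ≤ ENNReal.ofReal ((K + 1) * y) := by
  have h1 := (le_iSup₂ (f := fun f (_ : f ∈ C) => ⨅ (I : Finset ℕ) (c : ℕ → ℝ)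
    (_ : I.card = M ∧ (∀ i ∈ I, (i : ℝ) + 1 ≤ p.eval (M : ℝ)) ∧
      ∀ i ∈ I, |c i| ≤ p.eval (M : ℝ)), ‖f - ∑ i ∈ I, c i • φ i‖ₑ) f hf).trans h
  have h2 : K * ENNReal.ofReal y < ENNReal.ofReal ((K + 1) * y) := by
    rw [← ENNReal.ofReal_coe_nnreal, ← ENNReal.ofReal_mul K.coe_nonneg]
    exact (ENNReal.ofReal_lt_ofReal_iff (by positivity)).2 (by linarith)
  obtain ⟨I, hI⟩ := iInf_lt_iff.1 (h1.trans_lt h2)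
  obtain ⟨c, hc⟩ := iInf_lt_iff.1 hI
  obtain ⟨⟨k1, k2, k3⟩, hlt⟩ := iInf_lt_iff.1 hc
  exact ⟨I, c, k1, k2, k3, hlt.le⟩

/-- The members of a canonically ordered spline wavelet system as combinations of B-splines, with
parameters growing at most linearly with the index. -/
theorem IsCanonicalSplineDictionary.exists_expansion {m : ℕ} (hm : 1 ≤ m) {Ω : Set ℝ}
    (hΩm : MeasurableSet Ω) (hΩb : Bornology.IsBounded Ω) (hΩ : (interior Ω).Nonempty)
    {φ : ℕ → L2On Ω} (hφ : IsCanonicalSplineDictionary m Ω φ) :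
    ∃ H : ℝ, 1 ≤ H ∧ ∀ i : ℕ, ∃ (c β : ℕ → ℝ) (α : ℝ), 1 ≤ α ∧ α ≤ H * (i + 1) ∧
      (∀ n ∈ Finset.Icc 1 (3 * m - 1), |c n| ≤ H * (i + 1)) ∧
      (∀ n ∈ Finset.Icc 1 (3 * m - 1), |β n| ≤ H * (i + 1)) ∧
      φ i =ᵐ[volume.restrict Ω] fun x => ∑ n ∈ Finset.Icc 1 (3 * m - 1),
        c n * cardinalBSpline m (α * x + β n) := by
  obtain ⟨σ, -, hmono, hσ, hall⟩ := hφ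
  obtain ⟨R₀, hR₀⟩ := hΩb.exists_norm_le
  set R := max R₀ 0 with hR
  have hR0 : 0 ≤ R := le_max_right _ _
  have hΩR : ∀ x ∈ Ω, |x| ≤ R := fun x hx => (hR₀ x hx).trans (le_max_left _ _)
  obtain ⟨C, hC1, hC⟩ := exists_two_pow_splineScale_le hm hΩ hmono hall
  obtain ⟨Q, hQ1, hQ⟩ := exists_splineFun_ae_eq_sum hm
  refine ⟨C * (2 + Q + 2 * (R + 2 * m) + 3 * m), ?_, fun i => ?_⟩
  · have : (1 : ℝ) ≤ 2 + Q + 2 * (R + 2 * m) + 3 * m := by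
      linarith [(m.cast_nonneg : (0 : ℝ) ≤ m)]
    exact one_le_mul_of_one_le_of_one_le hC1 this
  obtain ⟨c, β, α, h1, h2, h3, h4, h5⟩ := hQ (σ i)
  have hm0 : (0 : ℝ) ≤ m := m.cast_nonneg
  have hs1 : (1 : ℝ) ≤ 2 ^ splineScale (σ i) := one_le_pow₀ one_le_two
  -- Listed elements are non-zero on the bounded set Ω, which bounds their shifts by a multiple of
  -- 2^scale.
  have hnz : ¬ splineFun m (σ i) =ᵐ[volume.restrict Ω] 0 := by
    intro h0
    refine (hσ i).1 ?_
    rw [Lp.eq_zero_iff_ae_eq_zero]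
    exact (hσ i).2.trans h0
  have hshift := abs_splineShift_le hm hΩR hΩm hnz
  have hbound : ∀ y : ℝ, 0 ≤ y → y ≤ 2 + Q + 2 * (R + 2 * m) + 3 * m →
      y * 2 ^ splineScale (σ i) ≤ C * (2 + Q + 2 * (R + 2 * m) + 3 * m) * (i + 1) := by
    intro y hy0 hy
    calc y * 2 ^ splineScale (σ i) ≤ (2 + Q + 2 * (R + 2 * m) + 3 * m) * (C * (i + 1)) :=
          mul_le_mul hy (hC i) (by positivity) (by linarith)
      _ = _ := by ring
  refine ⟨c, β, α, h1, h2.trans (hbound 2 (by norm_num) (by linarith)),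
    fun n hn => (h3 n hn).trans (hbound Q (by linarith) (by linarith)), fun n hn => ?_,
    (hσ i).2.trans (ae_restrict_of_ae h5)⟩
  refine (h4 n hn).trans (le_trans ?_ (hbound (2 * (R + 2 * m) + 3 * m) (by positivity)
    (by linarith)))
  have : 3 * (m : ℝ) ≤ 3 * m * 2 ^ splineScale (σ i) := le_mul_of_one_le_right (by positivity) hs1
  linarith

/-- Approximation by spline wavelets, turned into approximation by networks. -/
theorem eventually_exists_network {m : ℕ} (hm : 1 ≤ m) {Ω : Set ℝ}
    (hΩm : MeasurableSet Ω) (hΩb : Bornology.IsBounded Ω) (hΩ : (interior Ω).Nonempty)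
    {φ : ℕ → L2On Ω} (hφ : IsCanonicalSplineDictionary m Ω φ) {C : Set (L2On Ω)} {γ : ℝ≥0}
    {p : ℝ[X]} (hdec : DecaysWithRate (dictionaryError C φ p) γ) :
    ∃ (w : ℕ) (c : ℝ), 0 < c ∧ ∀ᶠ M : ℕ in atTop, ∀ f ∈ C, ∃ Ψ : ReLUNetwork 1 1,
      Ψ.Nondegenerate ∧ (Ψ.connectivity : ℝ) ≤ c * Real.logb 2 M * M ∧
      (Ψ.depth : ℝ) ≤ c * Real.logb 2 M ∧ (Ψ.weightMagnitude : ℝ) ≤ (M : ℝ) ^ w ∧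
      eLpNorm (fun x => f x - Ψ.toRealFun x) 2 (volume.restrict Ω) ≤
        ENNReal.ofReal (c * (M : ℝ) ^ (-(γ : ℝ))) := by
  obtain ⟨H, hH1, hH⟩ := hφ.exists_expansion hm hΩm hΩb hΩ
  obtain ⟨K, hK0, hK⟩ := ReLUNetwork.exists_eLpNorm_approx_sum hm
  have hfin : volume Ω ^ (1 / 2 : ℝ) ≠ ∞ :=
    ENNReal.rpow_ne_top_of_nonneg (by norm_num) hΩb.measure_lt_top.ne
  set V : ℝ := max 1 (volume Ω ^ (1 / 2 : ℝ)).toReal with hV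
  have hV1 : 1 ≤ V := le_max_left _ _
  have hVΩ : volume Ω ^ (1 / 2 : ℝ) ≤ ENNReal.ofReal V := by
    refine (ENNReal.ofReal_toReal hfin).symm.le.trans (ENNReal.ofReal_le_ofReal (le_max_right _ _))
  obtain ⟨Kd, hKd⟩ := hdec
  obtain ⟨k, x₀, hx₀, hp⟩ := exists_eval_le_pow p
  set g : ℕ := ⌈(γ : ℝ)⌉₊ with hg
  -- The total error is at most the number of terms (at most 3mM) times a constant times A·2^(-T),
  -- with A = M^(2k+1) and 2^(-T) ≤ M^(-q). One further factor M absorbs the constants, leaving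
  -- M^(-g).
  set q : ℕ := 2 * k + 3 + g with hq
  set D : ℝ := 3 * m * (K * (2 * q + 1) + 3) with hD
  have hm1 : (1 : ℝ) ≤ m := by exact_mod_cast hm
  have hK1 : (1 : ℝ) ≤ K := by exact_mod_cast hK0
  have hD0 : 0 ≤ D := by positivity
  refine ⟨4 * q, D + (Kd + 1) + 1, by positivity, ?_⟩
  filter_upwards [hKd, tendsto_natCast_atTop_atTop.eventually_ge_atTop
    (max x₀ (max H (3 * m * ((K + 1) * V)))), eventually_ge_atTop 2] with M hM hMx hM2 f hf
  have hMx0 : x₀ ≤ M := (le_max_left _ _).trans hMx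
  have hMH : H ≤ M := ((le_max_left _ _).trans (le_max_right _ _)).trans hMx
  have hMV : 3 * m * ((K + 1) * V) ≤ M := ((le_max_right _ _).trans (le_max_right _ _)).trans hMx
  have hM2' : (2 : ℝ) ≤ M := by exact_mod_cast hM2
  have hM1 : (1 : ℝ) ≤ M := by linarith
  have hM0 : (0 : ℝ) < M := by linarith
  set L := Real.logb 2 (M : ℝ) with hL
  have hL1 : 1 ≤ L := by
    rw [hL, Real.le_logb_iff_rpow_le one_lt_two hM0, Real.rpow_one]
    exact hM2'
  have hpM : p.eval (M : ℝ) ≤ (M : ℝ) ^ k := hp _ hMx0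
  obtain ⟨I, a, hI, hIi, hIa, hIf⟩ := exists_finset_of_dictionaryError_le
    (y := (M : ℝ) ^ (-(γ : ℝ))) (by positivity) hM hf
  choose c β α hα1 hα2 hc hβ hexp using hH
  set J : Finset (ℕ × ℕ) := I ×ˢ Finset.Icc 1 (3 * m - 1) with hJ
  have hJcard : J.card ≤ 3 * m * M := by
    rw [hJ, Finset.card_product, hI, Nat.card_Icc, mul_comm]
    exact Nat.mul_le_mul_right _ (by omega)
  have hJne : J.Nonempty := by
    rw [hJ, Finset.nonempty_product]
    refine ⟨Finset.card_pos.1 (by omega), ⟨1, Finset.mem_Icc.2 ⟨le_rfl, by omega⟩⟩⟩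
  -- A coefficient of the approximant, at most M^k, multiplies one of the expansion, at most H(i+1)
  -- ≤ M^(k+1).
  set A : ℝ≥0 := (M : ℝ≥0) ^ (2 * k + 1) with hA
  have hAr : (A : ℝ) = (M : ℝ) ^ (2 * k + 1) := by rw [hA]; push_cast; rfl
  have hA1 : 1 ≤ A := by
    rw [← NNReal.coe_le_coe, hAr, NNReal.coe_one]
    exact one_le_pow₀ hM1
  have hiM : ∀ i ∈ I, H * ((i : ℝ) + 1) ≤ (M : ℝ) ^ (k + 1) := by
    intro i hi
    rw [pow_succ']
    exact mul_le_mul hMH ((hIi i hi).trans hpM) (by positivity) hM0.le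
  have hle : (M : ℝ) ^ (k + 1) ≤ (M : ℝ) ^ (2 * k + 1) := pow_le_pow_right₀ hM1 (by omega)
  set T : ℕ := q * ⌈L⌉₊ with hT
  have hceil : (⌈L⌉₊ : ℝ) ≤ L + 1 := (Nat.ceil_lt_add_one (by linarith)).le
  have h2L : (2 : ℝ) ^ L = M := Real.rpow_logb two_pos (by norm_num) hM0
  have h2c1 : (M : ℝ) ≤ 2 ^ ⌈L⌉₊ := by
    calc (M : ℝ) = (2 : ℝ) ^ L := h2L.symm
      _ ≤ (2 : ℝ) ^ (⌈L⌉₊ : ℝ) := Real.rpow_le_rpow_of_exponent_le one_le_two (Nat.le_ceil L)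
      _ = 2 ^ ⌈L⌉₊ := Real.rpow_natCast _ _
  have h2c2 : (2 : ℝ) ^ ⌈L⌉₊ ≤ (M : ℝ) ^ 2 := by
    calc (2 : ℝ) ^ ⌈L⌉₊ = (2 : ℝ) ^ (⌈L⌉₊ : ℝ) := (Real.rpow_natCast _ _).symm
      _ ≤ (2 : ℝ) ^ (L + 1) := Real.rpow_le_rpow_of_exponent_le one_le_two hceil
      _ = M * 2 := by rw [Real.rpow_add two_pos, h2L, Real.rpow_one]
      _ ≤ (M : ℝ) ^ 2 := by nlinarith
  obtain ⟨Ψ, n1, n2, n3, n4, n5⟩ := hK hΩm hV1 hVΩ J (fun r => a r.1 * c r.1 r.2)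
    (fun r => α r.1) (fun r => β r.1 r.2) A T hJne hA1 (by
      rintro ⟨i, n⟩ hin
      obtain ⟨hi, hn⟩ := Finset.mem_product.1 hin
      rw [hAr]
      refine ⟨?_, hα1 i, (hα2 i).trans ((hiM i hi).trans hle),
        (hβ i n hn).trans ((hiM i hi).trans hle)⟩
      simp only
      rw [abs_mul]
      calc |a i| * |c i n| ≤ (M : ℝ) ^ k * (M : ℝ) ^ (k + 1) :=
            mul_le_mul ((hIa i hi).trans hpM) ((hc i n hn).trans (hiM i hi)) (abs_nonneg _)
              (by positivity)
        _ = (M : ℝ) ^ (2 * k + 1) := by ring)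
  have hTL : (T : ℝ) + 1 ≤ (2 * q + 1) * L := by
    rw [hT]
    push_cast
    nlinarith [mul_le_mul_of_nonneg_left hceil (q.cast_nonneg : (0 : ℝ) ≤ q),
      mul_le_mul_of_nonneg_left hL1 (q.cast_nonneg : (0 : ℝ) ≤ q)]
  have hKT : (K : ℝ) * (T + 1) + 3 ≤ (K * (2 * q + 1) + 3) * L := by
    nlinarith [mul_le_mul_of_nonneg_left hTL (by linarith : (0 : ℝ) ≤ K)]
  have hX0 : (0 : ℝ) ≤ (K * (2 * q + 1) + 3) * L := by positivity
  have hcL : D * L ≤ (D + (Kd + 1) + 1) * L :=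
    mul_le_mul_of_nonneg_right (by linarith [Kd.coe_nonneg]) (by linarith)
  refine ⟨Ψ, n1, ?_, ?_, ?_, ?_⟩
  · calc (Ψ.connectivity : ℝ) ≤ (J.card : ℝ) * (K * (T + 1) + 3) := by exact_mod_cast n2
      _ ≤ (3 * m * M) * ((K * (2 * q + 1) + 3) * L) := by
        gcongr
        exact_mod_cast hJcard
      _ = D * L * M := by rw [hD]; ring
      _ ≤ (D + (Kd + 1) + 1) * L * M := mul_le_mul_of_nonneg_right hcL hM0.le
  · calc (Ψ.depth : ℝ) ≤ K * (T + 1) + 2 := by exact_mod_cast n3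
      _ ≤ (K * (2 * q + 1) + 3) * L := by linarith
      _ ≤ (3 * m) * ((K * (2 * q + 1) + 3) * L) := le_mul_of_one_le_left hX0 (by linarith)
      _ = D * L := by rw [hD]; ring
      _ ≤ _ := hcL
  · have h4T : (4 : ℝ) ^ T ≤ (M : ℝ) ^ (4 * q) := by
      calc (4 : ℝ) ^ T = (((2 : ℝ) ^ ⌈L⌉₊) ^ 2) ^ q := by
            rw [hT, ← pow_mul, ← pow_mul, show (4 : ℝ) = 2 ^ 2 by norm_num, ← pow_mul]
            congr 1
            ring
        _ ≤ (((M : ℝ) ^ 2) ^ 2) ^ q := by gcongr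
        _ = (M : ℝ) ^ (4 * q) := by
            rw [← pow_mul, ← pow_mul]
            congr 1
            ring
    have hAq : (A : ℝ) ≤ (M : ℝ) ^ (4 * q) := by
      rw [hAr]
      exact pow_le_pow_right₀ hM1 (by omega)
    refine (NNReal.coe_le_coe.2 n4).trans ?_
    rw [NNReal.coe_max]
    refine max_le hAq ?_
    push_cast
    exact h4T
  · have hsum : (∑ i ∈ I, a i • φ i : L2On Ω) =ᵐ[volume.restrict Ω] fun x =>
        ∑ r ∈ J, a r.1 * c r.1 r.2 * cardinalBSpline m (α r.1 * x + β r.1 r.2) := by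
      have hs1 : (∑ i ∈ I, a i • φ i : L2On Ω) =ᵐ[volume.restrict Ω] fun x =>
          ∑ i ∈ I, a i * φ i x := by
        have h1 := Lp.coeFn_fun_finsetSum I (fun i => a i • φ i)
        have h2 : ∀ᵐ x ∂volume.restrict Ω, ∀ i, (a i • φ i : L2On Ω) x = a i * φ i x :=
          ae_all_iff.2 fun i => (Lp.coeFn_smul (a i) (φ i)).mono fun x hx => by
            rw [hx]; rfl
        filter_upwards [h1, h2] with x hx1 hx2
        rw [hx1]
        exact Finset.sum_congr rfl fun i _ => hx2 i
      filter_upwards [hs1, ae_all_iff.2 hexp] with x hx hx2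
      rw [hx, hJ, Finset.sum_product]
      refine Finset.sum_congr rfl fun i _ => ?_
      rw [hx2 i, Finset.mul_sum]
      exact Finset.sum_congr rfl fun n _ => by ring
    set S : L2On Ω := ∑ i ∈ I, a i • φ i with hS
    have e : (fun x => f x - Ψ.toRealFun x) =ᵐ[volume.restrict Ω] (f - S : L2On Ω) +
        fun x => ∑ r ∈ J, a r.1 * c r.1 r.2 * cardinalBSpline m (α r.1 * x + β r.1 r.2) -
          Ψ.toRealFun x := by
      filter_upwards [hsum, Lp.coeFn_sub f S] with x hx hx2
      rw [Pi.add_apply, hx2, Pi.sub_apply, hx]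
      ring
    have hmeas : Measurable fun x => ∑ r ∈ J, a r.1 * c r.1 r.2 *
        cardinalBSpline m (α r.1 * x + β r.1 r.2) - Ψ.toRealFun x := by
      refine Measurable.sub (Finset.measurable_fun_sum _ fun r _ => ?_)
        (ReLUNetwork.continuous_toRealFun Ψ).measurable
      exact ((measurable_cardinalBSpline hm).comp (by fun_prop)).const_mul _
    rw [eLpNorm_congr_ae e]
    refine (eLpNorm_add_le (Lp.aestronglyMeasurable _) hmeas.aestronglyMeasurable
      one_le_two).trans ?_
    have hSf : eLpNorm (f - S : L2On Ω) 2 (volume.restrict Ω) ≤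
        ENNReal.ofReal ((Kd + 1) * (M : ℝ) ^ (-(γ : ℝ))) := by
      rwa [← Lp.enorm_def]
    have hnum : (J.card : ℝ) * ((K + 1) * A * V * (2 ^ T)⁻¹) ≤ (M : ℝ) ^ (-(γ : ℝ)) := by
      have h2T : (M : ℝ) ^ q ≤ 2 ^ T := by
        rw [hT, mul_comm, pow_mul]
        gcongr
      calc (J.card : ℝ) * ((K + 1) * A * V * (2 ^ T)⁻¹)
          ≤ (3 * m * M) * ((K + 1) * A * V * ((M : ℝ) ^ q)⁻¹) := by
            gcongr
            exact_mod_cast hJcard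
        _ = (3 * m * ((K + 1) * V)) * M * (M : ℝ) ^ (2 * k + 1) * ((M : ℝ) ^ q)⁻¹ := by
            rw [hAr]; ring
        _ ≤ M * M * (M : ℝ) ^ (2 * k + 1) * ((M : ℝ) ^ q)⁻¹ := by gcongr
        _ = ((M : ℝ) ^ g)⁻¹ := by
            have : (M : ℝ) ^ q = M * M * (M : ℝ) ^ (2 * k + 1) * (M : ℝ) ^ g := by
              rw [hq]; ring
            rw [this]
            field_simp
        _ = (M : ℝ) ^ (-(g : ℝ)) := by rw [Real.rpow_neg hM0.le, Real.rpow_natCast]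
        _ ≤ (M : ℝ) ^ (-(γ : ℝ)) :=
            Real.rpow_le_rpow_of_exponent_le hM1 (neg_le_neg (Nat.le_ceil _))
    refine (add_le_add hSf (n5.trans (ENNReal.ofReal_le_ofReal hnum))).trans ?_
    rw [← ENNReal.ofReal_add (by positivity) (by positivity)]
    refine ENNReal.ofReal_le_ofReal ?_
    have : 0 ≤ D * (M : ℝ) ^ (-(γ : ℝ)) := by positivity
    linarith

/-- An approximant with M terms costs of order M log M weights. Spending a budget of N weights on
only about N^r terms, r < 1, leaves N^(1-r) for the logarithm and reduces the rate from γ to rγ. -/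
theorem dictionaryRate_le_networkRate {m : ℕ} (hm : 1 ≤ m) {Ω : Set ℝ}
    (hΩm : MeasurableSet Ω) (hΩb : Bornology.IsBounded Ω) (hΩ : (interior Ω).Nonempty)
    {φ : ℕ → L2On Ω} (hφ : IsCanonicalSplineDictionary m Ω φ) (C : Set (L2On Ω)) :
    dictionaryRate C φ ≤ networkRate C := by
  refine iSup₂_le fun γ hγ => ?_
  obtain ⟨p, hp⟩ := hγ
  refine le_of_forall_lt fun a ha => ?_
  obtain ⟨γ', hγ'a, hγ'γ⟩ := ENNReal.lt_iff_exists_nnreal_btwn.1 ha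
  refine hγ'a.trans_le ?_
  have hlt : γ' < γ := by exact_mod_cast hγ'γ
  have hγ'0 : 0 < γ' := by
    have : (0 : ℝ≥0∞) < γ' := (zero_le).trans_lt hγ'a
    exact_mod_cast this
  have hγ'r : (0 : ℝ) < γ' := by exact_mod_cast hγ'0
  have hltr : (γ' : ℝ) < γ := by exact_mod_cast hlt
  have hγr : (0 : ℝ) < γ := hγ'r.trans hltr
  set r : ℝ := γ' / γ with hr
  have hr0 : 0 < r := by positivity
  have hr1 : 0 < 1 - r := by
    rw [sub_pos, hr, div_lt_one hγr]
    exact hltr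
  obtain ⟨w, c, hc, hev⟩ := eventually_exists_network hm hΩm hΩb hΩ hφ hp
  -- One polynomial serves both constraints: c·X bounds the depth in terms of log N, and X^w bounds
  -- the weights. The factor 2^γ comes from ⌊N^r⌋ ≥ N^r/2.
  refine le_iSup₂_of_le γ' ⟨Polynomial.X ^ w + Polynomial.C c * Polynomial.X,
    (c * 2 ^ (γ : ℝ)).toNNReal, ?_⟩ le_rfl
  have htend : Tendsto (fun N : ℕ => (N : ℝ) ^ r) atTop atTop :=
    (tendsto_rpow_atTop hr0).comp tendsto_natCast_atTop_atTop
  have htend2 : Tendsto (fun N : ℕ => ⌊(N : ℝ) ^ r⌋₊) atTop atTop :=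
    tendsto_nat_floor_atTop.comp htend
  filter_upwards [htend2.eventually hev, htend.eventually_ge_atTop 1,
    eventually_mul_logb_pow_le c 1 hr1, eventually_ge_atTop 1] with N hN hNr hlog hN1
  have hN1' : (1 : ℝ) ≤ N := by exact_mod_cast hN1
  have hN0 : (0 : ℝ) < N := by linarith
  set M := ⌊(N : ℝ) ^ r⌋₊ with hM
  have hMle : (M : ℝ) ≤ (N : ℝ) ^ r := Nat.floor_le (by positivity)
  have hM1n : 1 ≤ M := (Nat.one_le_floor_iff _).2 hNr
  have hM1 : (1 : ℝ) ≤ M := by exact_mod_cast hM1n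
  have hM0 : (0 : ℝ) < M := by linarith
  have hMN : (M : ℝ) ≤ N := hMle.trans (Real.rpow_le_self_of_one_le hN1' (by linarith))
  have hMge : (N : ℝ) ^ r / 2 ≤ M := by
    have := Nat.lt_floor_add_one ((N : ℝ) ^ r)
    rw [← hM] at this
    linarith
  have hlogMN : Real.logb 2 M ≤ Real.logb 2 N := Real.logb_le_logb_of_le one_lt_two hM0 hMN
  have hlogN0 : 0 ≤ Real.logb 2 N := Real.logb_nonneg one_lt_two hN1'
  rw [pow_one] at hlog
  refine iSup₂_le fun f hf => ?_
  obtain ⟨Ψ, n1, n2, n3, n4, n5⟩ := hN f hf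
  have hΨ : Ψ ∈ boundedNetworks (Polynomial.X ^ w + Polynomial.C c * Polynomial.X) N := by
    refine ⟨n1, ?_, ?_, ?_⟩
    · have : (Ψ.connectivity : ℝ) ≤ N := by
        calc (Ψ.connectivity : ℝ) ≤ c * Real.logb 2 M * M := n2
          _ ≤ (N : ℝ) ^ (1 - r) * (N : ℝ) ^ r := by
            refine mul_le_mul ?_ hMle hM0.le (by positivity)
            exact (mul_le_mul_of_nonneg_left hlogMN hc.le).trans hlog
          _ = N := by rw [← Real.rpow_add hN0, sub_add_cancel, Real.rpow_one]
      exact_mod_cast this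
    · simp only [Polynomial.eval_add, Polynomial.eval_pow, Polynomial.eval_X, Polynomial.eval_mul,
        Polynomial.eval_C]
      have h1 : 0 ≤ Real.logb 2 (N : ℝ) ^ w := by positivity
      linarith [mul_le_mul_of_nonneg_left hlogMN hc.le]
    · simp only [Polynomial.eval_add, Polynomial.eval_pow, Polynomial.eval_X, Polynomial.eval_mul,
        Polynomial.eval_C]
      have h1 : (M : ℝ) ^ w ≤ (N : ℝ) ^ w := pow_le_pow_left₀ hM0.le hMN w
      have h2 : 0 ≤ c * (N : ℝ) := by positivity
      linarith
  refine (iInf₂_le Ψ hΨ).trans (n5.trans ?_)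
  have hreal : c * (M : ℝ) ^ (-(γ : ℝ)) ≤ c * 2 ^ (γ : ℝ) * (N : ℝ) ^ (-(γ' : ℝ)) := by
    rw [mul_assoc]
    refine mul_le_mul_of_nonneg_left ?_ hc.le
    calc (M : ℝ) ^ (-(γ : ℝ)) ≤ ((N : ℝ) ^ r / 2) ^ (-(γ : ℝ)) :=
          Real.rpow_le_rpow_of_nonpos (by positivity) hMge (by linarith)
      _ = 2 ^ (γ : ℝ) * (N : ℝ) ^ (-(γ' : ℝ)) := by
          rw [Real.div_rpow (by positivity) (by norm_num), ← Real.rpow_mul hN0.le,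
            show r * -(γ : ℝ) = -γ' by rw [hr]; field_simp, Real.rpow_neg two_pos.le,
            div_inv_eq_mul, mul_comm]
  refine (ENNReal.ofReal_le_ofReal hreal).trans (le_of_eq ?_)
  rw [ENNReal.ofReal_mul (by positivity)]
  rfl

end

theorem mainTheorem5 (m : ℕ) (hm : 1 ≤ m) :
    (∀ (Ω : Set ℝ), MeasurableSet Ω → Bornology.IsBounded Ω → (interior Ω).Nonempty →
      ∀ φ : ℕ → L2On Ω, IsCanonicalSplineDictionary m Ω φ →
      ∀ C : Set (L2On Ω), IsCompact C →
        OptimallyRepresentableByDictionary C φ → OptimallyRepresentableByNetworks C) ∧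
    (2 ≤ m → ∃ K : ℝ, 0 < K ∧ ∀ ε : ℝ, 0 < ε → ε < 1 / 2 →
      ∃ Φ : ReLUNetwork 1 1, Φ.Nondegenerate ∧
        (∀ x : ℝ, |Φ.toRealFun x - cardinalBSpline m x| ≤ ε) ∧
        (Φ.connectivity : ℝ) ≤ K * Real.logb 2 ε⁻¹ ∧ Φ.weightMagnitude ≤ 1) ∧
    splineWavelet m =ᵐ[volume]
      fun x => ∑ n ∈ Finset.Icc 1 (3 * m - 1),
        twoScaleCoeff m n * cardinalBSpline m (2 * x - n + 1) := by
  refine ⟨fun Ω hΩm hΩb hΩ φ hφ C _ hC => ?_,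
    fun h => ReLUNetwork.exists_approx_cardinalBSpline_logb h, splineWavelet_ae_eq hm⟩
  refine le_antisymm (networkRate_le_optimalExponent hΩm hΩb C) ?_
  rw [← show dictionaryRate C φ = optimalExponent C from hC]
  exact dictionaryRate_le_networkRate hm hΩm hΩb hΩ hφ C
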